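/- Fix $\kappa>0$ and put $a=\sqrt{2/\kappa}$, $b=\sqrt{\kappa/8}-\sqrt{2/\kappa}$. **Equations.** Let $\mathfrak X^n=\{\boldsymbol\theta\in\mathbb R^n:\theta_1<\dots<\theta_n<\theta_1+2\pi\}$. A function $\psi:\mathfrak X^n\to\mathbb C$ solves the *null vector equations* with constant $h$ if it is $C^2$ and, on $\mathfrak X^n$, for every $i=1,\dots,n$, $$\frac{\kappa}{2}\,\partial_{i}^2\psi+\sum_{j\neq i}\cot\Big(\frac{\theta_j-\theta_i}{2}\Big)\,\partial_j\psi+\Big(1-\frac6\kappa\Big)\sum_{j\ne i}\frac{1}{4\sin^2\frac{\theta_j-\theta_i}{2}}\,\psi-h\,\psi=0 .$$ It solves the *rotation equation* with constant $\omega$ if $\psi(\theta_1+t,\dots,\theta_n+t)=e^{\omega t}\,\psi(\theta_1,\dots,\theta_n)$ for all $\boldsymbol\theta\in\mathfrak X^n$ and $t\in\mathbb R$; equivalently $\sum_j\partial_j\psi=\omega\psi$. **Link patterns and contours.** A radial $(n,m)$-link pattern $\alpha\in LP(n,m)$ is a homotopy class of $m$ disjoint links joining pairs of the boundary points $e^{i\theta_1},\dots,e^{i\theta_n}$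 inside the unit disc punctured at $0$, together with disjoint rays that join the remaining $n-2m$ points to $0$, no ray meeting a link. In the angular coordinate $z=e^{i\theta}$ a link is represented by the semicircle in the upper half plane over a segment $[p,q]$ whose endpoints $p<q$ belong to the lifted points $\theta_j+2\pi\mathbb Z$. The Pochhammer contour of the link is the commutator $C_pC_qC_p^{-1}C_q^{-1}$, where $C_p,C_q$ are the counterclockwise circles of a radius $\delta$ around $p$ and $q$, joined along that semicircle; here $\delta=\delta(\boldsymbol\theta)>0$ is any continuous function that is less than half of every gap between neighbouring lifted points. For a list of $m$ links we write $\mathcal C_1,\dots,\mathcal C_m$ for their Pochhammer contours. Given charges $\sigma_1,\dots,\sigma_n$ at the points $\theta_i$ and the charge $-2a$ at each of $\zeta_1,\dots,\zeta_m$, put $$\Phi^{\boldsymbol\sigma}(\boldsymbol\theta,\boldsymbol\zeta)=\prod_{i<j}\Big(\sin\tfrac{\theta_j-\theta_i}{2}\Big)^{\sigma_i\sigma_j}\prod_{r<s}\Big(\sin\tfrac{\zeta_s-\zeta_r}{2}\Big)^{4a^2}\prod_{i,r}\Big(\sin\tfrac{\zeta_r-\theta_i}{2}\Big)^{-2a\sigma_i}.$$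 A determination of the integrals below is a choice of $\delta(\boldsymbol\theta)$ and of branches, along the contours, of the logarithms of $\sin\frac{\zeta_r-\theta_i}2$ and of $\sin\frac{\zeta_s-\zeta_r}2$ ($r<s$), continuous in $\boldsymbol\theta\in\mathfrak X^n$ and in the positions on the contours. **Theorem.** Let $\kappa>0$. In each of the following cases determinations exist, and for every determination the integral defines a function on $\mathfrak X^n$ that solves the null vector equations and the rotation equation with the stated constants. 1. (Radial ground solutions.) Let $1\le m\le n/2$, $\alpha\in LP(n,m)$, with the contours of the $m$ links of $\alpha$, and $\sigma_i=a$ for all $i$. Then $$\mathcal J^{n,m}_\alpha(\boldsymbol\theta)=\oint_{\mathcal C_1}\!\cdots\oint_{\mathcal C_m}\Phi^{\boldsymbol\sigma}(\boldsymbol\theta,\boldsymbol\zeta)\,d\zeta_m\cdots d\zeta_1:\qquad h=\frac{1-(n-2m)^2}{2\kappa},\quad \omega=0 .$$ 2. (Radial excited solutions.) Let $n$ be even, $1\le m\le n/2$, $\alpha\in LP(n,m)$, with the contours of the $m$ links of $\alpha$, $\sigma_i=a$ for all $i$, and let $A\in\mathbb C$ with $\operatorname{Im}A\ge\pi$ (so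 that the segment from $A$ to $A+2\pi$, a small circle around $0$ in the coordinate $e^{iw}$, lies above all the contours). Then $$\mathcal K^{(m,n)}_\alpha(\boldsymbol\theta)=\oint_{\mathcal C_1}\!\cdots\oint_{\mathcal C_m}\int_A^{A+2\pi}\Phi^{\boldsymbol\sigma}(\boldsymbol\theta,\boldsymbol\zeta)\prod_{i}\sin\tfrac{\theta_i-w}{2}\prod_{r}\Big(\sin\tfrac{\zeta_r-w}{2}\Big)^{-2}dw\,d\zeta_m\cdots d\zeta_1:\qquad h=\frac{1-\left(n-2m+\frac\kappa2\right)^2}{2\kappa},\quad\omega=0 .$$ 3. (Radial ground solutions with spin $\eta\in\mathbb R$.) Let $1\le m\le n/2$, $\alpha\in LP(n,m)$, with the contours of the $m$ links of $\alpha$, and $\sigma_i=a$ for all $i$. Then $$\mathcal J^{n,m}_\alpha(\boldsymbol\theta,\eta)=\oint_{\mathcal C_1}\!\cdots\oint_{\mathcal C_m}\Phi^{\boldsymbol\sigma}(\boldsymbol\theta,\boldsymbol\zeta)\prod_i e^{\frac{\eta a^2}{2}\theta_i}\prod_r e^{-\eta a^2\zeta_r}\,d\zeta_m\cdots d\zeta_1:\qquad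 h=-\frac{(n-2m)^2}{2\kappa}+\frac{1+\eta^2}{2\kappa},\quad\omega=\frac{\eta(n-2m)}{\kappa}.$$ 4. (Chordal-type solutions.) Let $n=2k$ with $k\ge1$, $\alpha\in LP(n,k)$, let $\theta_c$ be one of the points, put $\sigma_c=2b-a$ and $\sigma_i=a$ for $i\ne c$, and use the Pochhammer contours of the $k-1$ links of $\alpha$ that do not end at $\theta_c$. Then $$\mathcal L^n_\alpha(\boldsymbol\theta)=\oint_{\mathcal C_1}\!\cdots\oint_{\mathcal C_{k-1}}\Phi^{\boldsymbol\sigma}(\boldsymbol\theta,\boldsymbol\zeta)\,d\zeta_{k-1}\cdots d\zeta_1:\qquad h=\frac{(6-\kappa)(\kappa-2)}{8\kappa},\quad\omega=0 .$$ -/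

import Mathlib

open scoped BigOperators

noncomputable section

namespace RadialCoulomb

/-! ### The chamber, the null vector equations and the rotation equation -/

/-- The chamber `θ₁ < θ₂ < ⋯ < θₙ < θ₁ + 2π`. -/
def chamber (n : ℕ) : Set (Fin n → ℝ) :=
  {θ | StrictMono θ ∧ ∀ i j, θ i < θ j + 2 * Real.pi}

/-- The partial derivative `∂ⱼ f`. -/
def partialDeriv {n : ℕ} (j : Fin n) (f : (Fin n → ℝ) → ℂ) (θ : Fin n → ℝ) : ℂ :=
  deriv (fun x : ℝ => f (Function.update θ j x)) (θ j)

/-- `ψ` is a (classical) solution, on the whole chamber and for every `i`, of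
`(κ/2) ∂ᵢ²ψ + ∑_{j≠i} cot((θⱼ-θᵢ)/2) ∂ⱼψ + (1-6/κ) ∑_{j≠i} 1/(4 sin²((θⱼ-θᵢ)/2)) ψ - h ψ = 0`. -/
def SolvesNullVector {n : ℕ} (κ h : ℝ) (ψ : (Fin n → ℝ) → ℂ) : Prop :=
  ContDiffOn ℝ 2 ψ (chamber n) ∧
  ∀ θ ∈ chamber n, ∀ i : Fin n,
    (κ / 2 : ℝ) * partialDeriv i (partialDeriv i ψ) θ
      + ∑ j ∈ Finset.univ.erase i,
          ((Real.cot ((θ j - θ i) / 2) : ℝ) : ℂ) * partialDeriv j ψ θ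
      + ((1 - 6 / κ : ℝ) : ℂ) * (∑ j ∈ Finset.univ.erase i,
          ((1 / (4 * Real.sin ((θ j - θ i) / 2) ^ 2) : ℝ) : ℂ)) * ψ θ
      - (h : ℂ) * ψ θ = 0

/-- `ψ(θ₁ + t, …, θₙ + t) = e^{ω t} ψ(θ₁, …, θₙ)` for all real `t`;
equivalently `∑ⱼ ∂ⱼψ = ω ψ`. -/
def SolvesRotation {n : ℕ} (ω : ℝ) (ψ : (Fin n → ℝ) → ℂ) : Prop :=
  ∀ θ ∈ chamber n, ∀ t : ℝ,
    ψ (fun i => θ i + t) = ((Real.exp (ω * t) : ℝ) : ℂ) * ψ θ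

/-! ### Radial link patterns -/

/-- The angular positions `θ₁, …, θₙ` lifted to the universal cover: the points are indexed by
`k : ℤ`, with `lift θ (k + n) = lift θ k + 2π` and `lift θ 0 = θ 0`, …, `lift θ (n-1) = θ (n-1)`. -/
def lift {n : ℕ} [NeZero n] (θ : Fin n → ℝ) (k : ℤ) : ℝ :=
  θ (Fin.ofNat n (k % (n : ℤ)).toNat) + 2 * Real.pi * ((k / (n : ℤ) : ℤ) : ℝ)

/-- A radial `(n,m)`-link pattern, with its `m` links listed in some order.  The disc minus the
origin is uncovered by `z = e^{iθ}`; up to homotopy, a link is the arc in the upper half plane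
joining the lifted points `left r < right r`, together with all its translates by multiples of the
period, and a ray is a vertical half line.  The links have distinct endpoints, they do not cross
each other or their own translates, and no ray (from a point that is not an endpoint of a link)
crosses a link. -/
structure RadialLinkPattern (n m : ℕ) where
  left : Fin m → ℤ
  right : Fin m → ℤ
  left_mem : ∀ r, 0 ≤ left r ∧ left r < n
  left_lt_right : ∀ r, left r < right r
  left_distinct : ∀ r s, r ≠ s → ¬ left r ≡ left s [ZMOD n]
  right_distinct : ∀ r s, r ≠ s → ¬ right r ≡ right s [ZMOD n]
  left_right_distinct : ∀ r s, ¬ left r ≡ right s [ZMOD n]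
  links_disjoint : ∀ r s, ∀ k : ℤ,
    ¬ (left r < left s + k * n ∧ left s + k * n < right r ∧ right r < right s + k * n)
  rays_disjoint : ∀ r, ∀ k : ℤ, left r < k → k < right r →
    ∃ s, k ≡ left s [ZMOD n] ∨ k ≡ right s [ZMOD n]

/-! ### Pochhammer contours -/

/-- The angle under which the circle of radius `δ` around an end point of the segment `[p,q]` cuts
the semicircle in the upper half plane with diameter `[p,q]`, seen from the centre. -/
def cutAngle (p q δ : ℝ) : ℝ := 2 * Real.arcsin (δ / (q - p))

/-- The part of the semicircle with diameter `[p,q]` in the upper half plane at distance at least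
`δ` from `p` and `q`, run through from the side of `p` (`s = 0`) to the side of `q` (`s = 1`). -/
def bridge (p q δ s : ℝ) : ℂ :=
  ((p + q) / 2 : ℝ) + ((q - p) / 2 : ℝ) *
    Complex.exp (((Real.pi - cutAngle p q δ
      - s * (Real.pi - 2 * cutAngle p q δ) : ℝ) : ℂ) * Complex.I)

/-- The counterclockwise circle around the real point `x` that starts and ends at `z`. -/
def circleAround (x : ℝ) (z : ℂ) (s : ℝ) : ℂ :=
  x + (z - x) * Complex.exp (((2 * Real.pi * s : ℝ) : ℂ) * Complex.I)

/-- The Pochhammer contour `C_p C_q C_p⁻¹ C_q⁻¹`, parametrised by `[0,8]`, where `C_p` is the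
counterclockwise circle of radius `δ` around `p` and `C_q` is the counterclockwise circle of
radius `δ` around `q`, reached and left along the semicircle with diameter `[p,q]`. -/
def pochhammer (p q δ t : ℝ) : ℂ :=
  if t ≤ 1 then circleAround p (bridge p q δ 0) t
  else if t ≤ 2 then bridge p q δ (t - 1)
  else if t ≤ 3 then circleAround q (bridge p q δ 1) (t - 2)
  else if t ≤ 4 then bridge p q δ (4 - t)
  else if t ≤ 5 then circleAround p (bridge p q δ 0) (5 - t)
  else if t ≤ 6 then bridge p q δ (t - 5)
  else if t ≤ 7 then circleAround q (bridge p q δ 1) (7 - t)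
  else bridge p q δ (8 - t)

/-- The Pochhammer contour for the link with lifted endpoints `l < r`. -/
def linkContour {n : ℕ} [NeZero n] (l r : ℤ) (δ : ℝ) (θ : Fin n → ℝ) (t : ℝ) : ℂ :=
  pochhammer (lift θ l) (lift θ r) δ t

/-! ### Determinations of the Coulomb gas integrals -/

/-- The data that fix a single-valued determination, on the whole chamber, of the trigonometric
Coulomb gas integral along the Pochhammer contours of the links `(left r, right r)`:
the radius `δ` of the contours (smaller than half of every gap between neighbouring points), and,
along the contours, continuous branches of the logarithms of
`sin((ζ_r - θ_i)/2)` and of `sin((ζ_s - ζ_r)/2)`, `r < s`. -/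
structure Determination {n m : ℕ} [NeZero n] (left right : Fin m → ℤ) where
  δ : (Fin n → ℝ) → ℝ
  δ_continuous : ContinuousOn δ (chamber n)
  δ_pos : ∀ θ ∈ chamber n, 0 < δ θ
  δ_lt : ∀ θ ∈ chamber n, ∀ k : ℤ, 2 * δ θ < lift θ (k + 1) - lift θ k
  logPoint : Fin n → Fin m → (Fin n → ℝ) → ℝ → ℂ
  logPoint_continuous : ∀ i r,
    ContinuousOn (fun x : (Fin n → ℝ) × ℝ => logPoint i r x.1 x.2)
      (chamber n ×ˢ Set.Icc 0 8)
  exp_logPoint : ∀ i r, ∀ θ ∈ chamber n, ∀ t ∈ Set.Icc (0 : ℝ) 8,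
    Complex.exp (logPoint i r θ t) =
      Complex.sin ((linkContour (left r) (right r) (δ θ) θ t - θ i) / 2)
  logPair : Fin m → Fin m → (Fin n → ℝ) → ℝ → ℝ → ℂ
  logPair_continuous : ∀ r s, r < s →
    ContinuousOn (fun x : (Fin n → ℝ) × ℝ × ℝ => logPair r s x.1 x.2.1 x.2.2)
      (chamber n ×ˢ (Set.Icc 0 8 ×ˢ Set.Icc 0 8))
  exp_logPair : ∀ r s, r < s → ∀ θ ∈ chamber n,
    ∀ t ∈ Set.Icc (0 : ℝ) 8, ∀ u ∈ Set.Icc (0 : ℝ) 8,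
    Complex.exp (logPair r s θ t u) =
      Complex.sin ((linkContour (left s) (right s) (δ θ) θ u
        - linkContour (left r) (right r) (δ θ) θ t) / 2)

namespace Determination

variable {n m : ℕ} [NeZero n] {left right : Fin m → ℤ} (D : Determination (n := n) left right)

/-- The position `ζ_r` on the `r`-th contour at parameter `t`. -/
def contour (r : Fin m) (θ : Fin n → ℝ) (t : ℝ) : ℂ :=
  linkContour (left r) (right r) (D.δ θ) θ t

/-- The chosen determination of the Coulomb gas correlation
`∏_{i<j} sin((θⱼ-θᵢ)/2)^{σᵢσⱼ} ∏_{r<s} sin((ζ_s-ζ_r)/2)^{τ²} ∏_{i,r} sin((ζ_r-θᵢ)/2)^{τσᵢ}`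
with charges `σᵢ` at `θᵢ` and charge `τ` at every `ζ_r`, at the points `ζ_r` of the contours with
parameters `t r`. -/
def correlation (σ : Fin n → ℝ) (τ : ℝ) (θ : Fin n → ℝ) (t : Fin m → ℝ) : ℂ :=
  (∏ i, ∏ j ∈ Finset.Ioi i, ((Real.sin ((θ j - θ i) / 2) ^ (σ i * σ j) : ℝ) : ℂ))
    * (∏ r, ∏ s ∈ Finset.Ioi r, Complex.exp (((τ * τ : ℝ) : ℂ) * D.logPair r s θ (t r) (t s)))
    * ∏ i, ∏ r, Complex.exp (((τ * σ i : ℝ) : ℂ) * D.logPoint i r θ (t r))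

/-- `∮ ⋯ ∮ Φ(θ, ζ) g(θ, ζ) dζ₁ ⋯ dζₘ` over the Pochhammer contours, where `Φ` is the Coulomb gas
correlation and `g` is a further single-valued factor. -/
def integral (σ : Fin n → ℝ) (τ : ℝ) (g : (Fin n → ℝ) → (Fin m → ℂ) → ℂ)
    (θ : Fin n → ℝ) : ℂ :=
  ∫ t in Set.pi Set.univ (fun _ : Fin m => Set.Icc (0 : ℝ) 8),
    D.correlation σ τ θ t * g θ (fun r => D.contour r θ (t r))
      * ∏ r, deriv (D.contour r θ) (t r)

end Determination

/-! ### The four families -/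

/-- `a = √(2/κ)`. -/
def chargeA (κ : ℝ) : ℝ := Real.sqrt (2 / κ)

/-- `b = √(κ/8) - √(2/κ)`. -/
def chargeB (κ : ℝ) : ℝ := Real.sqrt (κ / 8) - Real.sqrt (2 / κ)

/-- The charges of the chordal-type solutions: `2b - a` at `θ_c` and `a` at the other points. -/
def chordalCharge {n : ℕ} (κ : ℝ) (c : Fin n) (i : Fin n) : ℝ :=
  if i = c then 2 * chargeB κ - chargeA κ else chargeA κ

section families

variable {n m : ℕ} [NeZero n] {left right : Fin m → ℤ} (D : Determination (n := n) left right)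

/-- Radial ground solution: charge `a` at every `θᵢ`, charge `-2a` at every `ζ_r`. -/
def groundSolution (κ : ℝ) : (Fin n → ℝ) → ℂ :=
  D.integral (fun _ => chargeA κ) (-2 * chargeA κ) (fun _ _ => 1)

/-- Radial excited solution: a further screening charge `2(a+b)` sits at `w`, which is integrated
over the horizontal segment from `A` to `A + 2π` (a circle around the origin in the coordinate
`e^{iw}`).  Its charge products with `a` and `-2a` are `2a(a+b) = 1` and `-4a(a+b) = -2`. -/
def excitedSolution (κ : ℝ) (A : ℂ) : (Fin n → ℝ) → ℂ :=
  D.integral (fun _ => chargeA κ) (-2 * chargeA κ) (fun θ ζ =>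
    ∫ x in (0 : ℝ)..(2 * Real.pi),
      (∏ i, Complex.sin ((θ i - (A + x)) / 2))
        * ∏ r, Complex.sin ((ζ r - (A + x)) / 2) ^ (-2 : ℤ))

/-- Radial ground solution with spin `η`: the ground correlation is multiplied by
`∏ᵢ e^{η a² θᵢ / 2} ∏_r e^{-η a² ζ_r}`. -/
def spinSolution (κ η : ℝ) : (Fin n → ℝ) → ℂ :=
  D.integral (fun _ => chargeA κ) (-2 * chargeA κ) (fun θ ζ =>
    (∏ i, Complex.exp (((η * chargeA κ ^ 2 / 2 : ℝ) : ℂ) * (θ i : ℂ)))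
      * ∏ r, Complex.exp (-((η * chargeA κ ^ 2 : ℝ) : ℂ) * ζ r))

/-- Chordal-type solution: charge `2b - a` at `θ_c`, charge `a` at the other `θᵢ`, charge `-2a` at
every `ζ_r`. -/
def chordalSolution (κ : ℝ) (c : Fin n) : (Fin n → ℝ) → ℂ :=
  D.integral (chordalCharge κ c) (-2 * chargeA κ) (fun _ _ => 1)

end families

end RadialCoulomb

end

noncomputable section

namespace RadialCoulomb

/-! ### Pochhammer contours: continuity, derivative, position -/

/-! This is the Coulomb gas method. The points and the screening variables are treated together as
charges `q l` at positions `x l`; the integrand is Φ G, where Φ is the product over pairs of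
sin((x_l - x_k)/2)^{q_l q_k} and G is single-valued and holomorphic. After division by Φ the
derivative ∂_l becomes the covariant derivative `covDeriv`, that is, ∂_l plus the logarithmic
derivative `drift` of Φ, so no branch enters the algebra.

Algebra. The subtraction formula of the cotangent collapses the double sums that the null vector
operator at x_i produces (`sum_cot_mul_drift`, `null_vector_identity`). If q²/2 - bq is (6-κ)/(2κ)
at the points and 1 at the screening charges, the operator turns G into ∑_r ∇_r(cot((x_i - x_r)/2)
G), plus a constant times G, plus terms in the sums of q_l cot and q_l cot² of (x_l - x_i)/2
(`HasExtraCharge.null_vector`). At a point of charge a these last terms drop out because κa² = 2 and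
b = κa/4 - a, and the constant is h. The spin is a factor ∏ e^{μ q_l x_l}. For the excited solutions
one more charge of weight 1 at w leaves only a w-derivative of a function that is 2π-periodic for
even n. At the special point of the chordal-type solutions the last terms survive, but they form a
sum of residues of a rational function of cotangents (`sum_residues`), and this is a further total
derivative (`covDeriv_chordalCorrection`).

Analysis. A Pochhammer contour is a commutator, so every continuous logarithm along it returns to
its value (`IsCommutatorPath.log_closed`), and total derivatives in a screening variable integrate
to zero. The radius δ(θ) is only continuous, so the contours cannot be differentiated in θ. Instead,
the contours at θ₀ and at a nearby θ are joined by straight segments with parameter s. The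
s-derivative of the integral is ∑_j (θ_j - θ₀_j) times the integral of ∇_j G, since the motion of
the contours only adds total derivatives (`hasDerivAt_defIntegral`). The mean value inequality then
gives the Fréchet derivative in θ (`hasFDerivAt_integral`): differentiation of the integral is
covariant differentiation of G.

Existence. Contours of non-crossing links avoid the points, each other and all translates, and the
chamber times the parameter space is convex; zero-free continuous functions on it have continuous
logarithms (`LinkSystem.nonempty_determination`). -/

theorem continuous_bridge {Z : Type*} [TopologicalSpace Z] {p q δ s : Z → ℝ} (hp : Continuous p)
    (hq : Continuous q) (hδ : Continuous δ) (hs : Continuous s) (h : ∀ z, p z < q z) :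
    Continuous fun z => bridge (p z) (q z) (δ z) (s z) := by
  have hc : Continuous fun z => cutAngle (p z) (q z) (δ z) := by
    unfold cutAngle
    exact continuous_const.mul (Real.continuous_arcsin.comp
      (hδ.div (hq.sub hp) fun z => (sub_pos.2 (h z)).ne'))
  unfold bridge
  fun_prop

theorem continuous_circleAround {Z : Type*} [TopologicalSpace Z] {x s : Z → ℝ} {w : Z → ℂ}
    (hx : Continuous x) (hw : Continuous w) (hs : Continuous s) :
    Continuous fun z => circleAround (x z) (w z) (s z) := by
  unfold circleAround
  fun_prop

@[simp] theorem circleAround_zero (x : ℝ) (z : ℂ) : circleAround x z 0 = z := by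
  simp [circleAround]

@[simp] theorem circleAround_one (x : ℝ) (z : ℂ) : circleAround x z 1 = z := by
  simp [circleAround, Complex.exp_two_pi_mul_I]

theorem continuous_pochhammer {Z : Type*} [TopologicalSpace Z] {p q δ t : Z → ℝ}
    (hp : Continuous p) (hq : Continuous q) (hδ : Continuous δ) (ht : Continuous t)
    (h : ∀ z, p z < q z) : Continuous fun z => pochhammer (p z) (q z) (δ z) (t z) := by
  have hb : ∀ s : Z → ℝ, Continuous s → Continuous fun z => bridge (p z) (q z) (δ z) (s z) :=
    fun s hs => continuous_bridge hp hq hδ hs h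
  have h0 := hb (fun _ => 0) continuous_const
  have h1 := hb (fun _ => 1) continuous_const
  have hcp : ∀ s : Z → ℝ, Continuous s →
      Continuous fun z => circleAround (p z) (bridge (p z) (q z) (δ z) 0) (s z) :=
    fun s hs => continuous_circleAround hp h0 hs
  have hcq : ∀ s : Z → ℝ, Continuous s →
      Continuous fun z => circleAround (q z) (bridge (p z) (q z) (δ z) 1) (s z) :=
    fun s hs => continuous_circleAround hq h1 hs
  unfold pochhammer
  refine Continuous.if_le (hcp _ ht) ?_ ht continuous_const ?_
  · refine Continuous.if_le (hb _ (by fun_prop)) ?_ ht continuous_const ?_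
    · refine Continuous.if_le (hcq _ (by fun_prop)) ?_ ht continuous_const ?_
      · refine Continuous.if_le (hb _ (by fun_prop)) ?_ ht continuous_const ?_
        · refine Continuous.if_le (hcp _ (by fun_prop)) ?_ ht continuous_const ?_
          · refine Continuous.if_le (hb _ (by fun_prop)) ?_ ht continuous_const ?_
            · refine Continuous.if_le (hcq _ (by fun_prop)) (hb _ (by fun_prop)) ht
                continuous_const ?_
              intro z hz; rw [hz]; norm_num
            · intro z hz; rw [hz]; norm_num
          · intro z hz; rw [hz]; norm_num
        · intro z hz; rw [hz]; norm_num
      · intro z hz; rw [hz]; norm_num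
    · intro z hz; rw [hz]; norm_num
  · intro z hz; rw [hz]; norm_num

/-- The derivative of `bridge` in its parameter. -/
def bridgeDeriv (p q δ s : ℝ) : ℂ :=
  ((q - p) / 2 : ℝ) * (Complex.exp (((Real.pi - cutAngle p q δ
      - s * (Real.pi - 2 * cutAngle p q δ) : ℝ) : ℂ) * Complex.I)
        * ((-(Real.pi - 2 * cutAngle p q δ) : ℝ) * Complex.I))

/-- The derivative of `circleAround` in its parameter. -/
def circleDeriv (x : ℝ) (z : ℂ) (s : ℝ) : ℂ :=
  (z - x) * (Complex.exp (((2 * Real.pi * s : ℝ) : ℂ) * Complex.I)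
    * (((2 * Real.pi : ℝ) : ℂ) * Complex.I))

theorem hasDerivAt_bridge (p q δ s : ℝ) :
    HasDerivAt (bridge p q δ) (bridgeDeriv p q δ s) s := by
  unfold bridge bridgeDeriv
  have h : HasDerivAt (fun s : ℝ => Real.pi - cutAngle p q δ
      - s * (Real.pi - 2 * cutAngle p q δ)) (-(Real.pi - 2 * cutAngle p q δ)) s := by
    simpa using ((hasDerivAt_id s).mul_const (Real.pi - 2 * cutAngle p q δ)).const_sub
      (Real.pi - cutAngle p q δ)
  exact (((h.ofReal_comp.mul_const Complex.I).cexp).const_mul _).const_add _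

theorem hasDerivAt_circleAround (x : ℝ) (z : ℂ) (s : ℝ) :
    HasDerivAt (circleAround x z) (circleDeriv x z s) s := by
  unfold circleAround circleDeriv
  have h : HasDerivAt (fun s : ℝ => 2 * Real.pi * s) (2 * Real.pi) s := by
    simpa using (hasDerivAt_id s).const_mul (2 * Real.pi)
  exact (((h.ofReal_comp.mul_const Complex.I).cexp).const_mul _).const_add _

/-- The derivative of `pochhammer` in its parameter, off the break points `1, …, 7`. -/
def pochhammerDeriv (p q δ t : ℝ) : ℂ :=
  if t ≤ 1 then circleDeriv p (bridge p q δ 0) t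
  else if t ≤ 2 then bridgeDeriv p q δ (t - 1)
  else if t ≤ 3 then circleDeriv q (bridge p q δ 1) (t - 2)
  else if t ≤ 4 then -bridgeDeriv p q δ (4 - t)
  else if t ≤ 5 then -circleDeriv p (bridge p q δ 0) (5 - t)
  else if t ≤ 6 then bridgeDeriv p q δ (t - 5)
  else if t ≤ 7 then -circleDeriv q (bridge p q δ 1) (7 - t)
  else -bridgeDeriv p q δ (8 - t)

/-- The break points of the Pochhammer contour. -/
def breakPoints : Set ℝ := {1, 2, 3, 4, 5, 6, 7}

theorem breakPoints_finite : breakPoints.Finite := by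
  unfold breakPoints
  exact Set.toFinite _

theorem hasDerivAt_ite_le {E : Type*} [NormedAddCommGroup E] [NormedSpace ℝ E] {f g : ℝ → E}
    {f' g' : E} {c t : ℝ} (hf : HasDerivAt f f' t) (hg : HasDerivAt g g' t) (h : t ≠ c) :
    HasDerivAt (fun t => if t ≤ c then f t else g t) (if t ≤ c then f' else g') t := by
  rcases lt_or_gt_of_ne h with h | h
  · rw [if_pos h.le]
    exact hf.congr_of_eventuallyEq ((eventually_lt_nhds h).mono fun x hx => if_pos hx.le)
  · rw [if_neg h.not_ge]
    exact hg.congr_of_eventuallyEq ((eventually_gt_nhds h).mono fun x hx => if_neg hx.not_ge)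

theorem hasDerivAt_pochhammer (p q δ : ℝ) {t : ℝ} (ht : t ∉ breakPoints) :
    HasDerivAt (pochhammer p q δ) (pochhammerDeriv p q δ t) t := by
  simp only [breakPoints, Set.mem_insert_iff, Set.mem_singleton_iff, not_or] at ht
  obtain ⟨h1, h2, h3, h4, h5, h6, h7⟩ := ht
  have sub : ∀ {f : ℝ → ℂ} {f' : ℂ} (c : ℝ), HasDerivAt f f' (t - c) →
      HasDerivAt (fun t => f (t - c)) f' t := fun c h => h.comp_sub_const t c
  have rev : ∀ {f : ℝ → ℂ} {f' : ℂ} (c : ℝ), HasDerivAt f f' (c - t) →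
      HasDerivAt (fun t => f (c - t)) (-f') t := fun c h => h.comp_const_sub c t
  unfold pochhammer pochhammerDeriv
  exact hasDerivAt_ite_le (hasDerivAt_circleAround _ _ _)
    (hasDerivAt_ite_le (sub 1 (hasDerivAt_bridge p q δ _))
    (hasDerivAt_ite_le (sub 2 (hasDerivAt_circleAround _ _ _))
    (hasDerivAt_ite_le (rev 4 (hasDerivAt_bridge p q δ _))
    (hasDerivAt_ite_le (rev 5 (hasDerivAt_circleAround _ _ _))
    (hasDerivAt_ite_le (sub 5 (hasDerivAt_bridge p q δ _))
    (hasDerivAt_ite_le (rev 7 (hasDerivAt_circleAround _ _ _))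
      (rev 8 (hasDerivAt_bridge p q δ _)) h7) h6) h5) h4) h3) h2) h1

theorem continuous_pochhammerDeriv {Z : Type*} [TopologicalSpace Z] {p q δ : Z → ℝ}
    (hp : Continuous p) (hq : Continuous q) (hδ : Continuous δ)
    (h : ∀ z, p z < q z) (t : ℝ) : Continuous fun z => pochhammerDeriv (p z) (q z) (δ z) t := by
  have hc : Continuous fun z => cutAngle (p z) (q z) (δ z) := by
    unfold cutAngle
    exact continuous_const.mul (Real.continuous_arcsin.comp
      (hδ.div (hq.sub hp) fun z => (sub_pos.2 (h z)).ne'))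
  have hb : ∀ s : ℝ, Continuous fun z => bridge (p z) (q z) (δ z) s :=
    fun s => continuous_bridge hp hq hδ continuous_const h
  have hb' : ∀ s : ℝ, Continuous fun z => bridgeDeriv (p z) (q z) (δ z) s := by
    intro s; unfold bridgeDeriv; fun_prop
  have hcp : ∀ s : ℝ,
      Continuous fun z => circleDeriv (p z) (bridge (p z) (q z) (δ z) 0) s := by
    intro s; have := hb 0; unfold circleDeriv; fun_prop
  have hcq : ∀ s : ℝ,
      Continuous fun z => circleDeriv (q z) (bridge (p z) (q z) (δ z) 1) s := by
    intro s; have := hb 1; unfold circleDeriv; fun_prop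
  unfold pochhammerDeriv
  split_ifs
  exacts [hcp _, hb' _, hcq _, (hb' _).neg, (hcp _).neg, hb' _, (hcq _).neg, (hb' _).neg]

theorem abs_cutAngle_le (p q δ : ℝ) : |cutAngle p q δ| ≤ Real.pi := by
  unfold cutAngle
  rw [abs_mul, abs_two]
  have := abs_le.2 ⟨Real.neg_pi_div_two_le_arcsin (δ / (q - p)), Real.arcsin_le_pi_div_two _⟩
  linarith

/-- `Real.arcsin` is clamped, so the speed is controlled by the length of the segment for every δ,
even one larger than q - p. -/
theorem norm_bridgeDeriv_le {p q : ℝ} (h : p < q) (δ s : ℝ) :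
    ‖bridgeDeriv p q δ s‖ ≤ 2 * Real.pi * (q - p) := by
  have hc := abs_le.1 (abs_cutAngle_le p q δ)
  have h1 : |-(Real.pi - 2 * cutAngle p q δ)| ≤ 3 * Real.pi :=
    abs_le.2 ⟨by linarith [Real.pi_pos], by linarith [Real.pi_pos]⟩
  unfold bridgeDeriv
  rw [norm_mul, norm_mul, norm_mul, Complex.norm_exp_ofReal_mul_I, Complex.norm_real,
    Complex.norm_real, Complex.norm_I, Real.norm_eq_abs, Real.norm_eq_abs,
    abs_of_pos (by linarith : 0 < (q - p) / 2)]
  have := mul_le_mul_of_nonneg_left h1 (by linarith : 0 ≤ (q - p) / 2)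
  nlinarith [Real.pi_pos]

theorem norm_circleDeriv (x : ℝ) (z : ℂ) (s : ℝ) :
    ‖circleDeriv x z s‖ = 2 * Real.pi * ‖z - x‖ := by
  unfold circleDeriv
  rw [norm_mul, norm_mul, norm_mul, Complex.norm_exp_ofReal_mul_I,
    Complex.norm_real, Complex.norm_I, Real.norm_eq_abs, abs_of_pos Real.two_pi_pos]
  ring

theorem norm_bridge_sub_left_le {p q : ℝ} (h : p < q) (δ s : ℝ) :
    ‖bridge p q δ s - p‖ ≤ q - p := by
  unfold bridge
  set w := Complex.exp _ with hw
  have h1 : ‖w‖ = 1 := Complex.norm_exp_ofReal_mul_I _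
  have : (((p + q) / 2 : ℝ) : ℂ) + ((q - p) / 2 : ℝ) * w - p = ((q - p) / 2 : ℝ) * (1 + w) := by
    push_cast; ring
  rw [this, norm_mul, Complex.norm_real, Real.norm_eq_abs,
    abs_of_pos (by linarith : 0 < (q - p) / 2)]
  have : ‖1 + w‖ ≤ 2 := (norm_add_le _ _).trans (by rw [h1]; norm_num)
  nlinarith

theorem norm_bridge_sub_right_le {p q : ℝ} (h : p < q) (δ s : ℝ) :
    ‖bridge p q δ s - q‖ ≤ q - p := by
  unfold bridge
  set w := Complex.exp _ with hw
  have h1 : ‖w‖ = 1 := Complex.norm_exp_ofReal_mul_I _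
  have : (((p + q) / 2 : ℝ) : ℂ) + ((q - p) / 2 : ℝ) * w - q = ((q - p) / 2 : ℝ) * (w - 1) := by
    push_cast; ring
  rw [this, norm_mul, Complex.norm_real, Real.norm_eq_abs,
    abs_of_pos (by linarith : 0 < (q - p) / 2)]
  have : ‖w - 1‖ ≤ 2 := (norm_sub_le _ _).trans (by rw [h1]; norm_num)
  nlinarith

theorem norm_pochhammerDeriv_le {p q : ℝ} (h : p < q) (δ t : ℝ) :
    ‖pochhammerDeriv p q δ t‖ ≤ 2 * Real.pi * (q - p) := by
  have hp : ∀ s, ‖circleDeriv p (bridge p q δ 0) s‖ ≤ 2 * Real.pi * (q - p) := fun s => by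
    rw [norm_circleDeriv]
    exact mul_le_mul_of_nonneg_left (norm_bridge_sub_left_le h δ 0) Real.two_pi_pos.le
  have hq : ∀ s, ‖circleDeriv q (bridge p q δ 1) s‖ ≤ 2 * Real.pi * (q - p) := fun s => by
    rw [norm_circleDeriv]
    exact mul_le_mul_of_nonneg_left (norm_bridge_sub_right_le h δ 1) Real.two_pi_pos.le
  unfold pochhammerDeriv
  split_ifs <;> simp only [norm_neg, hp, hq, norm_bridgeDeriv_le h]

/-! ### The eight pieces of the contour on closed parameter intervals -/

section evaluation

variable (p q δ : ℝ) {t : ℝ}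

theorem pochhammer_of_mem_Icc_zero_one (h : t ∈ Set.Icc (0 : ℝ) 1) :
    pochhammer p q δ t = circleAround p (bridge p q δ 0) t := by
  simp [pochhammer, h.2]

theorem pochhammer_of_mem_Icc_one_two (h : t ∈ Set.Icc (1 : ℝ) 2) :
    pochhammer p q δ t = bridge p q δ (t - 1) := by
  rcases h.1.eq_or_lt with rfl | h1
  · norm_num [pochhammer]
  · simp [pochhammer, h.2, h1.not_ge]

theorem pochhammer_of_mem_Icc_two_three (h : t ∈ Set.Icc (2 : ℝ) 3) :
    pochhammer p q δ t = circleAround q (bridge p q δ 1) (t - 2) := by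
  rcases h.1.eq_or_lt with rfl | h1
  · norm_num [pochhammer]
  · simp [pochhammer, h.2, h1.not_ge, (by linarith : 1 < t).not_ge]

theorem pochhammer_of_mem_Icc_three_four (h : t ∈ Set.Icc (3 : ℝ) 4) :
    pochhammer p q δ t = bridge p q δ (4 - t) := by
  rcases h.1.eq_or_lt with rfl | h1
  · norm_num [pochhammer]
  · simp [pochhammer, h.2, h1.not_ge, (by linarith : 1 < t).not_ge, (by linarith : 2 < t).not_ge]

theorem pochhammer_of_mem_Icc_four_five (h : t ∈ Set.Icc (4 : ℝ) 5) :
    pochhammer p q δ t = circleAround p (bridge p q δ 0) (5 - t) := by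
  rcases h.1.eq_or_lt with rfl | h1
  · norm_num [pochhammer]
  · simp [pochhammer, h.2, h1.not_ge, (by linarith : 1 < t).not_ge, (by linarith : 2 < t).not_ge,
      (by linarith : 3 < t).not_ge]

theorem pochhammer_of_mem_Icc_five_six (h : t ∈ Set.Icc (5 : ℝ) 6) :
    pochhammer p q δ t = bridge p q δ (t - 5) := by
  rcases h.1.eq_or_lt with rfl | h1
  · norm_num [pochhammer]
  · simp [pochhammer, h.2, h1.not_ge, (by linarith : 1 < t).not_ge, (by linarith : 2 < t).not_ge,
      (by linarith : 3 < t).not_ge, (by linarith : 4 < t).not_ge]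

theorem pochhammer_of_mem_Icc_six_seven (h : t ∈ Set.Icc (6 : ℝ) 7) :
    pochhammer p q δ t = circleAround q (bridge p q δ 1) (7 - t) := by
  rcases h.1.eq_or_lt with rfl | h1
  · norm_num [pochhammer]
  · simp [pochhammer, h.2, h1.not_ge, (by linarith : 1 < t).not_ge, (by linarith : 2 < t).not_ge,
      (by linarith : 3 < t).not_ge, (by linarith : 4 < t).not_ge, (by linarith : 5 < t).not_ge]

theorem pochhammer_of_mem_Icc_seven_eight (h : t ∈ Set.Icc (7 : ℝ) 8) :
    pochhammer p q δ t = bridge p q δ (8 - t) := by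
  rcases h.1.eq_or_lt with rfl | h1
  · norm_num [pochhammer]
  · simp [pochhammer, h1.not_ge, (by linarith : 1 < t).not_ge, (by linarith : 2 < t).not_ge,
      (by linarith : 3 < t).not_ge, (by linarith : 4 < t).not_ge, (by linarith : 5 < t).not_ge,
      (by linarith : 6 < t).not_ge]

end evaluation

/-! ### Commutator paths and logarithms along them -/

/-- The way in which a closed path `[0,8] → X` can be a commutator of two loops. -/
structure IsCommutatorPath {X : Type*} (γ : ℝ → X) : Prop where
  first : ∀ u ∈ Set.Icc (0 : ℝ) 1, γ (4 + u) = γ (1 - u)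
  second : ∀ u ∈ Set.Icc (0 : ℝ) 1, γ (1 + u) = γ (4 - u)
  third : ∀ u ∈ Set.Icc (0 : ℝ) 1, γ (5 + u) = γ (8 - u)
  fourth : ∀ u ∈ Set.Icc (0 : ℝ) 1, γ (6 + u) = γ (3 - u)

theorem IsCommutatorPath.comp {X Y : Type*} {γ : ℝ → X} (h : IsCommutatorPath γ) (f : X → Y) :
    IsCommutatorPath (fun t => f (γ t)) :=
  ⟨fun u hu => congrArg f (h.first u hu), fun u hu => congrArg f (h.second u hu),
    fun u hu => congrArg f (h.third u hu), fun u hu => congrArg f (h.fourth u hu)⟩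

theorem IsCommutatorPath.closed {X : Type*} {γ : ℝ → X} (h : IsCommutatorPath γ) :
    γ 8 = γ 0 := by
  have h1 := h.first 1 (by simp)
  have h2 := h.third 0 (by simp)
  norm_num at h1 h2
  rw [← h2, h1]

theorem isCommutatorPath_pochhammer (p q δ : ℝ) : IsCommutatorPath (pochhammer p q δ) := by
  constructor <;> rintro u ⟨h0, h1⟩
  · rw [pochhammer_of_mem_Icc_four_five _ _ _ ⟨by linarith, by linarith⟩,
      pochhammer_of_mem_Icc_zero_one _ _ _ ⟨by linarith, by linarith⟩]
    congr 1; ring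
  · rw [pochhammer_of_mem_Icc_one_two _ _ _ ⟨by linarith, by linarith⟩,
      pochhammer_of_mem_Icc_three_four _ _ _ ⟨by linarith, by linarith⟩]
    congr 1; ring
  · rw [pochhammer_of_mem_Icc_five_six _ _ _ ⟨by linarith, by linarith⟩,
      pochhammer_of_mem_Icc_seven_eight _ _ _ ⟨by linarith, by linarith⟩]
    congr 1; ring
  · rw [pochhammer_of_mem_Icc_six_seven _ _ _ ⟨by linarith, by linarith⟩,
      pochhammer_of_mem_Icc_two_three _ _ _ ⟨by linarith, by linarith⟩]
    congr 1; ring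

/-- Two continuous logarithms of the same function differ by a constant. -/
theorem continuousOn_log_sub_eq {f g : ℝ → ℂ} (hf : ContinuousOn f (Set.Icc 0 1))
    (hg : ContinuousOn g (Set.Icc 0 1))
    (h : ∀ u ∈ Set.Icc (0 : ℝ) 1, Complex.exp (f u) = Complex.exp (g u)) :
    f 1 - g 1 = f 0 - g 0 := by
  have hc : ContinuousOn (fun u => ((f u - g u) / (2 * Real.pi * Complex.I)).re)
      (Set.Icc 0 1) := by fun_prop
  have hi : ∀ u ∈ Set.Icc (0 : ℝ) 1, ∃ k : ℤ, f u - g u = k * (2 * Real.pi * Complex.I) := by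
    intro u hu
    obtain ⟨k, hk⟩ := Complex.exp_eq_exp_iff_exists_int.1 (h u hu)
    exact ⟨k, by rw [hk]; ring⟩
  have hne : (2 * Real.pi * Complex.I : ℂ) ≠ 0 := Complex.two_pi_I_ne_zero
  -- The difference divided by 2πi is an integer that varies continuously on an interval, hence is
  -- constant.
  choose! k hk using hi
  have hk' : ContinuousOn (fun u => (k u : ℝ)) (Set.Icc 0 1) := by
    refine hc.congr fun u hu => ?_
    simp only [hk u hu, mul_div_cancel_right₀ _ hne]
    simp
  have hconst : k 1 = k 0 := by
    have hz : ContinuousOn k (Set.Icc 0 1) := by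
      have := Int.isClosedEmbedding_coe_real.isInducing
      exact this.continuousOn_iff.2 hk'
    exact isPreconnected_Icc.constant hz (by simp) (by simp)
  rw [hk 1 (by simp), hk 0 (by simp), hconst]

/-- A continuous logarithm along a commutator returns to its value. -/
theorem IsCommutatorPath.log_closed {γ : ℝ → ℂ} (h : IsCommutatorPath γ) {f : ℝ → ℂ}
    (hf : ContinuousOn f (Set.Icc 0 8))
    (hγ : ∀ t ∈ Set.Icc (0 : ℝ) 8, Complex.exp (f t) = γ t) : f 8 = f 0 := by
  -- If the piece that starts at a runs backwards through the piece that ends at b, then the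
  -- increments of f over the two pieces cancel.
  have key : ∀ a b : ℝ, 0 ≤ a → a ≤ 7 → 1 ≤ b → b ≤ 8 →
      (∀ u ∈ Set.Icc (0 : ℝ) 1, γ (a + u) = γ (b - u)) →
      f (a + 1) - f (b - 1) = f a - f b := by
    intro a b ha ha' hb hb' hab
    have h1 : ContinuousOn (fun u => f (a + u)) (Set.Icc 0 1) :=
      hf.comp (by fun_prop) fun u hu => ⟨by linarith [hu.1], by linarith [hu.2]⟩
    have h2 : ContinuousOn (fun u => f (b - u)) (Set.Icc 0 1) :=
      hf.comp (by fun_prop) fun u hu => ⟨by linarith [hu.2], by linarith [hu.1]⟩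
    have := continuousOn_log_sub_eq h1 h2 fun u hu => by
      rw [hγ _ ⟨by linarith [hu.1], by linarith [hu.2]⟩,
        hγ _ ⟨by linarith [hu.2], by linarith [hu.1]⟩, hab u hu]
    simpa using this
  have e1 := key 4 1 (by norm_num) (by norm_num) (by norm_num) (by norm_num) h.first
  have e2 := key 1 4 (by norm_num) (by norm_num) (by norm_num) (by norm_num) h.second
  have e3 := key 5 8 (by norm_num) (by norm_num) (by norm_num) (by norm_num) h.third
  have e4 := key 6 3 (by norm_num) (by norm_num) (by norm_num) (by norm_num) h.fourth
  norm_num at e1 e2 e3 e4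
  -- The eight pieces are matched as [4,5] with [0,1], [1,2] with [3,4], [5,6] with [7,8] and [6,7]
  -- with [2,3]; the total increment over [0,8] is zero.
  linear_combination e1 + e2 + e3 + e4

/-! ### Position of the contours in the plane -/

/-- The points at distance `δ` from `p` or `q` or on the open semicircle over `[p, q]`. -/
def OnContour (p q δ : ℝ) (z : ℂ) : Prop :=
  (z.re - p) ^ 2 + z.im ^ 2 = δ ^ 2 ∨ (z.re - q) ^ 2 + z.im ^ 2 = δ ^ 2 ∨
    (0 < z.im ∧ (z.re - p) * (z.re - q) + z.im ^ 2 = 0)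

theorem bridge_re_im (p q δ s : ℝ) :
    (bridge p q δ s).re = (p + q) / 2 + (q - p) / 2 * Real.cos (Real.pi - cutAngle p q δ
      - s * (Real.pi - 2 * cutAngle p q δ)) ∧
    (bridge p q δ s).im = (q - p) / 2 * Real.sin (Real.pi - cutAngle p q δ
      - s * (Real.pi - 2 * cutAngle p q δ)) := by
  unfold bridge
  constructor <;>
  simp only [Complex.add_re, Complex.add_im, Complex.mul_re, Complex.mul_im, Complex.ofReal_re,
    Complex.ofReal_im, Complex.exp_ofReal_mul_I_re, Complex.exp_ofReal_mul_I_im] <;> ring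

theorem cutAngle_mem {p q δ : ℝ} (hδ : 0 < δ) (h : 2 * δ < q - p) :
    0 < cutAngle p q δ ∧ 2 * cutAngle p q δ < Real.pi := by
  have h0 : 0 < δ / (q - p) := div_pos hδ (by linarith)
  have h1 : δ / (q - p) < 1 / 2 := by rw [div_lt_div_iff₀ (by linarith) (by norm_num)]; linarith
  unfold cutAngle
  refine ⟨by linarith [Real.arcsin_pos.2 h0], ?_⟩
  -- The sharp bound is π/6; π/4 already keeps the two cuts apart, so that the bridge stays strictly
  -- inside the upper half circle.
  have h2 : Real.arcsin (δ / (q - p)) < Real.pi / 4 := by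
    rw [Real.arcsin_lt_iff_lt_sin' ⟨by linarith [Real.pi_pos], by linarith [Real.pi_pos]⟩,
      Real.sin_pi_div_four]
    have : (1 : ℝ) < Real.sqrt 2 := by
      rw [Real.lt_sqrt (by norm_num)]; norm_num
    linarith
  linarith

theorem onContour_bridge {p q δ s : ℝ} (hδ : 0 < δ) (h : 2 * δ < q - p)
    (hs : s ∈ Set.Icc (0 : ℝ) 1) : OnContour p q δ (bridge p q δ s) := by
  obtain ⟨h1, h2⟩ := bridge_re_im p q δ s
  obtain ⟨c1, c2⟩ := cutAngle_mem hδ h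
  refine Or.inr (Or.inr ⟨?_, ?_⟩)
  · rw [h2]
    refine mul_pos (by linarith) (Real.sin_pos_of_pos_of_lt_pi ?_ ?_) <;>
    nlinarith [hs.1, hs.2]
  · rw [h1, h2]
    linear_combination ((q - p) ^ 2 / 4) * Real.sin_sq_add_cos_sq (Real.pi - cutAngle p q δ
      - s * (Real.pi - 2 * cutAngle p q δ))

/-- Half-angle formula. A chord of the circle with diameter q - p that subtends this angle has
squared length (q-p)²/2 · (1 - cos) = δ², so the bridge begins and ends on the two small circles. -/
theorem sin_half_cutAngle {p q δ : ℝ} (hδ : 0 < δ) (h : 2 * δ < q - p) :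
    1 - Real.cos (cutAngle p q δ) = 2 * (δ / (q - p)) ^ 2 := by
  have h0 : 0 < δ / (q - p) := div_pos hδ (by linarith)
  have h1 : δ / (q - p) < 1 := by rw [div_lt_one (by linarith)]; linarith
  unfold cutAngle
  rw [Real.cos_two_mul, Real.cos_sq', Real.sin_arcsin (by linarith) h1.le]
  ring

theorem bridge_zero_sq {p q δ : ℝ} (hδ : 0 < δ) (h : 2 * δ < q - p) :
    ((bridge p q δ 0).re - p) ^ 2 + (bridge p q δ 0).im ^ 2 = δ ^ 2 := by
  obtain ⟨h1, h2⟩ := bridge_re_im p q δ 0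
  have h3 := sin_half_cutAngle hδ h
  have h4 : (q - p) * (δ / (q - p)) = δ := mul_div_cancel₀ _ (by linarith)
  simp only [zero_mul, sub_zero, Real.cos_pi_sub, Real.sin_pi_sub] at h1 h2
  rw [h1, h2]
  linear_combination ((q - p) ^ 2 / 4) * Real.sin_sq_add_cos_sq (cutAngle p q δ)
    + ((q - p) ^ 2 / 2) * h3 + ((q - p) * (δ / (q - p)) + δ) * h4

theorem bridge_one_sq {p q δ : ℝ} (hδ : 0 < δ) (h : 2 * δ < q - p) :
    ((bridge p q δ 1).re - q) ^ 2 + (bridge p q δ 1).im ^ 2 = δ ^ 2 := by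
  obtain ⟨h1, h2⟩ := bridge_re_im p q δ 1
  have h3 := sin_half_cutAngle hδ h
  have h4 : (q - p) * (δ / (q - p)) = δ := mul_div_cancel₀ _ (by linarith)
  have h5 : Real.pi - cutAngle p q δ - 1 * (Real.pi - 2 * cutAngle p q δ) = cutAngle p q δ := by
    ring
  rw [h5] at h1 h2
  rw [h1, h2]
  linear_combination ((q - p) ^ 2 / 4) * Real.sin_sq_add_cos_sq (cutAngle p q δ)
    + ((q - p) ^ 2 / 2) * h3 + ((q - p) * (δ / (q - p)) + δ) * h4

theorem circleAround_sq (x : ℝ) (z : ℂ) (s : ℝ) :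
    ((circleAround x z s).re - x) ^ 2 + (circleAround x z s).im ^ 2
      = (z.re - x) ^ 2 + z.im ^ 2 := by
  have e : ∀ w : ℂ, (w.re - x) ^ 2 + w.im ^ 2 = Complex.normSq (w - x) := fun w => by
    simp [Complex.normSq_apply]; ring
  rw [e, e]
  unfold circleAround
  rw [add_sub_cancel_left, map_mul, Complex.normSq_eq_norm_sq (Complex.exp _),
    Complex.norm_exp_ofReal_mul_I]
  simp

theorem onContour_pochhammer {p q δ t : ℝ} (hδ : 0 < δ) (h : 2 * δ < q - p)
    (ht : t ∈ Set.Icc (0 : ℝ) 8) : OnContour p q δ (pochhammer p q δ t) := by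
  have hp : ∀ s, OnContour p q δ (circleAround p (bridge p q δ 0) s) := fun s =>
    Or.inl (by rw [circleAround_sq, bridge_zero_sq hδ h])
  have hq : ∀ s, OnContour p q δ (circleAround q (bridge p q δ 1) s) := fun s =>
    Or.inr (Or.inl (by rw [circleAround_sq, bridge_one_sq hδ h]))
  have hb : ∀ s ∈ Set.Icc (0 : ℝ) 1, OnContour p q δ (bridge p q δ s) := fun s hs =>
    onContour_bridge hδ h hs
  unfold pochhammer
  split_ifs
  exacts [hp _, hb _ ⟨by linarith, by linarith⟩, hq _, hb _ ⟨by linarith, by linarith⟩, hp _,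
    hb _ ⟨by linarith, by linarith⟩, hq _, hb _ ⟨by linarith [ht.2], by linarith⟩]

/-- The circles rise to height δ and the semicircle to (q-p)/2, both below π for a link shorter than
a full turn. This keeps the contours off the line on which the extra screening charge is integrated.
-/
theorem OnContour.im_lt {p q δ : ℝ} {z : ℂ} (hz : OnContour p q δ z) (hδ : 0 < δ)
    (h : 2 * δ < q - p) (hpq : q - p < 2 * Real.pi) : z.im < Real.pi := by
  rcases hz with hz | hz | ⟨-, hz⟩
  · have : z.im ≤ δ := abs_le_of_sq_le_sq' (by nlinarith [sq_nonneg (z.re - p)]) hδ.le |>.2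
    linarith
  · have : z.im ≤ δ := abs_le_of_sq_le_sq' (by nlinarith [sq_nonneg (z.re - q)]) hδ.le |>.2
    linarith
  · have : z.im ≤ (q - p) / 2 :=
      abs_le_of_sq_le_sq' (by nlinarith [sq_nonneg (z.re - (p + q) / 2)]) (by linarith) |>.2
    linarith

/-- Circles around different points do not meet. -/
theorem circles_disjoint {a b δ x y : ℝ} (hδ : 0 < δ) (hab : 2 * δ < |a - b|)
    (h1 : (x - a) ^ 2 + y ^ 2 = δ ^ 2) (h2 : (x - b) ^ 2 + y ^ 2 = δ ^ 2) : False := by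
  have h3 := abs_le_of_sq_le_sq' (by nlinarith [sq_nonneg y] : (x - a) ^ 2 ≤ δ ^ 2) hδ.le
  have h4 := abs_le_of_sq_le_sq' (by nlinarith [sq_nonneg y] : (x - b) ^ 2 ≤ δ ^ 2) hδ.le
  have : |a - b| ≤ 2 * δ := abs_le.2 ⟨by linarith, by linarith⟩
  linarith

/-- A circle around a point other than `p`, `q` does not meet the semicircle over `[p, q]`. -/
theorem circle_semicircle_disjoint {a p q δ x y : ℝ} (hδ : 0 < δ) (hp : 2 * δ < |a - p|)
    (hq : 2 * δ < |a - q|) (h1 : (x - a) ^ 2 + y ^ 2 = δ ^ 2)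
    (h2 : (x - p) * (x - q) + y ^ 2 = 0) : False := by
  have h3 := abs_le_of_sq_le_sq' (by nlinarith [sq_nonneg y] : (x - a) ^ 2 ≤ δ ^ 2) hδ.le
  have h4 : (x - p) * (x - q) = (x - a) ^ 2 - δ ^ 2 := by linarith
  -- If a lies on the same side of p and q, then (x-p)(x-q) is positive, although it equals -y². If
  -- a lies between them, both x-p and q-x exceed δ, so y² = (x-p)(q-x) > δ², which is too high for
  -- the circle.
  rcases lt_abs.1 hp with hp | hp <;> rcases lt_abs.1 hq with hq | hq
  · nlinarith [mul_pos (by linarith : 0 < x - p - δ) (by linarith : 0 < x - q - δ),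
      mul_pos hδ (by linarith : 0 < x - p), mul_pos hδ (by linarith : 0 < x - q), sq_nonneg y]
  · nlinarith [mul_pos (by linarith : 0 < x - p - δ) (by linarith : 0 < q - x - δ),
      sq_nonneg (x - a)]
  · nlinarith [mul_pos (by linarith : 0 < p - x - δ) (by linarith : 0 < x - q - δ),
      sq_nonneg (x - a)]
  · nlinarith [mul_pos (by linarith : 0 < p - x - δ) (by linarith : 0 < q - x - δ),
      mul_pos hδ (by linarith : 0 < p - x), mul_pos hδ (by linarith : 0 < q - x), sq_nonneg y]

/-- Semicircles over disjoint or nested segments do not meet. -/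
theorem semicircles_disjoint {p q p' q' x y : ℝ} (hpq : p < q) (hpq' : p' < q') (hy : 0 < y)
    (h : q ≤ p' ∨ q' ≤ p ∨ (p < p' ∧ q' < q) ∨ (p' < p ∧ q < q'))
    (h1 : (x - p) * (x - q) + y ^ 2 = 0) (h2 : (x - p') * (x - q') + y ^ 2 = 0) : False := by
  have mem : ∀ {a b : ℝ}, a < b → (x - a) * (x - b) + y ^ 2 = 0 → a < x ∧ x < b := by
    intro a b hab e
    have : (x - a) * (x - b) < 0 := by nlinarith [pow_pos hy 2]
    rcases mul_neg_iff.1 this with h | h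
    · exact ⟨by linarith, by linarith⟩
    · exact absurd h.1 (by linarith)
  have m1 := mem hpq h1
  have m2 := mem hpq' h2
  -- A point of an open semicircle lies over the open segment, which settles the disjoint cases. For
  -- nested segments the heights y² = (x-p)(q-x) and y² = (x-p')(q'-x) are strictly ordered.
  rcases h with h | h | h | h
  · linarith
  · linarith
  · nlinarith [mul_pos (by linarith : 0 < p' - p) (by linarith : 0 < q' - x),
      mul_pos (by linarith : 0 < x - p) (by linarith : 0 < q - q')]
  · nlinarith [mul_pos (by linarith : 0 < p - p') (by linarith : 0 < q - x),
      mul_pos (by linarith : 0 < x - p') (by linarith : 0 < q' - q)]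

end RadialCoulomb
end

noncomputable section

namespace RadialCoulomb

open MeasureTheory Filter Topology Set

/-! ### Integrals over the parameter cube -/

/-- The cube `[0,8]^m` of contour parameters. -/
def cube (m : ℕ) : Set (Fin m → ℝ) := Set.pi Set.univ fun _ => Set.Icc 0 8

theorem isCompact_cube (m : ℕ) : IsCompact (cube m) := isCompact_univ_pi fun _ => isCompact_Icc

theorem mem_cube {m : ℕ} {t : Fin m → ℝ} : t ∈ cube m ↔ ∀ r, t r ∈ Set.Icc (0 : ℝ) 8 := by
  simp only [cube, Set.mem_univ_pi]

theorem measurableSet_cube (m : ℕ) : MeasurableSet (cube m) :=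
  MeasurableSet.univ_pi fun _ => measurableSet_Icc

theorem update_mem_cube {m : ℕ} {t : Fin m → ℝ} (ht : t ∈ cube m) (r : Fin m) {τ : ℝ}
    (hτ : τ ∈ Set.Icc (0 : ℝ) 8) : Function.update t r τ ∈ cube m := by
  rw [mem_cube] at *
  intro s
  rcases eq_or_ne s r with rfl | h
  · simpa using hτ
  · simpa [h] using ht s

theorem ae_cube_notMem {m : ℕ} {S : Set ℝ} (hS : S.Countable) :
    ∀ᵐ t ∂(volume.restrict (cube m)), t ∈ cube m ∧ ∀ r, t r ∉ S := by
  refine (ae_restrict_mem (measurableSet_cube m)).and (ae_restrict_of_ae ?_)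
  rw [ae_all_iff]
  intro r
  have : ∀ᵐ t : Fin m → ℝ, ∀ c ∈ S, t r ≠ c := by
    rw [ae_ball_iff hS]
    intro c _
    exact Measure.ae_eval_ne (μ := fun _ : Fin m => (volume : Measure ℝ)) r c
  filter_upwards [this] with t ht h
  exact ht _ h rfl

/-- The integral of a derivative in the direction of a closed contour vanishes. -/
theorem integral_cube_deriv_eq_zero {m : ℕ} (r : Fin m) {u v : (Fin m → ℝ) → ℂ} {S : Set ℝ}
    (hS : S.Countable)
    (hc : ∀ t ∈ cube m, ContinuousOn (fun τ => u (Function.update t r τ)) (Set.Icc 0 8))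
    (hd : ∀ t ∈ cube m, ∀ τ ∈ Set.Ioo (0 : ℝ) 8 \ S,
      HasDerivAt (fun τ => u (Function.update t r τ)) (v (Function.update t r τ)) τ)
    (hcl : ∀ t ∈ cube m, u (Function.update t r 8) = u (Function.update t r 0))
    (hi : IntegrableOn v (cube m)) : ∫ t in cube m, v t = 0 := by
  obtain _ | m := m
  · exact r.elim0
  set e := MeasurableEquiv.piFinSuccAbove (fun _ : Fin (m + 1) => ℝ) r with he
  have hmp : MeasurePreserving e.symm (volume.prod volume) volume :=
    (volume_preserving_piFinSuccAbove (fun _ : Fin (m + 1) => ℝ) r).symm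
  have hesymm : ∀ z : ℝ × (Fin m → ℝ), e.symm z = r.insertNth z.1 z.2 := fun z => rfl
  have hpre : e.symm ⁻¹' (cube (m + 1)) = Set.Icc 0 8 ×ˢ cube m := by
    ext z
    rw [mem_preimage, hesymm, mem_cube, mem_prod, mem_cube, Fin.forall_iff_succAbove r]
    simp
  have hmp' : MeasurePreserving e.symm ((volume.restrict (Set.Icc 0 8)).prod
      (volume.restrict (cube m))) (volume.restrict (cube (m + 1))) := by
    rw [Measure.prod_restrict, ← hpre]
    exact hmp.restrict_preimage_emb e.symm.measurableEmbedding _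
  have hi' : Integrable (fun z => v (e.symm z)) ((volume.restrict (Set.Icc 0 8)).prod
      (volume.restrict (cube m))) :=
    (hmp'.integrable_comp_emb e.symm.measurableEmbedding).2 hi
  -- Fubini with the r-th parameter innermost: for almost all values of the others the inner
  -- integral is an increment of u around a closed curve, by the fundamental theorem of calculus off
  -- the countable set S.
  rw [← hmp'.integral_comp e.symm.measurableEmbedding, integral_prod_symm _ hi']
  refine integral_eq_zero_of_ae ?_
  filter_upwards [hi'.prod_left_ae, ae_restrict_mem (measurableSet_cube m)] with t hti ht
  have hupd : ∀ τ, e.symm (τ, t) = Function.update (r.insertNth (0 : ℝ) t) r τ := fun τ => by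
    rw [hesymm]; simp
  have htc : r.insertNth (0 : ℝ) t ∈ cube (m + 1) := by
    rw [mem_cube, Fin.forall_iff_succAbove r]
    rw [mem_cube] at ht
    simpa using ht
  simp only [hupd] at hti ⊢
  rw [integral_Icc_eq_integral_Ioc, ← intervalIntegral.integral_of_le (by norm_num),
    integral_eq_of_hasDerivAt_off_countable _ _ hS
      (by rw [uIcc_of_le (by norm_num)]; exact hc _ htc)
      (by rw [min_eq_left (by norm_num), max_eq_right (by norm_num)]; exact hd _ htc),
    hcl _ htc, sub_self, Pi.zero_apply]
  · rw [intervalIntegrable_iff_integrableOn_Icc_of_le (by norm_num)]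
    exact hti

theorem integrableOn_cube_mul {m : ℕ} {f w : (Fin m → ℝ) → ℂ} (hf : ContinuousOn f (cube m))
    (hw : AEStronglyMeasurable w (volume.restrict (cube m))) {C : ℝ}
    (hC : ∀ᵐ t ∂(volume.restrict (cube m)), ‖w t‖ ≤ C) :
    IntegrableOn (fun t => f t * w t) (cube m) :=
  (hf.integrableOn_compact (isCompact_cube m)).mul_bdd hw hC

/-- The exponent is m rather than the size of s, thanks to 1 ≤ C, so one bound serves the full
product of speeds and the product with one factor left out. -/
theorem norm_prod_le_pow {m : ℕ} (s : Finset (Fin m)) {d : Fin m → ℂ} {C : ℝ} (hC : 1 ≤ C)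
    (h : ∀ r, ‖d r‖ ≤ C) : ‖∏ r ∈ s, d r‖ ≤ C ^ m := by
  rw [norm_prod]
  calc ∏ r ∈ s, ‖d r‖ ≤ ∏ _r ∈ s, C := Finset.prod_le_prod (fun _ _ => norm_nonneg _) fun r _ => h r
    _ = C ^ s.card := by simp
    _ ≤ C ^ m := pow_le_pow_right₀ hC (by simpa using s.card_le_univ)

/-! ### Coulomb gas drift and covariant derivatives -/

/-- The logarithmic derivative in `x l` of `∏ sin((x l - x k)/2)^{q l q k}`. -/
def drift {ι : Type*} [Fintype ι] (q : ι → ℝ) (x : ι → ℂ) (l : ι) : ℂ :=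
  ∑ k, ((q l * q k / 2 : ℝ) : ℂ) * Complex.cot ((x l - x k) / 2)

/-- The derivative in `x l` of `Φ G`, divided by the Coulomb gas correlation `Φ`. -/
def covDeriv {ι : Type*} [Fintype ι] [DecidableEq ι] (q : ι → ℝ) (l : ι) (G : (ι → ℂ) → ℂ)
    (x : ι → ℂ) : ℂ :=
  fderiv ℂ G x (Pi.single l 1) + drift q x l * G x

/-- A continuous half logarithm of `sin²` is differentiable. -/
theorem hasDerivAt_of_exp_eq_sin_sq {L X : ℝ → ℂ} {X' : ℂ} {τ : ℝ} (hL : ContinuousAt L τ)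
    (hX : HasDerivAt X X' τ)
    (h : ∀ᶠ σ in 𝓝 τ, Complex.exp (2 * L σ) = Complex.sin (X σ / 2) ^ 2) :
    HasDerivAt L (X' / 2 * Complex.cot (X τ / 2)) τ := by
  have hτ := h.self_of_nhds
  have hne : Complex.sin (X τ / 2) ≠ 0 := fun h0 => by
    rw [h0] at hτ; simp [Complex.exp_ne_zero] at hτ
  have hE : HasDerivAt (fun σ => Complex.sin (X σ / 2) ^ 2 / Complex.sin (X τ / 2) ^ 2)
      (2 * Complex.sin (X τ / 2) * (Complex.cos (X τ / 2) * (X' / 2))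
        / Complex.sin (X τ / 2) ^ 2) τ := by
    have h1 := (Complex.hasDerivAt_sin (X τ / 2)).comp τ (hX.div_const 2)
    simpa using (h1.pow 2).div_const (Complex.sin (X τ / 2) ^ 2)
  -- The quotient by the value at τ equals 1 at τ, where the principal logarithm is smooth.
  have hlog := hE.clog_real (by
    rw [div_self (pow_ne_zero 2 hne)]; exact Complex.one_mem_slitPlane)
  rw [div_self (pow_ne_zero 2 hne), div_one] at hlog
  have hlog' := (hlog.div_const 2).const_add (L τ)
  -- Continuity of L confines 2(L σ - L τ) to the strip in which the principal logarithm inverts the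
  -- exponential. Working with sin² allows one logarithm for both orders of a pair, whatever the
  -- sign of the sine.
  have hsmall : ∀ᶠ σ in 𝓝 τ, ‖2 * L σ - 2 * L τ‖ < Real.pi := by
    have : Tendsto (fun σ => ‖2 * L σ - 2 * L τ‖) (𝓝 τ) (𝓝 ‖2 * L τ - 2 * L τ‖) :=
      ((continuousAt_const.mul hL).sub continuousAt_const).norm
    rw [sub_self, norm_zero] at this
    exact this.eventually_lt_const Real.pi_pos
  have heq : L =ᶠ[𝓝 τ] fun σ => L τ
      + Complex.log (Complex.sin (X σ / 2) ^ 2 / Complex.sin (X τ / 2) ^ 2) / 2 := by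
    filter_upwards [h, hsmall] with σ h1 h2
    rw [← h1, ← hτ, ← Complex.exp_sub]
    have := (Complex.abs_im_le_norm _).trans_lt h2
    rw [abs_lt] at this
    rw [Complex.log_exp this.1 this.2.le]
    ring
  refine (hlog'.congr_of_eventuallyEq heq).congr_deriv ?_
  rw [Complex.cot_eq_cos_div_sin]
  field_simp

section lifted

variable {ι : Type*} [Fintype ι]

/-- The Coulomb gas correlation with the logarithms `L l k` of `± sin((x l - x k)/2)`. -/
def expWeight (q : ι → ℝ) (L : ι → ι → ℂ) : ℂ :=
  Complex.exp (1 / 2 * ∑ l, ∑ k, ((q l * q k : ℝ) : ℂ) * L l k)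

theorem continuousOn_expWeight {X : Type*} [TopologicalSpace X] {s : Set X} (q : ι → ℝ)
    {L : ι → ι → X → ℂ} (hL : ∀ l k, ContinuousOn (L l k) s) :
    ContinuousOn (fun x => expWeight q fun l k => L l k x) s := by
  unfold expWeight
  fun_prop

/-- The cotangent is odd, so the x'_l and the x'_k parts of the double sum agree; this doubling
absorbs the factor 1/2 with which `expWeight` counts ordered pairs. -/
theorem sum_sum_antisymm (q : ι → ℝ) (x x' : ι → ℂ) :
    (1 / 2 * ∑ l, ∑ k, ((q l * q k : ℝ) : ℂ) * ((x' l - x' k) / 2 *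
      Complex.cot ((x l - x k) / 2))) = ∑ l, x' l * drift q x l := by
  have h1 : ∑ l, ∑ k, ((q l * q k : ℝ) : ℂ) * ((x' l - x' k) / 2 * Complex.cot ((x l - x k) / 2))
      = ∑ l, x' l * drift q x l
        + ∑ l, ∑ k, x' k * (((q k * q l / 2 : ℝ) : ℂ) * Complex.cot ((x k - x l) / 2)) := by
    rw [← Finset.sum_add_distrib]
    refine Finset.sum_congr rfl fun l _ => ?_
    rw [drift, Finset.mul_sum, ← Finset.sum_add_distrib]
    refine Finset.sum_congr rfl fun k _ => ?_
    have : Complex.cot ((x k - x l) / 2) = -Complex.cot ((x l - x k) / 2) := by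
      rw [← neg_sub, neg_div]
      simp [Complex.cot_eq_cos_div_sin, div_neg]
    rw [this]
    push_cast
    ring
  rw [Finset.sum_comm (s := Finset.univ)
    (f := fun l k => x' k * (((q k * q l / 2 : ℝ) : ℂ) * Complex.cot ((x k - x l) / 2)))] at h1
  have h2 : ∀ l, ∑ k, x' l * (((q l * q k / 2 : ℝ) : ℂ) * Complex.cot ((x l - x k) / 2))
      = x' l * drift q x l := fun l => by rw [drift, Finset.mul_sum]
  simp only [h2] at h1
  rw [h1]
  ring

/-- The chain rule for a lifted Coulomb gas integrand along a curve. -/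
theorem hasDerivAt_expWeight_mul [DecidableEq ι] (q : ι → ℝ) {L : ι → ι → ℝ → ℂ} {x : ℝ → ι → ℂ} {x' : ι → ℂ}
    {G : (ι → ℂ) → ℂ} {τ : ℝ} (hx : ∀ l, HasDerivAt (fun σ => x σ l) (x' l) τ)
    (hd : ∀ l σ, L l l σ = 0) (hL : ∀ l k, l ≠ k → ContinuousAt (L l k) τ)
    (hexp : ∀ l k, l ≠ k → ∀ᶠ σ in 𝓝 τ,
      Complex.exp (2 * L l k σ) = Complex.sin ((x σ l - x σ k) / 2) ^ 2)
    (hG : DifferentiableAt ℂ G (x τ)) :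
    HasDerivAt (fun σ => expWeight q (fun l k => L l k σ) * G (x σ))
      (∑ l, x' l * (expWeight q (fun l k => L l k τ) * covDeriv q l G (x τ))) τ := by
  have h1 : ∀ l k, HasDerivAt (L l k) ((x' l - x' k) / 2 * Complex.cot ((x τ l - x τ k) / 2)) τ := by
    intro l k
    rcases eq_or_ne l k with rfl | h
    · rw [show L l l = fun _ => 0 from funext (hd l), sub_self, zero_div, zero_mul]
      exact hasDerivAt_const τ (0 : ℂ)
    · exact hasDerivAt_of_exp_eq_sin_sq (X := fun σ => x σ l - x σ k) (hL l k h)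
        ((hx l).sub (hx k)) (hexp l k h)
  have h2 : HasDerivAt (fun σ => expWeight q (fun l k => L l k σ))
      (expWeight q (fun l k => L l k τ) * ∑ l, x' l * drift q (x τ) l) τ := by
    have h0 : HasDerivAt (fun σ => ∑ l, ∑ k, ((q l * q k : ℝ) : ℂ) * L l k σ)
        (∑ l, ∑ k, ((q l * q k : ℝ) : ℂ) * ((x' l - x' k) / 2 *
          Complex.cot ((x τ l - x τ k) / 2))) τ :=
      HasDerivAt.fun_sum fun l _ => HasDerivAt.fun_sum fun k _ => (h1 l k).const_mul _
    rw [← sum_sum_antisymm]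
    exact (h0.const_mul (1 / 2)).cexp
  have hx2 : HasDerivAt x x' τ := hasDerivAt_pi.2 hx
  have h3 : HasDerivAt (fun σ => G (x σ)) (fderiv ℂ G (x τ) x') τ :=
    (hG.hasFDerivAt.restrictScalars ℝ).comp_hasDerivAt τ hx2
  have h4 : fderiv ℂ G (x τ) x' = ∑ l, x' l * fderiv ℂ G (x τ) (Pi.single l 1) := by
    conv_lhs => rw [pi_eq_sum_univ' x', map_sum]
    refine Finset.sum_congr rfl fun l _ => ?_
    rw [← smul_eq_mul, ← map_smul]
  refine (h2.mul h3).congr_deriv ?_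
  rw [h4, mul_assoc, Finset.sum_mul, Finset.mul_sum, Finset.mul_sum, ← Finset.sum_add_distrib]
  refine Finset.sum_congr rfl fun l _ => ?_
  rw [covDeriv]
  ring

end lifted

end RadialCoulomb
end

noncomputable section

namespace RadialCoulomb

open MeasureTheory Filter Topology Set

/-! ### Families of closed contours with logarithms -/

/-- The configurations of points and screening charges on which the integrands are holomorphic. -/
def configSpace (n m : ℕ) : Set (Fin n ⊕ Fin m → ℂ) :=
  {x | (∀ l k, l ≠ k → Complex.sin ((x l - x k) / 2) ≠ 0) ∧ ∀ l, (x l).im < Real.pi}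

theorem isOpen_configSpace (n m : ℕ) : IsOpen (configSpace n m) := by
  have : configSpace n m = (⋂ l, ⋂ k, {x | l ≠ k → Complex.sin ((x l - x k) / 2) ≠ 0}) ∩
      ⋂ l, {x | (x l).im < Real.pi} := by
    ext x; simp [configSpace]
  rw [this]
  refine (isOpen_iInter_of_finite fun l => isOpen_iInter_of_finite fun k => ?_).inter
    (isOpen_iInter_of_finite fun r => ?_)
  · by_cases h : l = k
    · simp [h]
    · simp only [ne_eq, h, not_false_eq_true, true_imp_iff]
      exact isOpen_ne_fun (by fun_prop) continuous_const
  · exact isOpen_lt (by fun_prop) continuous_const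

theorem isOpen_chamber (n : ℕ) : IsOpen (chamber n) := by
  have : chamber n = (⋂ i, ⋂ j, {θ | i < j → θ i < θ j}) ∩
      ⋂ i, ⋂ j, {θ | θ i < θ j + 2 * Real.pi} := by
    ext x; simp [chamber, StrictMono]
  rw [this]
  refine (isOpen_iInter_of_finite fun l => isOpen_iInter_of_finite fun k => ?_).inter
    (isOpen_iInter_of_finite fun l => isOpen_iInter_of_finite fun k => ?_)
  · by_cases h : l < k
    · simp only [h, true_imp_iff]
      exact isOpen_lt (by fun_prop) (by fun_prop)
    · simp [h]
  · exact isOpen_lt (by fun_prop) (by fun_prop)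

/-- Closed contours over the chamber with continuous logarithms of all `sin((x l - x k)/2)`
up to sign. -/
structure LiftedFamily (n m : ℕ) where
  γ : Fin m → (Fin n → ℝ) → ℝ → ℂ
  S : Set ℝ
  S_countable : S.Countable
  bound : (Fin n → ℝ) → ℝ
  bound_continuous : ContinuousOn bound (chamber n)
  γ_continuous : ∀ r, ContinuousOn (fun z : (Fin n → ℝ) × ℝ => γ r z.1 z.2)
    (chamber n ×ˢ Set.Icc 0 8)
  γ_differentiable : ∀ r, ∀ θ ∈ chamber n, ∀ t, t ∉ S → DifferentiableAt ℝ (γ r θ) t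
  deriv_continuous : ∀ r t, t ∉ S → ContinuousOn (fun θ => deriv (γ r θ) t) (chamber n)
  deriv_le : ∀ r, ∀ θ ∈ chamber n, ∀ t, t ∉ S → ‖deriv (γ r θ) t‖ ≤ bound θ
  γ_closed : ∀ r, ∀ θ ∈ chamber n, γ r θ 8 = γ r θ 0
  L : Fin n ⊕ Fin m → Fin n ⊕ Fin m → (Fin n → ℝ) → (Fin m → ℝ) → ℂ
  L_continuous : ∀ l k, ContinuousOn (fun z : (Fin n → ℝ) × (Fin m → ℝ) => L l k z.1 z.2)
    (chamber n ×ˢ cube m)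
  L_self : ∀ l θ t, L l l θ t = 0
  exp_L : ∀ l k, l ≠ k → ∀ θ ∈ chamber n, ∀ t ∈ cube m, Complex.exp (2 * L l k θ t) =
    Complex.sin (((Sum.elim (fun i => (θ i : ℂ)) (fun r => γ r θ (t r)) : Fin n ⊕ Fin m → ℂ) l
      - (Sum.elim (fun i => (θ i : ℂ)) (fun r => γ r θ (t r)) : Fin n ⊕ Fin m → ℂ) k) / 2) ^ 2
  L_closed : ∀ l k r, ∀ θ ∈ chamber n, ∀ t ∈ cube m,
    L l k θ (Function.update t r 8) = L l k θ (Function.update t r 0)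
  γ_im_lt : ∀ r, ∀ θ ∈ chamber n, ∀ t ∈ Set.Icc (0 : ℝ) 8, (γ r θ t).im < Real.pi

namespace LiftedFamily

variable {n m : ℕ} (F : LiftedFamily n m)

/-- The positions of the points and of the screening charges. -/
def pos (θ : Fin n → ℝ) (t : Fin m → ℝ) : Fin n ⊕ Fin m → ℂ :=
  Sum.elim (fun i => (θ i : ℂ)) fun r => F.γ r θ (t r)

/-- The integral of `Φ G` over the contours. -/
def integral (q : Fin n ⊕ Fin m → ℝ) (G : (Fin n ⊕ Fin m → ℂ) → ℂ) (θ : Fin n → ℝ) : ℂ :=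
  ∫ t in cube m, expWeight q (fun l k => F.L l k θ t) * G (F.pos θ t) * ∏ r, deriv (F.γ r θ) (t r)

theorem exp_L_pos {l k : Fin n ⊕ Fin m} (h : l ≠ k) {θ : Fin n → ℝ} (hθ : θ ∈ chamber n)
    {t : Fin m → ℝ} (ht : t ∈ cube m) :
    Complex.exp (2 * F.L l k θ t) = Complex.sin ((F.pos θ t l - F.pos θ t k) / 2) ^ 2 :=
  F.exp_L l k h θ hθ t ht

theorem pos_mem {θ : Fin n → ℝ} (hθ : θ ∈ chamber n) {t : Fin m → ℝ} (ht : t ∈ cube m) :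
    F.pos θ t ∈ configSpace n m := by
  refine ⟨fun l k h h0 => ?_, fun l => ?_⟩
  swap
  · rcases l with i | r
    · simpa [pos] using Real.pi_pos
    · exact F.γ_im_lt r θ hθ _ (mem_cube.1 ht r)
  have := F.exp_L_pos h hθ ht
  rw [h0] at this
  simp [Complex.exp_ne_zero] at this

theorem continuousOn_pos :
    ContinuousOn (fun z : (Fin n → ℝ) × (Fin m → ℝ) => F.pos z.1 z.2) (chamber n ×ˢ cube m) := by
  refine continuousOn_pi.2 fun l => ?_
  rcases l with i | r
  · exact (by fun_prop : Continuous fun z : (Fin n → ℝ) × (Fin m → ℝ) =>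
      ((z.1 i : ℝ) : ℂ)).continuousOn
  · exact (F.γ_continuous r).comp (f := fun z : (Fin n → ℝ) × (Fin m → ℝ) => (z.1, z.2 r))
      (by fun_prop) fun z hz => ⟨hz.1, mem_cube.1 hz.2 r⟩

/-! #### The straight deformation from the contours at `θ₀` to those at `θ` -/

/-- The positions of the deformation. -/
def defPos (θ₀ θ : Fin n → ℝ) (s : ℝ) (t : Fin m → ℝ) (l : Fin n ⊕ Fin m) : ℂ :=
  F.pos θ₀ t l + s * (F.pos θ t l - F.pos θ₀ t l)

/-- The quotient of the `sin²` of the deformation and of its start. -/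
def defRatio (θ₀ θ : Fin n → ℝ) (s : ℝ) (t : Fin m → ℝ) (l k : Fin n ⊕ Fin m) : ℂ :=
  Complex.sin ((F.defPos θ₀ θ s t l - F.defPos θ₀ θ s t k) / 2) ^ 2
    / Complex.sin ((F.pos θ₀ t l - F.pos θ₀ t k) / 2) ^ 2

/-- The logarithms of the deformation. -/
def defLog (θ₀ θ : Fin n → ℝ) (s : ℝ) (t : Fin m → ℝ) (l k : Fin n ⊕ Fin m) : ℂ :=
  F.L l k θ₀ t + 1 / 2 * Complex.log (F.defRatio θ₀ θ s t l k)

/-- The Coulomb gas integrand of the deformation, without the derivatives of the contours. -/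
def defIntegrand (q : Fin n ⊕ Fin m → ℝ) (G : (Fin n ⊕ Fin m → ℂ) → ℂ) (θ₀ θ : Fin n → ℝ) (s : ℝ)
    (t : Fin m → ℝ) : ℂ :=
  expWeight q (F.defLog θ₀ θ s t) * G (F.defPos θ₀ θ s t)

/-- The derivatives of the contours of the deformation. -/
def defDeriv (θ₀ θ : Fin n → ℝ) (s : ℝ) (r : Fin m) (τ : ℝ) : ℂ :=
  deriv (F.γ r θ₀) τ + s * (deriv (F.γ r θ) τ - deriv (F.γ r θ₀) τ)

/-- The integral over the contours of the deformation. -/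
def defIntegral (q : Fin n ⊕ Fin m → ℝ) (G : (Fin n ⊕ Fin m → ℂ) → ℂ) (θ₀ θ : Fin n → ℝ)
    (s : ℝ) : ℂ :=
  ∫ t in cube m, F.defIntegrand q G θ₀ θ s t * ∏ r, F.defDeriv θ₀ θ s r (t r)

/-- The end point of the deformation is close enough to its start. -/
structure IsNear (θ₀ θ : Fin n → ℝ) : Prop where
  left_mem : θ₀ ∈ chamber n
  right_mem : θ ∈ chamber n
  -- The interval [-1,2] contains [0,1] in its interior, so two-sided derivatives in s exist on all
  -- of [0,1].
  pos_mem : ∀ s ∈ Set.Icc (-1 : ℝ) 2, ∀ t ∈ cube m, F.defPos θ₀ θ s t ∈ configSpace n m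
  ratio_mem : ∀ s ∈ Set.Icc (-1 : ℝ) 2, ∀ t ∈ cube m, ∀ l k, l ≠ k →
    F.defRatio θ₀ θ s t l k ∈ Complex.slitPlane
  log_lt : ∀ t ∈ cube m, ∀ l k, l ≠ k → ‖2 * F.L l k θ t - 2 * F.L l k θ₀ t‖ < Real.pi

variable {F} {θ₀ θ : Fin n → ℝ} {q : Fin n ⊕ Fin m → ℝ} {G : (Fin n ⊕ Fin m → ℂ) → ℂ}

theorem defPos_zero (t : Fin m → ℝ) : F.defPos θ₀ θ 0 t = F.pos θ₀ t := by
  ext l; simp [defPos]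

theorem defPos_one (t : Fin m → ℝ) : F.defPos θ₀ θ 1 t = F.pos θ t := by
  ext l; simp [defPos]

theorem defPos_self (s : ℝ) (t : Fin m → ℝ) : F.defPos θ₀ θ₀ s t = F.pos θ₀ t := by
  ext l; simp [defPos]

theorem defRatio_self_index (s : ℝ) (t : Fin m → ℝ) (l : Fin n ⊕ Fin m) :
    F.defRatio θ₀ θ s t l l = 0 := by
  simp [defRatio]

theorem defLog_self_index (s : ℝ) (t : Fin m → ℝ) (l : Fin n ⊕ Fin m) :
    F.defLog θ₀ θ s t l l = 0 := by
  simp [defLog, defRatio_self_index, F.L_self]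

theorem sin_ne_zero_of_mem {x : Fin n ⊕ Fin m → ℂ} (hx : x ∈ configSpace n m)
    {l k : Fin n ⊕ Fin m} (h : l ≠ k) : Complex.sin ((x l - x k) / 2) ≠ 0 := hx.1 l k h

theorem defRatio_eq_one (hθ : θ₀ ∈ chamber n) {s : ℝ} {t : Fin m → ℝ} (ht : t ∈ cube m)
    (h : F.defPos θ₀ θ s t = F.pos θ₀ t) {l k : Fin n ⊕ Fin m} (hlk : l ≠ k) :
    F.defRatio θ₀ θ s t l k = 1 := by
  rw [defRatio, h]
  exact div_self (pow_ne_zero 2 (sin_ne_zero_of_mem (F.pos_mem hθ ht) hlk))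

theorem defLog_eq (hθ : θ₀ ∈ chamber n) {s : ℝ} {t : Fin m → ℝ} (ht : t ∈ cube m)
    (h : F.defPos θ₀ θ s t = F.pos θ₀ t) (l k : Fin n ⊕ Fin m) :
    F.defLog θ₀ θ s t l k = F.L l k θ₀ t := by
  rcases eq_or_ne l k with rfl | hlk
  · rw [defLog_self_index, F.L_self]
  · rw [defLog, defRatio_eq_one hθ ht h hlk]
    simp

theorem defIntegrand_self (hθ : θ₀ ∈ chamber n) (s : ℝ) {t : Fin m → ℝ} (ht : t ∈ cube m) :
    F.defIntegrand q G θ₀ θ₀ s t = expWeight q (fun l k => F.L l k θ₀ t) * G (F.pos θ₀ t) := by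
  rw [defIntegrand, defPos_self]
  congr 2
  ext l k
  exact defLog_eq hθ ht (defPos_self s t) l k

theorem defIntegral_zero (hθ : θ₀ ∈ chamber n) : F.defIntegral q G θ₀ θ 0 = F.integral q G θ₀ := by
  unfold defIntegral integral
  refine setIntegral_congr_fun (measurableSet_cube m) fun t ht => ?_
  have : F.defLog θ₀ θ 0 t = fun l k => F.L l k θ₀ t := by
    ext l k; exact defLog_eq hθ ht (defPos_zero t) l k
  simp only [defIntegrand, this, defPos_zero, defDeriv, Complex.ofReal_zero, zero_mul, add_zero]

namespace IsNear

variable (h : F.IsNear θ₀ θ)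
include h

theorem exp_defLog {s : ℝ} (hs : s ∈ Set.Icc (-1 : ℝ) 2) {t : Fin m → ℝ} (ht : t ∈ cube m)
    {l k : Fin n ⊕ Fin m} (hlk : l ≠ k) : Complex.exp (2 * F.defLog θ₀ θ s t l k)
      = Complex.sin ((F.defPos θ₀ θ s t l - F.defPos θ₀ θ s t k) / 2) ^ 2 := by
  have h0 := Complex.slitPlane_ne_zero (h.ratio_mem s hs t ht l k hlk)
  rw [defLog, mul_add, ← mul_assoc, Complex.exp_add, F.exp_L_pos hlk h.left_mem ht]
  norm_num
  rw [Complex.exp_log h0, defRatio]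
  exact mul_div_cancel₀ _ (pow_ne_zero 2 (sin_ne_zero_of_mem (F.pos_mem h.left_mem ht) hlk))

/-- Both logarithms of sin² are given, and their difference has imaginary part of modulus below π;
therefore the principal logarithm of the quotient is exactly this difference and the deformation
ends in the prescribed branch. -/
theorem defLog_one {t : Fin m → ℝ} (ht : t ∈ cube m) (l k : Fin n ⊕ Fin m) :
    F.defLog θ₀ θ 1 t l k = F.L l k θ t := by
  rcases eq_or_ne l k with rfl | hlk
  · rw [defLog_self_index, F.L_self]
  · have := (Complex.abs_im_le_norm _).trans_lt (h.log_lt t ht l k hlk)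
    rw [abs_lt] at this
    rw [defLog, defRatio, defPos_one, ← F.exp_L_pos hlk h.right_mem ht,
      ← F.exp_L_pos hlk h.left_mem ht, ← Complex.exp_sub, Complex.log_exp this.1 this.2.le]
    ring

theorem defIntegral_one : F.defIntegral q G θ₀ θ 1 = F.integral q G θ := by
  unfold defIntegral integral
  refine setIntegral_congr_fun (measurableSet_cube m) fun t ht => ?_
  have : F.defLog θ₀ θ 1 t = fun l k => F.L l k θ t := by
    ext l k; exact h.defLog_one ht l k
  simp only [defIntegrand, this, defPos_one, defDeriv, Complex.ofReal_one, one_mul,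
    add_sub_cancel]

theorem continuousOn_defPos : ContinuousOn (fun z : ℝ × (Fin m → ℝ) => F.defPos θ₀ θ z.1 z.2)
    (Set.univ ×ˢ cube m) := by
  have h0 : ∀ θ ∈ chamber n, ContinuousOn (fun z : ℝ × (Fin m → ℝ) => F.pos θ z.2)
      (Set.univ ×ˢ cube m) := fun θ hθ =>
    F.continuousOn_pos.comp (f := fun z : ℝ × (Fin m → ℝ) => (θ, z.2)) (by fun_prop)
      fun z hz => ⟨hθ, hz.2⟩
  have h1 := h0 θ₀ h.left_mem
  have h2 := h0 θ h.right_mem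
  rw [continuousOn_pi] at h1 h2 ⊢
  intro l
  unfold defPos
  exact (h1 l).add ((Complex.continuous_ofReal.comp continuous_fst).continuousOn.mul
    ((h2 l).sub (h1 l)))

theorem continuousOn_defLog (l k : Fin n ⊕ Fin m) :
    ContinuousOn (fun z : ℝ × (Fin m → ℝ) => F.defLog θ₀ θ z.1 z.2 l k)
      (Set.Icc (-1) 2 ×ˢ cube m) := by
  rcases eq_or_ne l k with rfl | hlk
  · simp only [defLog_self_index]
    exact continuousOn_const
  · have hp := h.continuousOn_defPos.mono
      (prod_mono_left (subset_univ (Set.Icc (-1 : ℝ) 2)))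
    have h0 : ContinuousOn (fun z : ℝ × (Fin m → ℝ) => F.pos θ₀ z.2)
        (Set.Icc (-1 : ℝ) 2 ×ˢ cube m) :=
      F.continuousOn_pos.comp (f := fun z : ℝ × (Fin m → ℝ) => (θ₀, z.2)) (by fun_prop)
        fun z hz => ⟨h.left_mem, hz.2⟩
    have hL : ContinuousOn (fun z : ℝ × (Fin m → ℝ) => F.L l k θ₀ z.2)
        (Set.Icc (-1 : ℝ) 2 ×ˢ cube m) :=
      (F.L_continuous l k).comp (f := fun z : ℝ × (Fin m → ℝ) => (θ₀, z.2)) (by fun_prop)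
        fun z hz => ⟨h.left_mem, hz.2⟩
    rw [continuousOn_pi] at hp h0
    have hsin : ∀ {X Y : ℝ × (Fin m → ℝ) → ℂ} {s}, ContinuousOn X s → ContinuousOn Y s →
        ContinuousOn (fun z => Complex.sin ((X z - Y z) / 2) ^ 2) s := fun hX hY =>
      (Complex.continuous_sin.comp_continuousOn ((hX.sub hY).div_const 2)).pow 2
    refine hL.add (continuousOn_const.mul (ContinuousOn.clog ?_
      fun z hz => h.ratio_mem z.1 hz.1 z.2 hz.2 l k hlk))
    exact (hsin (hp l) (hp k)).div (hsin (h0 l) (h0 k)) fun z hz =>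
      pow_ne_zero 2 (sin_ne_zero_of_mem (F.pos_mem h.left_mem hz.2) hlk)

theorem continuousOn_defIntegrand (hG : ContinuousOn G (configSpace n m)) :
    ContinuousOn (fun z : ℝ × (Fin m → ℝ) => F.defIntegrand q G θ₀ θ z.1 z.2)
      (Set.Icc (-1) 2 ×ˢ cube m) := by
  unfold defIntegrand
  exact (continuousOn_expWeight q (L := fun l k (z : ℝ × (Fin m → ℝ)) =>
    F.defLog θ₀ θ z.1 z.2 l k) h.continuousOn_defLog).mul
    (hG.comp (h.continuousOn_defPos.mono (prod_mono_left (subset_univ _)))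
      fun z hz => h.pos_mem z.1 hz.1 z.2 hz.2)

theorem continuousOn_defIntegrand_right (hG : ContinuousOn G (configSpace n m)) {s : ℝ}
    (hs : s ∈ Set.Icc (-1 : ℝ) 2) :
    ContinuousOn (F.defIntegrand q G θ₀ θ s) (cube m) :=
  (h.continuousOn_defIntegrand hG).comp (f := fun t => (s, t)) (by fun_prop)
    fun _ ht => ⟨hs, ht⟩

/-- The derivative of the integrand in the deformation parameter. -/
theorem hasDerivAt_defIntegrand_left (hG : DifferentiableOn ℂ G (configSpace n m)) {s : ℝ}
    (hs : s ∈ Set.Ioo (-1 : ℝ) 2) {t : Fin m → ℝ} (ht : t ∈ cube m) :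
    HasDerivAt (fun s => F.defIntegrand q G θ₀ θ s t)
      (∑ l, (F.pos θ t l - F.pos θ₀ t l) * F.defIntegrand q (covDeriv q l G) θ₀ θ s t) s := by
  have hs' := Ioo_subset_Icc_self hs
  refine hasDerivAt_expWeight_mul q (L := fun l k s => F.defLog θ₀ θ s t l k)
    (x := fun s => F.defPos θ₀ θ s t) (fun l => ?_)
    (fun l σ => defLog_self_index σ t l) (fun l k hlk => ?_) (fun l k hlk => ?_)
    (hG.differentiableAt ((isOpen_configSpace n m).mem_nhds (h.pos_mem s hs' t ht)))
  · have := ((Complex.ofRealCLM.hasDerivAt (x := s)).mul_const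
      (F.pos θ t l - F.pos θ₀ t l)).const_add (F.pos θ₀ t l)
    rw [Complex.ofRealCLM_apply, Complex.ofReal_one, one_mul] at this
    exact this
  · have h1 := (h.continuousOn_defLog l k).comp (f := fun s => (s, t)) (s := Set.Icc (-1 : ℝ) 2)
      (by fun_prop) fun σ hσ => ⟨hσ, ht⟩
    exact h1.continuousAt (Icc_mem_nhds hs.1 hs.2)
  · filter_upwards [Icc_mem_nhds hs.1 hs.2] with σ hσ
    exact h.exp_defLog hσ ht hlk

theorem hasDerivAt_defPos (r : Fin m) {s : ℝ} {t : Fin m → ℝ} {τ : ℝ} (hτS : τ ∉ F.S)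
    (l : Fin n ⊕ Fin m) : HasDerivAt (fun τ => F.defPos θ₀ θ s (Function.update t r τ) l)
      (if l = Sum.inr r then F.defDeriv θ₀ θ s r τ else 0) τ := by
  rcases l with i | r'
  · simpa [defPos, pos] using hasDerivAt_const τ _
  · rcases eq_or_ne r' r with rfl | hr
    · have h0 := (F.γ_differentiable r' θ₀ h.left_mem τ hτS).hasDerivAt
      have h1 := (F.γ_differentiable r' θ h.right_mem τ hτS).hasDerivAt
      simp only [defPos, pos, defDeriv, Sum.elim_inr, Function.update_self, if_true]
      exact h0.add ((h1.sub h0).const_mul (s : ℂ))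
    · simpa [defPos, pos, hr] using hasDerivAt_const τ _

/-- The derivative of the integrand in a contour parameter. -/
theorem hasDerivAt_defIntegrand_right (hG : DifferentiableOn ℂ G (configSpace n m)) {s : ℝ}
    (hs : s ∈ Set.Icc (-1 : ℝ) 2) (r : Fin m) {t : Fin m → ℝ} (ht : t ∈ cube m) {τ : ℝ}
    (hτ : τ ∈ Set.Ioo (0 : ℝ) 8) (hτS : τ ∉ F.S) :
    HasDerivAt (fun τ => F.defIntegrand q G θ₀ θ s (Function.update t r τ))
      (F.defDeriv θ₀ θ s r τ *
        F.defIntegrand q (covDeriv q (Sum.inr r) G) θ₀ θ s (Function.update t r τ)) τ := by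
  have hτ' := Ioo_subset_Icc_self hτ
  have key := hasDerivAt_expWeight_mul q (G := G)
    (L := fun l k τ => F.defLog θ₀ θ s (Function.update t r τ) l k)
    (x := fun τ => F.defPos θ₀ θ s (Function.update t r τ))
    (fun l => h.hasDerivAt_defPos r (s := s) (t := t) hτS l)
    (fun l σ => defLog_self_index s _ l) (fun l k hlk => ?_) (fun l k hlk => ?_)
    (hG.differentiableAt ((isOpen_configSpace n m).mem_nhds
      (h.pos_mem s hs _ (update_mem_cube ht r hτ'))))
  · refine key.congr_deriv ?_
    simp [defIntegrand]
  · have h1 := (h.continuousOn_defLog l k).comp (f := fun τ => (s, Function.update t r τ))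
      (s := Set.Icc (0 : ℝ) 8) (by fun_prop) fun σ hσ => ⟨hs, update_mem_cube ht r hσ⟩
    exact h1.continuousAt (Icc_mem_nhds hτ.1 hτ.2)
  · filter_upwards [Icc_mem_nhds hτ.1 hτ.2] with σ hσ
    exact h.exp_defLog hs (update_mem_cube ht r hσ) hlk

end IsNear

theorem pos_closed (hθ : θ ∈ chamber n) (r : Fin m) (t : Fin m → ℝ) :
    F.pos θ (Function.update t r 8) = F.pos θ (Function.update t r 0) := by
  ext l
  rcases l with i | r'
  · rfl
  · rcases eq_or_ne r' r with rfl | hr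
    · simp [pos, F.γ_closed r' θ hθ]
    · simp [pos, hr]

namespace IsNear

variable (h : F.IsNear θ₀ θ)
include h

/-- The start and the end of the deformation are closed, hence so is every convex or affine
combination of them. The branch is closed because it is the closed branch at θ₀ plus a function of
the positions. -/
theorem defIntegrand_closed (s : ℝ) (r : Fin m) {t : Fin m → ℝ} (ht : t ∈ cube m) :
    F.defIntegrand q G θ₀ θ s (Function.update t r 8)
      = F.defIntegrand q G θ₀ θ s (Function.update t r 0) := by
  have h1 : F.defPos θ₀ θ s (Function.update t r 8) = F.defPos θ₀ θ s (Function.update t r 0) := by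
    ext l; rw [defPos, defPos, pos_closed h.left_mem, pos_closed h.right_mem]
  have h2 : F.defLog θ₀ θ s (Function.update t r 8) = F.defLog θ₀ θ s (Function.update t r 0) := by
    ext l k
    rw [defLog, defLog, F.L_closed l k r θ₀ h.left_mem t ht, defRatio, defRatio, h1,
      pos_closed h.left_mem]
  rw [defIntegrand, defIntegrand, h1, h2]

theorem norm_defDeriv_le (s : ℝ) (hs : s ∈ Set.Icc (-1 : ℝ) 2) (r : Fin m) {τ : ℝ}
    (hτ : τ ∉ F.S) : ‖F.defDeriv θ₀ θ s r τ‖ ≤ 3 * F.bound θ₀ + 2 * F.bound θ := by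
  have h0 := F.deriv_le r θ₀ h.left_mem τ hτ
  have h1 := F.deriv_le r θ h.right_mem τ hτ
  have hs2 : ‖(s : ℂ)‖ ≤ 2 := by
    rw [Complex.norm_real, Real.norm_eq_abs]; exact abs_le.2 ⟨by linarith [hs.1], hs.2⟩
  calc ‖F.defDeriv θ₀ θ s r τ‖
      ≤ ‖deriv (F.γ r θ₀) τ‖ + ‖(s : ℂ)‖ * ‖deriv (F.γ r θ) τ - deriv (F.γ r θ₀) τ‖ := by
        rw [← norm_mul]; exact norm_add_le _ _
    _ ≤ F.bound θ₀ + 2 * (F.bound θ + F.bound θ₀) := by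
        refine add_le_add h0 (mul_le_mul hs2 ((norm_sub_le _ _).trans (add_le_add h1 h0))
          (norm_nonneg _) (by norm_num))
    _ = _ := by ring

end IsNear

theorem measurable_defDeriv (s : ℝ) (r : Fin m) : Measurable (F.defDeriv θ₀ θ s r) := by
  unfold defDeriv
  exact (measurable_deriv _).add (measurable_const.mul
    ((measurable_deriv _).sub (measurable_deriv _)))

theorem measurable_prod_defDeriv (s : ℝ) (A : Finset (Fin m)) :
    Measurable fun t : Fin m → ℝ => ∏ r ∈ A, F.defDeriv θ₀ θ s r (t r) :=
  Finset.measurable_prod _ fun r _ => (measurable_defDeriv s r).comp (measurable_pi_apply r)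

end LiftedFamily

end RadialCoulomb
end

noncomputable section

namespace RadialCoulomb

open MeasureTheory Filter Topology Set

/-! ### Smooth integrands and the derivative of the integral along the deformation -/

theorem contDiffAt_cot {k : WithTop ℕ∞} {z : ℂ} (h : Complex.sin z ≠ 0) :
    ContDiffAt ℂ k Complex.cot z := by
  have : Complex.cot = fun z => Complex.cos z / Complex.sin z := by
    ext z; exact Complex.cot_eq_cos_div_sin z
  rw [this]
  exact Complex.contDiff_cos.contDiffAt.div Complex.contDiff_sin.contDiffAt h

theorem contDiffOn_cot_sub {n m : ℕ} (k : WithTop ℕ∞) (l l' : Fin n ⊕ Fin m) :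
    ContDiffOn ℂ k (fun x : Fin n ⊕ Fin m → ℂ => Complex.cot ((x l - x l') / 2))
      (configSpace n m) := by
  rcases eq_or_ne l l' with rfl | h
  · simp only [sub_self]
    exact contDiffOn_const
  · intro x hx
    have h1 : ContDiffAt ℂ k (fun x : Fin n ⊕ Fin m → ℂ => (x l - x l') / 2) x := by fun_prop
    exact ((contDiffAt_cot (hx.1 l l' h)).comp x h1).contDiffWithinAt

theorem contDiffOn_drift {n m : ℕ} (k : WithTop ℕ∞) (q : Fin n ⊕ Fin m → ℝ) (l : Fin n ⊕ Fin m) :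
    ContDiffOn ℂ k (fun x => drift q x l) (configSpace n m) := by
  unfold drift
  exact ContDiffOn.sum fun k' _ => contDiffOn_const.mul (contDiffOn_cot_sub k l k')

theorem contDiffOn_covDeriv {n m : ℕ} {k k' : WithTop ℕ∞} (hk : k + 1 ≤ k')
    (q : Fin n ⊕ Fin m → ℝ) (l : Fin n ⊕ Fin m)
    {G : (Fin n ⊕ Fin m → ℂ) → ℂ} (hG : ContDiffOn ℂ k' G (configSpace n m)) :
    ContDiffOn ℂ k (covDeriv q l G) (configSpace n m) := by
  have h1 := (hG.fderiv_of_isOpen (isOpen_configSpace n m) hk).clm_apply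
    (contDiffOn_const (c := (Pi.single l 1 : Fin n ⊕ Fin m → ℂ)))
  exact h1.add ((contDiffOn_drift k q l).mul (hG.of_le (le_self_add.trans hk)))

namespace LiftedFamily

variable {n m : ℕ} {F : LiftedFamily n m} {θ₀ θ : Fin n → ℝ} {q : Fin n ⊕ Fin m → ℝ}
  {G : (Fin n ⊕ Fin m → ℂ) → ℂ}

theorem aux_bound (h : F.IsNear θ₀ θ) {s : ℝ} (hs : s ∈ Set.Icc (-1 : ℝ) 2) {t : Fin m → ℝ}
    (ht : ∀ r, t r ∉ F.S) (A : Finset (Fin m)) : ‖∏ r ∈ A, F.defDeriv θ₀ θ s r (t r)‖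
      ≤ (max 1 (3 * F.bound θ₀ + 2 * F.bound θ)) ^ m :=
  norm_prod_le_pow A (le_max_left _ _) fun r =>
    (h.norm_defDeriv_le s hs r (ht r)).trans (le_max_right _ _)

theorem integrableOn_def (h : F.IsNear θ₀ θ) (hG : ContinuousOn G (configSpace n m)) {s : ℝ}
    (hs : s ∈ Set.Icc (-1 : ℝ) 2) (A : Finset (Fin m)) :
    IntegrableOn (fun t => F.defIntegrand q G θ₀ θ s t * ∏ r ∈ A, F.defDeriv θ₀ θ s r (t r))
      (cube m) := by
  refine integrableOn_cube_mul (h.continuousOn_defIntegrand_right hG hs)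
    (measurable_prod_defDeriv s A).aestronglyMeasurable
    (C := (max 1 (3 * F.bound θ₀ + 2 * F.bound θ)) ^ m) ?_
  filter_upwards [ae_cube_notMem F.S_countable] with t ht
  exact aux_bound h hs ht.2 A

/-- The integral of a derivative along the `r`-th contour vanishes. -/
theorem integral_contour_deriv (h : F.IsNear θ₀ θ) (hG : ContDiffOn ℂ 1 G (configSpace n m))
    {s : ℝ} (hs : s ∈ Set.Icc (-1 : ℝ) 2) (r : Fin m) {η η' : ℝ → ℂ} {C : ℝ}
    (hη : ContinuousOn η (Set.Icc 0 8)) (hη' : ∀ τ ∉ F.S, HasDerivAt η (η' τ) τ)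
    (hηc : η 8 = η 0) (hm : Measurable η') (hC : ∀ τ ∉ F.S, ‖η' τ‖ ≤ C) :
    IntegrableOn (fun t => F.defIntegrand q (covDeriv q (Sum.inr r) G) θ₀ θ s t * η (t r)
        * ∏ r, F.defDeriv θ₀ θ s r (t r)) (cube m) ∧
    IntegrableOn (fun t => F.defIntegrand q G θ₀ θ s t * η' (t r)
        * ∏ r' ∈ Finset.univ.erase r, F.defDeriv θ₀ θ s r' (t r')) (cube m) ∧
    (∫ t in cube m, (F.defIntegrand q (covDeriv q (Sum.inr r) G) θ₀ θ s t * η (t r)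
        * (∏ r, F.defDeriv θ₀ θ s r (t r)) + F.defIntegrand q G θ₀ θ s t * η' (t r)
        * ∏ r' ∈ Finset.univ.erase r, F.defDeriv θ₀ θ s r' (t r'))) = 0 := by
  have hcov : ContinuousOn (covDeriv q (Sum.inr r) G) (configSpace n m) :=
    (contDiffOn_covDeriv (k := 0) (by simp) q _ hG).continuousOn
  have hηr : ContinuousOn (fun t : Fin m → ℝ => η (t r)) (cube m) :=
    hη.comp (by fun_prop) fun t ht => mem_cube.1 ht r
  set B := (max 1 (3 * F.bound θ₀ + 2 * F.bound θ)) ^ m with hB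
  have i1 : IntegrableOn (fun t => F.defIntegrand q (covDeriv q (Sum.inr r) G) θ₀ θ s t * η (t r)
        * ∏ r, F.defDeriv θ₀ θ s r (t r)) (cube m) := by
    refine integrableOn_cube_mul ((h.continuousOn_defIntegrand_right hcov hs).mul hηr)
      (measurable_prod_defDeriv s _).aestronglyMeasurable (C := B) ?_
    filter_upwards [ae_cube_notMem F.S_countable] with t ht
    exact aux_bound h hs ht.2 _
  have i2 : IntegrableOn (fun t => F.defIntegrand q G θ₀ θ s t * η' (t r)
        * ∏ r' ∈ Finset.univ.erase r, F.defDeriv θ₀ θ s r' (t r')) (cube m) := by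
    simp only [mul_assoc]
    refine integrableOn_cube_mul (h.continuousOn_defIntegrand_right hG.continuousOn hs)
      ((hm.comp (measurable_pi_apply r)).mul (measurable_prod_defDeriv s _)).aestronglyMeasurable
      (C := C * B) ?_
    filter_upwards [ae_cube_notMem F.S_countable] with t ht
    rw [norm_mul]
    exact mul_le_mul (hC _ (ht.2 r)) (aux_bound h hs ht.2 _) (norm_nonneg _)
      ((norm_nonneg _).trans (hC _ (ht.2 r)))
  refine ⟨i1, i2, ?_⟩
  have hw : ∀ (t : Fin m → ℝ) τ, ∏ r' ∈ Finset.univ.erase r,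
      F.defDeriv θ₀ θ s r' (Function.update t r τ r')
        = ∏ r' ∈ Finset.univ.erase r, F.defDeriv θ₀ θ s r' (t r') := fun t τ =>
    Finset.prod_congr rfl fun r' hr' => by
      rw [Function.update_of_ne (Finset.ne_of_mem_erase hr')]
  -- The function differentiated in t r is the integrand times η, without the speed of the r-th
  -- contour. The chain rule supplies that speed in the first term, and the second term carries η'
  -- in its place.
  refine integral_cube_deriv_eq_zero r (u := fun t => F.defIntegrand q G θ₀ θ s t * η (t r)
    * ∏ r' ∈ Finset.univ.erase r, F.defDeriv θ₀ θ s r' (t r')) F.S_countable ?_ ?_ ?_ (i1.add i2)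
  · intro t ht
    simp only [hw, Function.update_self]
    refine (((h.continuousOn_defIntegrand_right hG.continuousOn hs).comp (by fun_prop)
      fun τ hτ => update_mem_cube ht r hτ).mul hη).mul continuousOn_const
  · intro t ht τ hτ
    simp only [hw, Function.update_self]
    have h1 := h.hasDerivAt_defIntegrand_right (q := q) (hG.differentiableOn one_ne_zero) hs r ht
      hτ.1 hτ.2
    refine ((h1.mul (hη' τ hτ.2)).mul_const _).congr_deriv ?_
    rw [← Finset.mul_prod_erase _ _ (Finset.mem_univ r), hw, Function.update_self]
    ring
  · intro t ht
    simp only [hw, Function.update_self, hηc, h.defIntegrand_closed s r ht]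

theorem isNear_self (hθ : θ ∈ chamber n) : F.IsNear θ θ where
  left_mem := hθ
  right_mem := hθ
  pos_mem s _ t ht := by rw [defPos_self]; exact F.pos_mem hθ ht
  ratio_mem s _ t ht l k hlk := by
    rw [defRatio_eq_one hθ ht (defPos_self s t) hlk]; exact Complex.one_mem_slitPlane
  log_lt t _ l k _ := by simp [Real.pi_pos]

theorem integrableOn_integrand (hθ : θ ∈ chamber n) (hG : ContinuousOn G (configSpace n m)) :
    IntegrableOn (fun t => expWeight q (fun l k => F.L l k θ t) * G (F.pos θ t)
      * ∏ r, deriv (F.γ r θ) (t r)) (cube m) := by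
  refine (integrableOn_def (q := q) (isNear_self (F := F) hθ) hG (s := 0) (by norm_num)
    Finset.univ).congr_fun (fun t ht => ?_) (measurableSet_cube m)
  simp only [defIntegrand_self hθ 0 ht, defDeriv, sub_self, mul_zero, add_zero]

/-- The integral of a total derivative in a screening variable vanishes. -/
theorem integral_covDeriv_screening (hθ : θ ∈ chamber n) (hG : ContDiffOn ℂ 1 G (configSpace n m))
    (r : Fin m) : F.integral q (covDeriv q (Sum.inr r) G) θ = 0 := by
  have h := (integral_contour_deriv (q := q) (isNear_self (F := F) hθ) hG (s := 0) (by norm_num) r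
    (η := fun _ => 1) (η' := fun _ => 0) (C := 0) continuousOn_const
    (fun τ _ => hasDerivAt_const τ 1) rfl measurable_const (by simp)).2.2
  rw [← defIntegral_zero (θ := θ) hθ, defIntegral]
  simpa using h

/-- The derivative of the integral in the deformation parameter. -/
theorem hasDerivAt_defIntegral (h : F.IsNear θ₀ θ) (hG : ContDiffOn ℂ 1 G (configSpace n m))
    {s : ℝ} (hs : s ∈ Set.Ioo (-1 : ℝ) 2) :
    HasDerivAt (F.defIntegral q G θ₀ θ)
      (∑ j, ((θ j - θ₀ j : ℝ) : ℂ) * F.defIntegral q (covDeriv q (Sum.inl j) G) θ₀ θ s) s := by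
  have hcov : ∀ l, ContinuousOn (covDeriv q l G) (configSpace n m) := fun l =>
    (contDiffOn_covDeriv (k := 0) (by simp) q l hG).continuousOn
  have hs' := Ioo_subset_Icc_self hs
  set e : Fin m → ℝ → ℂ := fun r τ => deriv (F.γ r θ) τ - deriv (F.γ r θ₀) τ with he
  -- The derivative in s: all positions move with velocity `F.pos θ t - F.pos θ₀ t`, and each speed
  -- changes at the rate `e r`.
  set P : ℝ → (Fin m → ℝ) → ℂ := fun s t =>
    (∑ l, (F.pos θ t l - F.pos θ₀ t l) * F.defIntegrand q (covDeriv q l G) θ₀ θ s t)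
      * (∏ r, F.defDeriv θ₀ θ s r (t r))
    + F.defIntegrand q G θ₀ θ s t * ∑ r, (∏ r' ∈ Finset.univ.erase r, F.defDeriv θ₀ θ s r' (t r'))
      * e r (t r) with hP
  set B := (max 1 (3 * F.bound θ₀ + 2 * F.bound θ)) ^ m with hB
  have hBpos : 0 ≤ B := by positivity
  have hpos : ∀ θ ∈ chamber n, ContinuousOn (fun z : ℝ × (Fin m → ℝ) => F.pos θ z.2)
      (Set.Icc (-1) 2 ×ˢ cube m) := fun θ hθ =>
    F.continuousOn_pos.comp (f := fun z : ℝ × (Fin m → ℝ) => (θ, z.2)) (by fun_prop)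
      fun z hz => ⟨hθ, hz.2⟩
  have hc1 : ContinuousOn (fun z : ℝ × (Fin m → ℝ) => ∑ l, (F.pos θ z.2 l - F.pos θ₀ z.2 l)
      * F.defIntegrand q (covDeriv q l G) θ₀ θ z.1 z.2) (Set.Icc (-1) 2 ×ˢ cube m) :=
    continuousOn_finsetSum _ fun l _ => ((continuousOn_pi.1 (hpos θ h.right_mem) l).sub
      (continuousOn_pi.1 (hpos θ₀ h.left_mem) l)).mul (h.continuousOn_defIntegrand (hcov l))
  have hcomp : IsCompact (Set.Icc (-1 : ℝ) 2 ×ˢ cube m) := isCompact_Icc.prod (isCompact_cube m)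
  obtain ⟨C1, hC1⟩ := hcomp.exists_bound_of_continuousOn hc1
  obtain ⟨C2, hC2⟩ := hcomp.exists_bound_of_continuousOn
    (h.continuousOn_defIntegrand (q := q) hG.continuousOn)
  have hem : ∀ r, Measurable (e r) := fun r => (measurable_deriv _).sub (measurable_deriv _)
  have heb : ∀ r, ∀ τ ∉ F.S, ‖e r τ‖ ≤ F.bound θ + F.bound θ₀ := fun r τ hτ =>
    (norm_sub_le _ _).trans (add_le_add (F.deriv_le r θ h.right_mem τ hτ)
      (F.deriv_le r θ₀ h.left_mem τ hτ))
  have hE : ∀ s ∈ Set.Icc (-1 : ℝ) 2, ∀ t : Fin m → ℝ, (∀ r, t r ∉ F.S) →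
      ‖∑ r, (∏ r' ∈ Finset.univ.erase r, F.defDeriv θ₀ θ s r' (t r')) * e r (t r)‖
        ≤ ∑ _r : Fin m, B * (F.bound θ + F.bound θ₀) := fun s hs t ht =>
    norm_sum_le_of_le _ fun r _ => by
      rw [norm_mul]
      exact mul_le_mul (aux_bound h hs ht _) (heb r _ (ht r)) (norm_nonneg _) hBpos
  have hmeasE : ∀ s, Measurable fun t : Fin m → ℝ =>
      ∑ r, (∏ r' ∈ Finset.univ.erase r, F.defDeriv θ₀ θ s r' (t r')) * e r (t r) := fun s =>
    Finset.measurable_sum _ fun r _ => (measurable_prod_defDeriv s _).mul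
      ((hem r).comp (measurable_pi_apply r))
  have hInt1 : ∀ l, IntegrableOn (fun t => (F.pos θ t l - F.pos θ₀ t l)
      * F.defIntegrand q (covDeriv q l G) θ₀ θ s t * ∏ r, F.defDeriv θ₀ θ s r (t r)) (cube m) := by
    intro l
    have c1 : ∀ θ ∈ chamber n, ContinuousOn (fun t => F.pos θ t l) (cube m) := fun θ hθ =>
      continuousOn_pi.1 (F.continuousOn_pos.comp (f := fun t : Fin m → ℝ => (θ, t)) (by fun_prop)
        fun z hz => ⟨hθ, hz⟩) l
    refine integrableOn_cube_mul (((c1 θ h.right_mem).sub (c1 θ₀ h.left_mem)).mul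
      (h.continuousOn_defIntegrand_right (hcov l) hs'))
      (measurable_prod_defDeriv s _).aestronglyMeasurable (C := B) ?_
    filter_upwards [ae_cube_notMem F.S_countable] with t ht
    exact aux_bound h hs' ht.2 _
  have hP_int : ∀ s ∈ Set.Icc (-1 : ℝ) 2, IntegrableOn (P s) (cube m) := by
    intro s hs
    refine IntegrableOn.add ?_ ?_
    · refine integrableOn_cube_mul (hc1.comp (f := fun t => (s, t)) (by fun_prop)
        fun t ht => ⟨hs, ht⟩) (measurable_prod_defDeriv s _).aestronglyMeasurable (C := B) ?_
      filter_upwards [ae_cube_notMem F.S_countable] with t ht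
      exact aux_bound h hs ht.2 _
    · refine integrableOn_cube_mul (h.continuousOn_defIntegrand_right hG.continuousOn hs)
        (hmeasE s).aestronglyMeasurable (C := ∑ _r : Fin m, B * (F.bound θ + F.bound θ₀)) ?_
      filter_upwards [ae_cube_notMem F.S_countable] with t ht
      exact hE s hs t ht.2
  have key := (hasDerivAt_integral_of_dominated_loc_of_deriv_le (μ := volume.restrict (cube m))
    (F := fun s t => F.defIntegrand q G θ₀ θ s t * ∏ r, F.defDeriv θ₀ θ s r (t r)) (F' := P)
    (bound := fun _ => C1 * B + C2 * ∑ _r : Fin m, B * (F.bound θ + F.bound θ₀))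
    (Ioo_mem_nhds hs.1 hs.2) ?_ (integrableOn_def h hG.continuousOn hs' _)
    (hP_int s hs').aestronglyMeasurable ?_ ?_ ?_).2
  · refine key.congr_deriv ?_
    -- With η the displacement of the r-th contour, the effect of moving the r-th screening variable
    -- and the effect of changing its speed combine into a total derivative in t r. Only the motion
    -- of the points θ contributes.
    have hz : ∀ r : Fin m, _ := fun r => integral_contour_deriv (q := q) h hG hs' r
      (η := fun τ => F.γ r θ τ - F.γ r θ₀ τ) (η' := e r) (C := F.bound θ + F.bound θ₀)
      (((F.γ_continuous r).comp (f := fun τ : ℝ => (θ, τ)) (by fun_prop)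
        fun τ hτ => ⟨h.right_mem, hτ⟩).sub
      ((F.γ_continuous r).comp (f := fun τ : ℝ => (θ₀, τ)) (by fun_prop)
        fun τ hτ => ⟨h.left_mem, hτ⟩))
      (fun τ hτ => (F.γ_differentiable r θ h.right_mem τ hτ).hasDerivAt.sub
        (F.γ_differentiable r θ₀ h.left_mem τ hτ).hasDerivAt)
      (by rw [F.γ_closed r θ h.right_mem, F.γ_closed r θ₀ h.left_mem]) (hem r) (heb r)
    have hsplit : P s = fun t =>
        (∑ j, (F.pos θ t (Sum.inl j) - F.pos θ₀ t (Sum.inl j))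
          * F.defIntegrand q (covDeriv q (Sum.inl j) G) θ₀ θ s t
            * ∏ r, F.defDeriv θ₀ θ s r (t r))
        + ∑ r, (F.defIntegrand q (covDeriv q (Sum.inr r) G) θ₀ θ s t
          * (F.γ r θ (t r) - F.γ r θ₀ (t r)) * (∏ r, F.defDeriv θ₀ θ s r (t r))
          + F.defIntegrand q G θ₀ θ s t * e r (t r)
            * ∏ r' ∈ Finset.univ.erase r, F.defDeriv θ₀ θ s r' (t r')) := by
      ext t
      simp only [hP, Fintype.sum_sum_type, add_mul, Finset.sum_mul, Finset.sum_add_distrib,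
        Finset.mul_sum, add_assoc]
      congr 1
      congr 1
      · refine Finset.sum_congr rfl fun r _ => ?_
        simp only [pos, Sum.elim_inr]
        ring
      · refine Finset.sum_congr rfl fun r _ => ?_
        ring
    have hz2 : ∀ r, IntegrableOn (fun t => F.defIntegrand q (covDeriv q (Sum.inr r) G) θ₀ θ s t
          * (F.γ r θ (t r) - F.γ r θ₀ (t r)) * (∏ r, F.defDeriv θ₀ θ s r (t r))
          + F.defIntegrand q G θ₀ θ s t * e r (t r)
            * ∏ r' ∈ Finset.univ.erase r, F.defDeriv θ₀ θ s r' (t r')) (cube m) :=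
      fun r => (hz r).1.add (hz r).2.1
    rw [hsplit]
    beta_reduce
    rw [integral_add (integrable_finsetSum _ fun j _ => hInt1 _)
      (integrable_finsetSum _ fun r _ => hz2 r),
      integral_finsetSum _ fun j _ => hInt1 _,
      integral_finsetSum _ fun r _ => hz2 r,
      Finset.sum_eq_zero (s := Finset.univ (α := Fin m)) fun r _ => (hz r).2.2, add_zero]
    refine Finset.sum_congr rfl fun j _ => ?_
    rw [defIntegral, ← integral_const_mul]
    refine integral_congr_ae (Eventually.of_forall fun t => ?_)
    simp only [pos, Sum.elim_inl]
    push_cast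
    ring
  · filter_upwards [Ioo_mem_nhds hs.1 hs.2] with σ hσ
    exact (integrableOn_def h hG.continuousOn (Ioo_subset_Icc_self hσ) _).aestronglyMeasurable
  · filter_upwards [ae_cube_notMem F.S_countable] with t ht σ hσ
    have hσ' := Ioo_subset_Icc_self hσ
    refine (norm_add_le _ _).trans (add_le_add ?_ ?_)
    · rw [norm_mul]
      exact mul_le_mul (hC1 (σ, t) ⟨hσ', ht.1⟩) (aux_bound h hσ' ht.2 _) (norm_nonneg _)
        ((norm_nonneg _).trans (hC1 (σ, t) ⟨hσ', ht.1⟩))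
    · rw [norm_mul]
      exact mul_le_mul (hC2 (σ, t) ⟨hσ', ht.1⟩) (hE σ hσ' t ht.2) (norm_nonneg _)
        ((norm_nonneg _).trans (hC2 (σ, t) ⟨hσ', ht.1⟩))
  · have : IsFiniteMeasure (volume.restrict (cube m)) :=
      ⟨by simpa using (isCompact_cube m).measure_lt_top⟩
    exact integrable_const _
  · filter_upwards [ae_cube_notMem F.S_countable] with t ht σ hσ
    have h1 := h.hasDerivAt_defIntegrand_left (q := q) (hG.differentiableOn one_ne_zero) hσ ht.1
    have h2 : HasDerivAt (fun σ : ℝ => ∏ r, F.defDeriv θ₀ θ σ r (t r))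
        (∑ r, (∏ r' ∈ Finset.univ.erase r, F.defDeriv θ₀ θ σ r' (t r')) • e r (t r)) σ := by
      refine HasDerivAt.fun_finsetProd fun r _ => ?_
      have := ((Complex.ofRealCLM.hasDerivAt (x := σ)).mul_const
        (e r (t r))).const_add (deriv (F.γ r θ₀) (t r))
      rw [Complex.ofRealCLM_apply, Complex.ofReal_one, one_mul] at this
      exact this
    exact h1.mul h2

end LiftedFamily

end RadialCoulomb
end

noncomputable section

namespace RadialCoulomb

open MeasureTheory Filter Topology Set

/-! ### Uniformity of the deformation and the derivative of the integral in θ -/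

theorem continuousAt_of_continuousOn_prod {X Y Z W : Type*} [TopologicalSpace X]
    [TopologicalSpace Y] [TopologicalSpace Z] [TopologicalSpace W] {f : X × Y → W} {U : Set X}
    {K : Set Y} (hf : ContinuousOn f (U ×ˢ K)) (hU : IsOpen U) {x : X} (hx : x ∈ U) {g : Z → Y}
    (hg : Continuous g) (hgK : ∀ z, g z ∈ K) (z : Z) :
    ContinuousAt (fun w : X × Z => f (w.1, g w.2)) (x, z) := by
  refine (hf (x, g z) ⟨hx, hgK z⟩).tendsto.comp (tendsto_nhdsWithin_iff.2 ⟨?_, ?_⟩)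
  · exact (by fun_prop : Continuous fun w : X × Z => (w.1, g w.2)).continuousAt
  · filter_upwards [continuous_fst.continuousAt.preimage_mem_nhds (hU.mem_nhds hx)] with w hw
    exact ⟨hw, hgK _⟩

namespace LiftedFamily

variable {n m : ℕ} {F : LiftedFamily n m} {θ₀ θ : Fin n → ℝ} {q : Fin n ⊕ Fin m → ℝ}
  {G : (Fin n ⊕ Fin m → ℂ) → ℂ}

theorem continuousAt_pos (hθ : θ₀ ∈ chamber n) (y : ↥(Set.Icc (-1 : ℝ) 2) × ↥(cube m)) :
    ContinuousAt (fun z : (Fin n → ℝ) × ↥(Set.Icc (-1 : ℝ) 2) × ↥(cube m) =>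
      F.pos z.1 z.2.2) (θ₀, y) :=
  continuousAt_of_continuousOn_prod F.continuousOn_pos (isOpen_chamber n) hθ
    (g := fun y : ↥(Set.Icc (-1 : ℝ) 2) × ↥(cube m) => (y.2 : Fin m → ℝ)) (by fun_prop)
    (fun y => y.2.2) y

theorem continuousAt_fst_const {f : (Fin n → ℝ) × (Fin m → ℝ) → ℂ}
    (hf : ContinuousOn f (chamber n ×ˢ cube m))
    (hθ : θ₀ ∈ chamber n) (y : ↥(Set.Icc (-1 : ℝ) 2) × ↥(cube m)) :
    ContinuousAt (fun z : (Fin n → ℝ) × ↥(Set.Icc (-1 : ℝ) 2) × ↥(cube m) =>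
      f (θ₀, z.2.2)) (θ₀, y) :=
  (continuousAt_of_continuousOn_prod hf (isOpen_chamber n) hθ
    (g := fun y : ↥(Set.Icc (-1 : ℝ) 2) × ↥(cube m) => (y.2 : Fin m → ℝ)) (by fun_prop)
    (fun y => y.2.2) y).comp (f := fun z : (Fin n → ℝ) × ↥(Set.Icc (-1 : ℝ) 2) × ↥(cube m) =>
      (θ₀, z.2)) (x := (θ₀, y)) (by fun_prop)

theorem continuousAt_defPos (hθ : θ₀ ∈ chamber n) (y : ↥(Set.Icc (-1 : ℝ) 2) × ↥(cube m)) :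
    ContinuousAt (fun z : (Fin n → ℝ) × ↥(Set.Icc (-1 : ℝ) 2) × ↥(cube m) =>
      F.defPos θ₀ z.1 z.2.1 z.2.2) (θ₀, y) := by
  refine continuousAt_pi.2 fun l => ?_
  have h1 := continuousAt_pi.1 (continuousAt_pos (F := F) hθ y) l
  have h0 := continuousAt_fst_const (continuousOn_pi.1 F.continuousOn_pos l) hθ y
  have hs : ContinuousAt (fun z : (Fin n → ℝ) × ↥(Set.Icc (-1 : ℝ) 2) × ↥(cube m) =>
      ((z.2.1 : ℝ) : ℂ)) (θ₀, y) := by fun_prop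
  exact h0.add (hs.mul (h1.sub h0))

theorem continuousAt_defRatio (hθ : θ₀ ∈ chamber n) {l k : Fin n ⊕ Fin m} (hlk : l ≠ k)
    (y : ↥(Set.Icc (-1 : ℝ) 2) × ↥(cube m)) :
    ContinuousAt (fun z : (Fin n → ℝ) × ↥(Set.Icc (-1 : ℝ) 2) × ↥(cube m) =>
      F.defRatio θ₀ z.1 z.2.1 z.2.2 l k) (θ₀, y) := by
  have hp := continuousAt_pi.1 (continuousAt_defPos (F := F) hθ y)
  have h0 := fun l => continuousAt_fst_const (continuousOn_pi.1 F.continuousOn_pos l) hθ y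
  have hsin : ∀ {X Y : (Fin n → ℝ) × ↥(Set.Icc (-1 : ℝ) 2) × ↥(cube m) → ℂ} {z},
      ContinuousAt X z → ContinuousAt Y z →
      ContinuousAt (fun z => Complex.sin ((X z - Y z) / 2) ^ 2) z := fun hX hY =>
    (Complex.continuous_sin.continuousAt.comp ((hX.sub hY).div_const 2)).pow 2
  exact (hsin (hp l) (hp k)).div (hsin (h0 l) (h0 k))
    (pow_ne_zero 2 (sin_ne_zero_of_mem (F.pos_mem hθ y.2.2) hlk))

theorem continuousAt_defIntegrand (hθ : θ₀ ∈ chamber n) (hG : ContinuousOn G (configSpace n m))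
    (y : ↥(Set.Icc (-1 : ℝ) 2) × ↥(cube m)) :
    ContinuousAt (fun z : (Fin n → ℝ) × ↥(Set.Icc (-1 : ℝ) 2) × ↥(cube m) =>
      F.defIntegrand q G θ₀ z.1 z.2.1 z.2.2) (θ₀, y) := by
  have h1 : ∀ l k, ContinuousAt (fun z : (Fin n → ℝ) × ↥(Set.Icc (-1 : ℝ) 2) × ↥(cube m) =>
      F.defLog θ₀ z.1 z.2.1 z.2.2 l k) (θ₀, y) := by
    intro l k
    rcases eq_or_ne l k with rfl | hlk
    · simp only [defLog_self_index]
      exact continuousAt_const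
    · refine (continuousAt_fst_const (F.L_continuous l k) hθ y).add
        (continuousAt_const.mul ((continuousAt_defRatio hθ hlk y).clog ?_))
      simp only
      rw [defRatio_eq_one hθ y.2.2 (defPos_self _ _) hlk]
      exact Complex.one_mem_slitPlane
  have h2 : ContinuousAt G (F.defPos θ₀ θ₀ y.1 y.2) := by
    rw [defPos_self]
    exact hG.continuousAt ((isOpen_configSpace n m).mem_nhds (F.pos_mem hθ y.2.2))
  unfold defIntegrand expWeight
  refine ContinuousAt.mul ?_ (ContinuousAt.comp (g := G) h2 (continuousAt_defPos hθ y))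
  fun_prop

/-- Tube lemma over the compact set [-1,2] × `cube m`: an open condition that holds at θ₀ for all
parameters holds for all parameters near θ₀. -/
theorem eventually_forall_deformation {P : (Fin n → ℝ) → ℝ → (Fin m → ℝ) → Prop}
    (hP : ∀ y : ↥(Set.Icc (-1 : ℝ) 2) × ↥(cube m),
      ∀ᶠ z : (Fin n → ℝ) × ↥(Set.Icc (-1 : ℝ) 2) × ↥(cube m) in 𝓝 (θ₀, y),
        P z.1 z.2.1 z.2.2) :
    ∀ᶠ θ in 𝓝 θ₀, ∀ s ∈ Set.Icc (-1 : ℝ) 2, ∀ t ∈ cube m, P θ s t := by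
  have : CompactSpace ↥(cube m) := isCompact_iff_compactSpace.1 (isCompact_cube m)
  have := (isCompact_univ (X := ↥(Set.Icc (-1 : ℝ) 2) × ↥(cube m))).eventually_forall_of_forall_eventually
    (P := fun θ y => P θ y.1 y.2) fun y _ => hP y
  exact this.mono fun θ h s hs t ht => h (⟨s, hs⟩, ⟨t, ht⟩) trivial

/-- At θ = θ₀ the deformation is constant: the positions lie in the open configuration space, the
quotients of sines are 1 and the logarithms differ by 0. All requirements are open there, and
compactness makes them uniform. -/
theorem eventually_isNear (hθ : θ₀ ∈ chamber n) : ∀ᶠ θ in 𝓝 θ₀, F.IsNear θ₀ θ := by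
  have e1 := eventually_forall_deformation (θ₀ := θ₀)
    (P := fun θ s t => F.defPos θ₀ θ s t ∈ configSpace n m) fun y =>
      (continuousAt_defPos hθ y).preimage_mem_nhds ((isOpen_configSpace n m).mem_nhds (by
        rw [defPos_self]; exact F.pos_mem hθ y.2.2))
  have e2 : ∀ᶠ θ in 𝓝 θ₀, ∀ l k, l ≠ k → ∀ s ∈ Set.Icc (-1 : ℝ) 2, ∀ t ∈ cube m,
      F.defRatio θ₀ θ s t l k ∈ Complex.slitPlane := by
    refine eventually_all.2 fun l => eventually_all.2 fun k => ?_
    by_cases hlk : l = k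
    · exact Eventually.of_forall fun _ h => absurd hlk h
    · refine (eventually_forall_deformation (θ₀ := θ₀)
        (P := fun θ s t => F.defRatio θ₀ θ s t l k ∈ Complex.slitPlane) fun y =>
        (continuousAt_defRatio hθ hlk y).preimage_mem_nhds
          (Complex.isOpen_slitPlane.mem_nhds ?_)).mono fun θ h _ => h
      rw [defRatio_eq_one hθ y.2.2 (defPos_self _ _) hlk]
      exact Complex.one_mem_slitPlane
  have e3 : ∀ᶠ θ in 𝓝 θ₀, ∀ l k, l ≠ k → ∀ s ∈ Set.Icc (-1 : ℝ) 2, ∀ t ∈ cube m,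
      ‖2 * F.L l k θ t - 2 * F.L l k θ₀ t‖ < Real.pi := by
    refine eventually_all.2 fun l => eventually_all.2 fun k => ?_
    refine (eventually_forall_deformation (θ₀ := θ₀)
      (P := fun θ _ t => ‖2 * F.L l k θ t - 2 * F.L l k θ₀ t‖ < Real.pi) fun y => ?_).mono
        fun θ h _ => h
    have c1 := continuousAt_of_continuousOn_prod (F.L_continuous l k) (isOpen_chamber n) hθ
      (g := fun y : ↥(Set.Icc (-1 : ℝ) 2) × ↥(cube m) => (y.2 : Fin m → ℝ)) (by fun_prop)
      (fun y => y.2.2) y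
    have c2 := continuousAt_fst_const (F.L_continuous l k) hθ y
    have c3 := ((continuousAt_const (y := (2 : ℂ))).mul c1).sub
      ((continuousAt_const (y := (2 : ℂ))).mul c2)
    refine c3.norm.eventually_lt_const ?_
    simpa using Real.pi_pos
  filter_upwards [(isOpen_chamber n).mem_nhds hθ, e1, e2, e3] with θ h0 h1 h2 h3
  exact ⟨hθ, h0, h1, fun s hs t ht l k hlk => h2 l k hlk s hs t ht,
    fun t ht l k hlk => h3 l k hlk 0 (by norm_num) t ht⟩

theorem eventually_norm_defIntegrand_sub_lt (hθ : θ₀ ∈ chamber n)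
    (hG : ContinuousOn G (configSpace n m)) {ε : ℝ} (hε : 0 < ε) :
    ∀ᶠ θ in 𝓝 θ₀, ∀ s ∈ Set.Icc (-1 : ℝ) 2, ∀ t ∈ cube m,
      ‖F.defIntegrand q G θ₀ θ s t - F.defIntegrand q G θ₀ θ₀ 0 t‖ < ε := by
  refine eventually_forall_deformation fun y => ?_
  have c1 := continuousAt_defIntegrand (F := F) (q := q) hθ hG y
  have c2 : ContinuousAt (fun z : (Fin n → ℝ) × ↥(Set.Icc (-1 : ℝ) 2) × ↥(cube m) =>
      F.defIntegrand q G θ₀ θ₀ 0 z.2.2) (θ₀, y) := by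
    refine (continuousAt_defIntegrand (F := F) (q := q) hθ hG (⟨0, by norm_num⟩, y.2)).comp
      (f := fun z : (Fin n → ℝ) × ↥(Set.Icc (-1 : ℝ) 2) × ↥(cube m) =>
        (θ₀, ((⟨0, by norm_num⟩, z.2.2) : ↥(Set.Icc (-1 : ℝ) 2) × ↥(cube m)))) (x := (θ₀, y)) ?_
    fun_prop
  refine (c1.sub c2).norm.eventually_lt_const ?_
  simp only [Pi.sub_apply]
  rw [defIntegrand_self hθ _ y.2.2, defIntegrand_self hθ _ y.2.2, sub_self, norm_zero]
  exact hε

/-- The principal filter of [0,1] makes the limit uniform in s. Dominated convergence applies: the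
integrand converges uniformly on the cube, and the speeds converge off S with a bound that is
locally uniform in θ. -/
theorem tendsto_defIntegral (hθ : θ₀ ∈ chamber n) (hG : ContinuousOn G (configSpace n m)) :
    Tendsto (fun z : (Fin n → ℝ) × ℝ => F.defIntegral q G θ₀ z.1 z.2)
      (𝓝 θ₀ ×ˢ 𝓟 (Set.Icc 0 1)) (𝓝 (F.integral q G θ₀)) := by
  rw [← defIntegral_zero (θ := θ₀) hθ]
  have hfst : Tendsto (Prod.fst : (Fin n → ℝ) × ℝ → (Fin n → ℝ)) (𝓝 θ₀ ×ˢ 𝓟 (Set.Icc 0 1))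
    (𝓝 θ₀) := tendsto_fst
  have hsnd : ∀ᶠ z : (Fin n → ℝ) × ℝ in 𝓝 θ₀ ×ˢ 𝓟 (Set.Icc (0 : ℝ) 1), z.2 ∈ Set.Icc (0 : ℝ) 1 :=
    (tendsto_snd (f := 𝓝 θ₀)).eventually (eventually_principal.2 fun _ h => h)
  have hsub : Set.Icc (0 : ℝ) 1 ⊆ Set.Icc (-1) 2 := Icc_subset_Icc (by norm_num) (by norm_num)
  have hbound : ∀ᶠ θ in 𝓝 θ₀, F.bound θ < F.bound θ₀ + 1 :=
    (F.bound_continuous.continuousAt ((isOpen_chamber n).mem_nhds hθ)).eventually_lt_const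
      (by linarith)
  have hcont0 := (isNear_self (F := F) hθ).continuousOn_defIntegrand_right (q := q) hG
    (s := 0) (by norm_num)
  obtain ⟨C, hC⟩ := (isCompact_cube m).exists_bound_of_continuousOn hcont0
  unfold defIntegral
  refine tendsto_integral_filter_of_dominated_convergence
    (fun _ => (C + 1) * (max 1 (3 * F.bound θ₀ + 2 * (F.bound θ₀ + 1))) ^ m) ?_ ?_ ?_ ?_
  · filter_upwards [hfst.eventually (eventually_isNear (F := F) hθ), hsnd] with z hz hs
    exact (integrableOn_def hz hG (hsub hs) _).aestronglyMeasurable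
  · filter_upwards [hfst.eventually (eventually_isNear (F := F) hθ), hsnd, hfst.eventually hbound,
      hfst.eventually (eventually_norm_defIntegrand_sub_lt (F := F) (q := q) hθ hG one_pos)]
      with z hz hs hb hd
    filter_upwards [ae_cube_notMem F.S_countable] with t ht
    rw [norm_mul]
    have h1 : ‖F.defIntegrand q G θ₀ z.1 z.2 t‖ ≤ C + 1 := by
      have h2 := hd z.2 (hsub hs) t ht.1
      have h3 := hC t ht.1
      have h4 := norm_le_norm_add_norm_sub (F.defIntegrand q G θ₀ θ₀ 0 t)
        (F.defIntegrand q G θ₀ z.1 z.2 t)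
      rw [norm_sub_rev] at h4
      linarith
    refine mul_le_mul h1 ((aux_bound hz (hsub hs) ht.2 _).trans ?_) (norm_nonneg _)
      ((norm_nonneg _).trans h1)
    gcongr
  · have : IsFiniteMeasure (volume.restrict (cube m)) :=
      ⟨by simpa using (isCompact_cube m).measure_lt_top⟩
    exact integrable_const _
  · filter_upwards [ae_cube_notMem F.S_countable] with t ht
    refine Tendsto.mul ?_ (tendsto_finsetProd _ fun r _ => ?_)
    · rw [Metric.tendsto_nhds]
      intro ε hε
      filter_upwards [hfst.eventually (eventually_norm_defIntegrand_sub_lt (F := F) (q := q)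
        hθ hG hε), hsnd] with z hz hs
      rw [dist_eq_norm]
      exact hz z.2 (hsub hs) t ht.1
    · have h1 : Tendsto (fun z : (Fin n → ℝ) × ℝ => deriv (F.γ r z.1) (t r)
          - deriv (F.γ r θ₀) (t r)) (𝓝 θ₀ ×ˢ 𝓟 (Set.Icc 0 1)) (𝓝 0) := by
        have := (((F.deriv_continuous r (t r) (ht.2 r)).continuousAt
          ((isOpen_chamber n).mem_nhds hθ)).tendsto.comp hfst).sub_const (deriv (F.γ r θ₀) (t r))
        rwa [sub_self] at this
      have h2 : Tendsto (fun z : (Fin n → ℝ) × ℝ => (z.2 : ℂ) * (deriv (F.γ r z.1) (t r)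
          - deriv (F.γ r θ₀) (t r))) (𝓝 θ₀ ×ˢ 𝓟 (Set.Icc 0 1)) (𝓝 0) := by
        refine squeeze_zero_norm' ?_ (by simpa using h1.norm)
        filter_upwards [hsnd] with z hz
        rw [norm_mul, Complex.norm_real, Real.norm_eq_abs, abs_of_nonneg hz.1]
        exact mul_le_of_le_one_left (norm_nonneg _) hz.2
      unfold defDeriv
      simpa using h2.const_add (deriv (F.γ r θ₀) (t r))

theorem eventually_norm_defIntegral_sub_lt (hθ : θ₀ ∈ chamber n)
    (hG : ContinuousOn G (configSpace n m)) {ε : ℝ} (hε : 0 < ε) :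
    ∀ᶠ θ in 𝓝 θ₀, ∀ s ∈ Set.Icc (0 : ℝ) 1,
      ‖F.defIntegral q G θ₀ θ s - F.integral q G θ₀‖ < ε := by
  have := Metric.tendsto_nhds.1 (tendsto_defIntegral (F := F) (q := q) hθ hG) ε hε
  simp only [dist_eq_norm] at this
  exact eventually_prod_principal_iff.1 this

/-- The derivative of a Coulomb gas integral with respect to the points `θ`. -/
theorem hasFDerivAt_integral (hθ : θ₀ ∈ chamber n) (hG : ContDiffOn ℂ 1 G (configSpace n m)) :
    HasFDerivAt (F.integral q G)
      (∑ j, (ContinuousLinearMap.proj (R := ℝ) (φ := fun _ : Fin n => ℝ) j).smulRight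
        (F.integral q (covDeriv q (Sum.inl j) G) θ₀)) θ₀ := by
  have hcov : ∀ l, ContinuousOn (covDeriv q l G) (configSpace n m) := fun l =>
    (contDiffOn_covDeriv (k := 0) (by simp) q l hG).continuousOn
  rw [hasFDerivAt_iff_isLittleO, Asymptotics.isLittleO_iff]
  intro ε hε
  -- One share of ε for each of the n coordinates; n + 1 keeps the denominator positive when n = 0.
  have hε' : 0 < ε / (n + 1) := by positivity
  have hev : ∀ᶠ θ in 𝓝 θ₀, ∀ j : Fin n, ∀ s ∈ Set.Icc (0 : ℝ) 1,
      ‖F.defIntegral q (covDeriv q (Sum.inl j) G) θ₀ θ s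
        - F.integral q (covDeriv q (Sum.inl j) G) θ₀‖ < ε / (n + 1) :=
    eventually_all.2 fun j => eventually_norm_defIntegral_sub_lt hθ (hcov _) hε'
  filter_upwards [eventually_isNear (F := F) hθ, hev] with θ h hd
  set c : ℂ := ∑ j, ((θ j - θ₀ j : ℝ) : ℂ) * F.integral q (covDeriv q (Sum.inl j) G) θ₀ with hc
  have hA : (∑ j, (ContinuousLinearMap.proj (R := ℝ) (φ := fun _ : Fin n => ℝ) j).smulRight
        (F.integral q (covDeriv q (Sum.inl j) G) θ₀)) (θ - θ₀) = c := by
    simp [hc]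
  rw [hA]
  -- Subtracting s times the expected increment c leaves a function on [0,1] with derivative at most
  -- ε‖θ - θ₀‖. The mean value inequality between s = 0 and s = 1 is then the little-o estimate.
  have hder : ∀ s ∈ Set.Icc (0 : ℝ) 1, HasDerivWithinAt
      (fun s : ℝ => F.defIntegral q G θ₀ θ s - s * c)
      (∑ j, ((θ j - θ₀ j : ℝ) : ℂ) * (F.defIntegral q (covDeriv q (Sum.inl j) G) θ₀ θ s
        - F.integral q (covDeriv q (Sum.inl j) G) θ₀)) (Set.Icc 0 1) s := by
    intro s hs
    have h1 := hasDerivAt_defIntegral (q := q) h hG (s := s)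
      ⟨by linarith [hs.1], by linarith [hs.2]⟩
    have h2 := (Complex.ofRealCLM.hasDerivAt (x := s)).mul_const c
    rw [Complex.ofRealCLM_apply, Complex.ofReal_one, one_mul] at h2
    refine ((h1.sub h2).congr_deriv ?_).hasDerivWithinAt
    rw [hc, ← Finset.sum_sub_distrib]
    exact Finset.sum_congr rfl fun j _ => by ring
  have hb : ∀ s ∈ Set.Ico (0 : ℝ) 1,
      ‖∑ j, ((θ j - θ₀ j : ℝ) : ℂ) * (F.defIntegral q (covDeriv q (Sum.inl j) G) θ₀ θ s
        - F.integral q (covDeriv q (Sum.inl j) G) θ₀)‖ ≤ ε * ‖θ - θ₀‖ := by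
    intro s hs
    calc _ ≤ ∑ _j : Fin n, ‖θ - θ₀‖ * (ε / (n + 1)) := by
          refine norm_sum_le_of_le _ fun j _ => ?_
          rw [norm_mul, Complex.norm_real]
          exact mul_le_mul (norm_le_pi_norm (θ - θ₀) j) (hd j s ⟨hs.1, hs.2.le⟩).le
            (norm_nonneg _) (norm_nonneg _)
      _ = (n / (n + 1)) * (ε * ‖θ - θ₀‖) := by
          rw [Finset.sum_const, Finset.card_univ, Fintype.card_fin, nsmul_eq_mul]
          ring
      _ ≤ 1 * (ε * ‖θ - θ₀‖) := by
          refine mul_le_mul_of_nonneg_right ?_ (by positivity)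
          rw [div_le_one (by positivity)]
          linarith
      _ = _ := one_mul _
  have := norm_image_sub_le_of_norm_deriv_le_segment_01' hder hb
  simp only [Complex.ofReal_one, Complex.ofReal_zero, one_mul, zero_mul, sub_zero,
    defIntegral_zero hθ, h.defIntegral_one] at this
  rwa [sub_right_comm] at this

/-- The partial derivatives are integrals of the same kind, with G replaced by its covariant
derivatives, so induction applies; each order uses up one order of smoothness of G. -/
theorem contDiffOn_integral (k : ℕ) : ∀ {G : (Fin n ⊕ Fin m → ℂ) → ℂ},
    ContDiffOn ℂ (k + 1) G (configSpace n m) → ContDiffOn ℝ k (F.integral q G) (chamber n) := by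
  induction k with
  | zero =>
    intro G hG
    refine contDiffOn_zero.2 fun θ hθ => ?_
    exact (hasFDerivAt_integral hθ (by simpa using hG)).continuousAt.continuousWithinAt
  | succ k ih =>
    intro G hG
    have hG1 : ContDiffOn ℂ 1 G (configSpace n m) := hG.of_le (by simp)
    have h1 : ∀ θ ∈ chamber n, HasFDerivAt (F.integral q G) _ θ :=
      fun θ hθ => hasFDerivAt_integral hθ hG1
    rw [Nat.cast_add, Nat.cast_one, contDiffOn_succ_iff_fderiv_of_isOpen (isOpen_chamber n)]
    refine ⟨fun θ hθ => (h1 θ hθ).differentiableAt.differentiableWithinAt, by simp, ?_⟩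
    refine ContDiffOn.congr ?_ fun θ hθ => (h1 θ hθ).fderiv
    refine ContDiffOn.sum fun j _ => contDiffOn_const.smulRight (ih ?_)
    exact contDiffOn_covDeriv (by simp) q _ hG

/-! ### From total derivatives to the differential equations -/

theorem partialDeriv_congr {f g : (Fin n → ℝ) → ℂ} (h : ∀ θ ∈ chamber n, f θ = g θ) (j : Fin n)
    (hθ : θ ∈ chamber n) : partialDeriv j f θ = partialDeriv j g θ := by
  refine Filter.EventuallyEq.deriv_eq ?_
  have hc : ContinuousAt (fun x : ℝ => Function.update θ j x) (θ j) := by fun_prop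
  have := hc.preimage_mem_nhds ((isOpen_chamber n).mem_nhds (by simpa using hθ))
  filter_upwards [this] with x hx
  exact h _ hx

theorem partialDeriv_integral (hθ : θ ∈ chamber n) (hG : ContDiffOn ℂ 1 G (configSpace n m))
    (j : Fin n) : partialDeriv j (F.integral q G) θ
      = F.integral q (covDeriv q (Sum.inl j) G) θ := by
  have h1 : HasFDerivAt (F.integral q G) _ (Function.update θ j (θ j)) :=
    hasFDerivAt_integral (by simpa using hθ) hG
  refine (h1.comp_hasDerivAt (θ j) (hasDerivAt_update θ j (θ j))).deriv.trans ?_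
  simp [Pi.single_apply]

theorem integral_congr {H H' : (Fin n ⊕ Fin m → ℂ) → ℂ}
    (h : ∀ t ∈ cube m, H (F.pos θ t) = H' (F.pos θ t)) :
    F.integral q H θ = F.integral q H' θ :=
  setIntegral_congr_fun (measurableSet_cube m) fun t ht => by simp only [h t ht]

theorem integral_add {H H' : (Fin n ⊕ Fin m → ℂ) → ℂ} (hθ : θ ∈ chamber n)
    (h : ContinuousOn H (configSpace n m)) (h' : ContinuousOn H' (configSpace n m)) :
    F.integral q (fun x => H x + H' x) θ = F.integral q H θ + F.integral q H' θ := by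
  unfold integral
  rw [← MeasureTheory.integral_add (integrableOn_integrand hθ h) (integrableOn_integrand hθ h')]
  simp only [mul_add, add_mul]

theorem integral_const_mul (c : ℂ) (H : (Fin n ⊕ Fin m → ℂ) → ℂ) :
    F.integral q (fun x => c * H x) θ = c * F.integral q H θ := by
  unfold integral
  rw [← MeasureTheory.integral_const_mul]
  refine MeasureTheory.integral_congr_ae (Eventually.of_forall fun t => ?_)
  ring

theorem integral_finsetSum {α : Type*} (s : Finset α) {H : α → (Fin n ⊕ Fin m → ℂ) → ℂ}
    (hθ : θ ∈ chamber n) (h : ∀ a, ContinuousOn (H a) (configSpace n m)) :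
    F.integral q (fun x => ∑ a ∈ s, H a x) θ = ∑ a ∈ s, F.integral q (H a) θ := by
  unfold integral
  rw [← MeasureTheory.integral_finsetSum _ fun a _ => integrableOn_integrand hθ (h a)]
  simp only [Finset.mul_sum, Finset.sum_mul]

/-- If the null vector operator turns the integrand into a total derivative, then the integral
solves the null vector equations. -/
theorem solvesNullVector_of_total_derivative {κ h : ℝ} {ψ : (Fin n → ℝ) → ℂ}
    (hψ : ∀ θ ∈ chamber n, ψ θ = F.integral q G θ) (hG : ContDiffOn ℂ 3 G (configSpace n m))
    (Q : Fin n → Fin m → (Fin n ⊕ Fin m → ℂ) → ℂ)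
    (hQ : ∀ i r, ContDiffOn ℂ 1 (Q i r) (configSpace n m))
    (hN : ∀ i, ∀ x ∈ configSpace n m,
      (κ / 2 : ℝ) * covDeriv q (Sum.inl i) (covDeriv q (Sum.inl i) G) x
        + ∑ j ∈ Finset.univ.erase i,
          Complex.cot ((x (Sum.inl j) - x (Sum.inl i)) / 2) * covDeriv q (Sum.inl j) G x
        + ((1 - 6 / κ : ℝ) : ℂ) * (∑ j ∈ Finset.univ.erase i,
          1 / (4 * Complex.sin ((x (Sum.inl j) - x (Sum.inl i)) / 2) ^ 2)) * G x - (h : ℂ) * G x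
      = ∑ r, covDeriv q (Sum.inr r) (Q i r) x) : SolvesNullVector κ h ψ := by
  have hG1 : ContDiffOn ℂ 1 G (configSpace n m) := hG.of_le (by norm_num)
  have hD : ∀ l, ContDiffOn ℂ 1 (covDeriv q l G) (configSpace n m) := fun l =>
    contDiffOn_covDeriv (by norm_num) q l hG
  have hDD : ∀ l, ContinuousOn (covDeriv q l (covDeriv q l G)) (configSpace n m) := fun l =>
    (contDiffOn_covDeriv (k := 0) (by simp) q l (hD l)).continuousOn
  refine ⟨(contDiffOn_integral (F := F) (q := q) 2 (by norm_num; exact hG)).congr hψ, ?_⟩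
  intro θ hθ i
  have e1 : ∀ j, ∀ θ ∈ chamber n, partialDeriv j ψ θ = F.integral q (covDeriv q (Sum.inl j) G) θ :=
    fun j θ hθ => by rw [partialDeriv_congr hψ j hθ, partialDeriv_integral hθ hG1]
  rw [partialDeriv_congr (e1 i) i hθ, partialDeriv_integral hθ (hD _), hψ θ hθ]
  simp only [e1 _ θ hθ]
  have hz : F.integral q (fun x => ∑ r, covDeriv q (Sum.inr r) (Q i r) x) θ = 0 := by
    rw [integral_finsetSum _ hθ fun r =>
      (contDiffOn_covDeriv (k := 0) (by simp) q _ (hQ i r)).continuousOn]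
    exact Finset.sum_eq_zero fun r _ => integral_covDeriv_screening hθ (hQ i r) r
  -- The coefficients of the operator involve the points only, so they are constants for the
  -- integration over the contours.
  set c : Fin n → ℂ := fun j => ((Real.cot ((θ j - θ i) / 2) : ℝ) : ℂ) with hc
  set d : ℂ := ∑ j ∈ Finset.univ.erase i,
    ((1 / (4 * Real.sin ((θ j - θ i) / 2) ^ 2) : ℝ) : ℂ) with hd
  have hcongr : F.integral q (fun x => ∑ r, covDeriv q (Sum.inr r) (Q i r) x) θ
      = F.integral q (fun x => ((κ / 2 : ℝ) : ℂ) * covDeriv q (Sum.inl i) (covDeriv q (Sum.inl i) G) x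
        + ∑ j ∈ Finset.univ.erase i, c j * covDeriv q (Sum.inl j) G x
        + (((1 - 6 / κ : ℝ) : ℂ) * d - h) * G x) θ := by
    refine integral_congr fun t ht => ?_
    rw [← hN i _ (F.pos_mem hθ ht)]
    have e2 : ∀ j, F.pos θ t (Sum.inl j) = (θ j : ℂ) := fun j => rfl
    simp only [hc, hd, e2]
    push_cast
    ring
  have c1 : ContinuousOn (fun x => ((κ / 2 : ℝ) : ℂ)
      * covDeriv q (Sum.inl i) (covDeriv q (Sum.inl i) G) x) (configSpace n m) :=
    continuousOn_const.mul (hDD _)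
  have c2 : ∀ j, ContinuousOn (fun x => c j * covDeriv q (Sum.inl j) G x) (configSpace n m) :=
    fun j => continuousOn_const.mul (hD _).continuousOn
  have c3 : ContinuousOn (fun x => ∑ j ∈ Finset.univ.erase i, c j * covDeriv q (Sum.inl j) G x)
    (configSpace n m) := continuousOn_finsetSum _ fun j _ => c2 j
  have c4 : ContinuousOn (fun x => (((1 - 6 / κ : ℝ) : ℂ) * d - h) * G x) (configSpace n m) :=
    continuousOn_const.mul hG1.continuousOn
  have c5 : ContinuousOn (fun x => ((κ / 2 : ℝ) : ℂ)
      * covDeriv q (Sum.inl i) (covDeriv q (Sum.inl i) G) x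
      + ∑ j ∈ Finset.univ.erase i, c j * covDeriv q (Sum.inl j) G x) (configSpace n m) := c1.add c3
  rw [hcongr, integral_add hθ c5 c4, integral_add hθ c1 c3,
    integral_finsetSum _ hθ c2, integral_const_mul, integral_const_mul] at hz
  simp only [integral_const_mul] at hz
  rw [← hz]
  ring

theorem add_const_mem_chamber (hθ : θ ∈ chamber n) (t : ℝ) : (fun i => θ i + t) ∈ chamber n :=
  ⟨fun i j hij => by simpa using hθ.1 hij, fun i j => by
    have := hθ.2 i j
    simp only
    linarith⟩

/-- If the infinitesimal rotation acts on the integrand by `ω` up to a total derivative, then the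
integral solves the rotation equation. -/
theorem solvesRotation_of_total_derivative {ω : ℝ} {ψ : (Fin n → ℝ) → ℂ}
    (hψ : ∀ θ ∈ chamber n, ψ θ = F.integral q G θ) (hG : ContDiffOn ℂ 1 G (configSpace n m))
    (hN : ∀ x ∈ configSpace n m, ∑ l, covDeriv q l G x = ω * G x) : SolvesRotation ω ψ := by
  have hD : ∀ l, ContinuousOn (covDeriv q l G) (configSpace n m) := fun l =>
    (contDiffOn_covDeriv (k := 0) (by simp) q l hG).continuousOn
  have hsum : ∀ θ ∈ chamber n, ∑ j, F.integral q (covDeriv q (Sum.inl j) G) θ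
      = ω * F.integral q G θ := by
    -- The covariant derivatives in the screening variables may be added, because their integrals
    -- vanish; the sum over all charges is what the hypothesis evaluates.
    intro θ hθ
    rw [← integral_const_mul, ← integral_congr (H := fun x => ∑ l, covDeriv q l G x)
      fun t ht => hN _ (F.pos_mem hθ ht), integral_finsetSum _ hθ hD, Fintype.sum_sum_type,
      Finset.sum_eq_zero (s := Finset.univ (α := Fin m))
        fun r _ => integral_covDeriv_screening hθ hG r, add_zero]
  intro θ hθ t
  -- The function e^{-ωs} ψ(θ + s) has derivative zero, hence is constant in s.
  have hder : ∀ s : ℝ, HasDerivAt (fun s : ℝ => Complex.exp ((-(ω * s) : ℝ) : ℂ) *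
      F.integral q G (fun i => θ i + s)) 0 s := by
    intro s
    have hs := add_const_mem_chamber hθ s
    have h1 : HasDerivAt (fun s : ℝ => fun i => θ i + s) (fun _ => 1) s :=
      hasDerivAt_pi.2 fun i => (hasDerivAt_id s).const_add (θ i)
    have h2 := (hasFDerivAt_integral (F := F) (q := q) hs hG).comp_hasDerivAt s h1
    have h3 : HasDerivAt (fun s : ℝ => -(ω * s)) (-ω) s := by
      simpa using ((hasDerivAt_id' s).const_mul ω).fun_neg
    refine (h3.ofReal_comp.cexp.mul h2).congr_deriv ?_
    have := hsum _ hs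
    simp only [ContinuousLinearMap.smulRight_apply, ContinuousLinearMap.proj_apply, one_smul,
      sum_apply, this, Function.comp_apply]
    push_cast
    ring
  have hconst := is_const_of_deriv_eq_zero (fun s => (hder s).differentiableAt)
    (fun s => (hder s).deriv) t 0
  simp only [mul_zero, add_zero, neg_zero, Complex.ofReal_zero, Complex.exp_zero, one_mul] at hconst
  rw [hψ _ (add_const_mem_chamber hθ t), hψ θ hθ, ← hconst, ← mul_assoc, Complex.ofReal_exp,
    ← Complex.exp_add]
  simp

end LiftedFamily

end RadialCoulomb
end

noncomputable section

namespace RadialCoulomb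

open Set

/-! ### The null vector identity -/

theorem cot_neg_half (z w : ℂ) : Complex.cot ((z - w) / 2) = -Complex.cot ((w - z) / 2) := by
  rw [← neg_sub, neg_div]
  simp [Complex.cot_eq_cos_div_sin, div_neg]

/-- Division by zero gives 0, the value that fits an odd function. So sums of cotangents over all
pairs contain their diagonal at no cost, and self-interactions need not be excluded. -/
theorem cot_zero' : Complex.cot 0 = 0 := by simp [Complex.cot_eq_cos_div_sin]

/-- The subtraction formula of the cotangent for (x-y)/2 = (x-z)/2 - (y-z)/2. It is the
trigonometric relation that makes the three-body terms separate. -/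
theorem cot_sub_mul_cot {x y z : ℂ} (hxz : Complex.sin ((x - z) / 2) ≠ 0)
    (hyz : Complex.sin ((y - z) / 2) ≠ 0) (hxy : Complex.sin ((x - y) / 2) ≠ 0) :
    (Complex.cot ((x - z) / 2) - Complex.cot ((y - z) / 2)) * Complex.cot ((x - y) / 2)
      = -(Complex.cot ((x - z) / 2) * Complex.cot ((y - z) / 2) + 1) := by
  have e : (x - y) / 2 = (x - z) / 2 - (y - z) / 2 := by ring
  rw [e] at hxy ⊢
  simp only [Complex.cot_eq_cos_div_sin]
  rw [Complex.sin_sub] at hxy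
  rw [Complex.sin_sub, Complex.cos_sub]
  field_simp
  ring

theorem one_add_cot_sq {z : ℂ} (h : Complex.sin z ≠ 0) :
    1 + Complex.cot z ^ 2 = 1 / Complex.sin z ^ 2 := by
  rw [Complex.cot_eq_cos_div_sin]
  field_simp
  exact Complex.sin_sq_add_cos_sq z

theorem hasDerivAt_cot {z : ℂ} (h : Complex.sin z ≠ 0) :
    HasDerivAt Complex.cot (-(1 + Complex.cot z ^ 2)) z := by
  have h1 := (Complex.hasDerivAt_cos z).div (Complex.hasDerivAt_sin z) h
  have h2 : Complex.cot = fun z => Complex.cos z / Complex.sin z := by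
    ext z; exact Complex.cot_eq_cos_div_sin z
  rw [h2]
  refine h1.congr_deriv ?_
  field_simp
  ring

section identity

variable {Λ : Type*} [Fintype Λ] [DecidableEq Λ] {X : Λ → ℂ} (q : Λ → ℂ)

/-- With y_l = cot((x_l - x_i)/2), oddness of cot((x_l - x_k)/2) replaces y_l by (y_l - y_k)/2, and
the subtraction formula turns each summand into -(y_l y_k + 1). The double sum becomes squares of
single sums, up to the exceptional index pairs. -/
theorem sum_cot_mul_drift (hX : ∀ l k, l ≠ k → Complex.sin ((X l - X k) / 2) ≠ 0) (i : Λ) :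
    ∑ l, Complex.cot ((X l - X i) / 2) * ∑ k, q l * q k / 2 * Complex.cot ((X l - X k) / 2)
      = 1 / 4 * (-(∑ l, q l * Complex.cot ((X l - X i) / 2)) ^ 2 - (∑ l, q l) ^ 2
        + ∑ l, q l ^ 2 * (1 + Complex.cot ((X l - X i) / 2) ^ 2)
        + 2 * q i * ∑ l, q l * (1 + Complex.cot ((X l - X i) / 2) ^ 2) - 2 * q i ^ 2) := by
  set y : Λ → ℂ := fun l => Complex.cot ((X l - X i) / 2) with hy
  set c : Λ → Λ → ℂ := fun l k => Complex.cot ((X l - X k) / 2) with hc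
  have hyi : y i = 0 := by simp [hy, cot_zero']
  have hanti : ∀ l k, c l k = -c k l := fun l k => cot_neg_half _ _
  -- The subtraction formula fails for l = k, l = i and k = i, where a sine vanishes. The default
  -- value y_i = 0 determines the correction in each case, and the last term removes the overcount
  -- at l = k = i.
  have key : ∀ l k, (y l - y k) * c l k = -(y l * y k + 1) + (if l = k then 1 + y l ^ 2 else 0)
      + (if l = i then 1 + y k ^ 2 else 0) + (if k = i then 1 + y l ^ 2 else 0)
      - if l = i then (if k = i then 2 else 0) else 0 := by
    intro l k
    by_cases hlk : l = k
    · subst hlk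
      by_cases hli : l = i
      · subst hli; simp [hyi]; norm_num
      · simp [hli]; ring
    · by_cases hli : l = i
      · subst hli
        have hkl : k ≠ l := fun h => hlk h.symm
        have : c l k = -y k := cot_neg_half _ _
        simp [hlk, hkl, hyi, this]; ring
      · by_cases hki : k = i
        · subst hki
          have : c l k = y l := rfl
          simp [hlk, hyi, this]; ring
        · simp only [hlk, hli, hki, if_false, add_zero, sub_zero]
          exact cot_sub_mul_cot (hX l i hli) (hX k i hki) (hX l k hlk)
  have h1 : ∑ l, ∑ k, q l * q k * (y l * c l k)
      = 1 / 2 * ∑ l, ∑ k, q l * q k * ((y l - y k) * c l k) := by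
    have h2 : ∑ l, ∑ k, q l * q k * (y k * c l k) = -∑ l, ∑ k, q l * q k * (y l * c l k) := by
      rw [Finset.sum_comm, ← Finset.sum_neg_distrib]
      refine Finset.sum_congr rfl fun l _ => ?_
      rw [← Finset.sum_neg_distrib]
      refine Finset.sum_congr rfl fun k _ => ?_
      rw [hanti k l]; ring
    have h3 : ∑ l, ∑ k, q l * q k * ((y l - y k) * c l k)
        = ∑ l, ∑ k, q l * q k * (y l * c l k) - ∑ l, ∑ k, q l * q k * (y k * c l k) := by
      simp only [← Finset.sum_sub_distrib]
      exact Finset.sum_congr rfl fun l _ => Finset.sum_congr rfl fun k _ => by ring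
    rw [h3, h2]; ring
  have h4 : ∑ l, y l * ∑ k, q l * q k / 2 * c l k = 1 / 2 * ∑ l, ∑ k, q l * q k * (y l * c l k) := by
    rw [Finset.mul_sum]
    refine Finset.sum_congr rfl fun l _ => ?_
    rw [Finset.mul_sum, Finset.mul_sum]
    exact Finset.sum_congr rfl fun k _ => by ring
  rw [h4, h1]
  have h5 : ∑ l, ∑ k, q l * q k * ((y l - y k) * c l k)
      = -(∑ l, q l * y l) ^ 2 - (∑ l, q l) ^ 2 + ∑ l, q l ^ 2 * (1 + y l ^ 2)
        + 2 * q i * ∑ l, q l * (1 + y l ^ 2) - 2 * q i ^ 2 := by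
    have e : ∀ l, ∑ k, q l * q k * ((y l - y k) * c l k)
        = -(q l * y l) * ∑ k, q k * y k - q l * ∑ k, q k + q l ^ 2 * (1 + y l ^ 2)
          + (if l = i then q i * ∑ k, q k * (1 + y k ^ 2) else 0)
          + q i * (q l * (1 + y l ^ 2)) - if l = i then 2 * q i ^ 2 else 0 := by
      intro l
      have e0 : ∀ k, q l * q k * ((y l - y k) * c l k) = -(q l * y l) * (q k * y k) - q l * q k
          + (if l = k then q l ^ 2 * (1 + y l ^ 2) else 0)
          + (if l = i then q i * (q k * (1 + y k ^ 2)) else 0)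
          + (if k = i then q i * (q l * (1 + y l ^ 2)) else 0)
          - if k = i then (if l = i then 2 * q i ^ 2 else 0) else 0 := by
        intro k
        rw [key]
        split_ifs with h1 h2 h3 h3 h2 h3 h3 <;> subst_vars <;> ring
      have e1 : ∑ k, (if l = i then q i * (q k * (1 + y k ^ 2)) else 0)
          = if l = i then q i * ∑ k, q k * (1 + y k ^ 2) else 0 := by
        split_ifs
        · rw [Finset.mul_sum]
        · simp
      simp only [e0, Finset.sum_add_distrib, Finset.sum_sub_distrib, ← Finset.mul_sum, e1,
        Finset.sum_ite_eq, Finset.sum_ite_eq', Finset.mem_univ, if_true]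
    simp only [e, Finset.sum_add_distrib, Finset.sum_sub_distrib, ← Finset.sum_mul,
      ← Finset.mul_sum, Finset.sum_ite_eq', Finset.mem_univ, if_true, Finset.sum_neg_distrib]
    ring
  rw [h5]
  ring

/-- The level two null vector identity for Coulomb gas charges. -/
theorem null_vector_identity (hX : ∀ l k, l ≠ k → Complex.sin ((X l - X k) / 2) ≠ 0) (i : Λ)
    (κ b μ : ℂ) (U : Λ → ℂ)
    (hU : ∀ l, U l = ∑ k, q l * q k / 2 * Complex.cot ((X l - X k) / 2) + μ * q l) :
    κ / 2 * (-(1 / 4) * q i * (∑ k, q k * (1 + Complex.cot ((X k - X i) / 2) ^ 2) - q i) + U i ^ 2)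
      + ∑ l, Complex.cot ((X l - X i) / 2) * U l
      - 1 / 2 * (∑ l, (q l ^ 2 / 2 - b * q l) * (1 + Complex.cot ((X l - X i) / 2) ^ 2)
        - (q i ^ 2 / 2 - b * q i))
    = (κ * q i ^ 2 / 8 - 1 / 4) * (∑ l, q l * Complex.cot ((X l - X i) / 2)) ^ 2
      + (-(κ * q i) / 8 + q i / 2 + b / 2) * ∑ l, q l * Complex.cot ((X l - X i) / 2) ^ 2
      + μ * (1 - κ * q i ^ 2 / 2) * ∑ l, q l * Complex.cot ((X l - X i) / 2)
      + (κ / 2 * μ ^ 2 * q i ^ 2 - κ * q i * (∑ l, q l - q i) / 8 - (∑ l, q l) ^ 2 / 4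
        + q i * (∑ l, q l) / 2 - q i ^ 2 / 4 + b * (∑ l, q l) / 2 - b * q i / 2) := by
  have hUi : U i = -(q i / 2) * ∑ l, q l * Complex.cot ((X l - X i) / 2) + μ * q i := by
    rw [hU, Finset.mul_sum]
    congr 1
    refine Finset.sum_congr rfl fun k _ => ?_
    rw [cot_neg_half]; ring
  have h1 : ∑ l, Complex.cot ((X l - X i) / 2) * U l
      = ∑ l, Complex.cot ((X l - X i) / 2)
          * ∑ k, q l * q k / 2 * Complex.cot ((X l - X k) / 2)
        + μ * ∑ l, q l * Complex.cot ((X l - X i) / 2) := by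
    rw [Finset.mul_sum, ← Finset.sum_add_distrib]
    refine Finset.sum_congr rfl fun l _ => ?_
    rw [hU]; ring
  rw [h1, sum_cot_mul_drift q hX, hUi]
  -- The quadratic part q_l²/2 of the weights cancels the sum of q_l²(1 + y_l²) that came from the
  -- cotangents times the drifts; only sums linear in the charges remain.
  have h2 : ∑ l, (q l ^ 2 / 2 - b * q l) * (1 + Complex.cot ((X l - X i) / 2) ^ 2)
      = 1 / 2 * ∑ l, q l ^ 2 * (1 + Complex.cot ((X l - X i) / 2) ^ 2)
        - b * ∑ l, q l * (1 + Complex.cot ((X l - X i) / 2) ^ 2) := by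
    rw [Finset.mul_sum, Finset.mul_sum, ← Finset.sum_sub_distrib]
    exact Finset.sum_congr rfl fun l _ => by ring
  have h3 : ∑ l, q l * (1 + Complex.cot ((X l - X i) / 2) ^ 2)
      = ∑ l, q l + ∑ l, q l * Complex.cot ((X l - X i) / 2) ^ 2 := by
    rw [← Finset.sum_add_distrib]
    exact Finset.sum_congr rfl fun l _ => by ring
  rw [h2, h3]
  ring

end identity

/-- The Coulomb gas correlation is invariant under a common translation of all charges;
algebraically, the cotangent is odd. -/
theorem sum_drift_eq_zero {Λ : Type*} [Fintype Λ] (q X : Λ → ℂ) :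
    ∑ l, ∑ k, q l * q k / 2 * Complex.cot ((X l - X k) / 2) = 0 := by
  have h : ∑ l, ∑ k, q l * q k / 2 * Complex.cot ((X l - X k) / 2)
      = -∑ l, ∑ k, q l * q k / 2 * Complex.cot ((X l - X k) / 2) := by
    conv_lhs => rw [Finset.sum_comm]
    rw [← Finset.sum_neg_distrib]
    refine Finset.sum_congr rfl fun l _ => ?_
    rw [← Finset.sum_neg_distrib]
    refine Finset.sum_congr rfl fun k _ => ?_
    rw [cot_neg_half]; ring
  linear_combination h / 2

/-! ### Partial derivatives -/

section partials

variable {n m : ℕ} {q : Fin n ⊕ Fin m → ℝ} {x : Fin n ⊕ Fin m → ℂ}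

theorem hasFDerivAt_cot_sub (hx : x ∈ configSpace n m) (l k : Fin n ⊕ Fin m) :
    HasFDerivAt (fun x : Fin n ⊕ Fin m → ℂ => Complex.cot ((x l - x k) / 2))
      ((-(1 + Complex.cot ((x l - x k) / 2) ^ 2) / 2) •
        (ContinuousLinearMap.proj (R := ℂ) (φ := fun _ : Fin n ⊕ Fin m => ℂ) l
          - ContinuousLinearMap.proj (R := ℂ) (φ := fun _ : Fin n ⊕ Fin m => ℂ) k)) x := by
  rcases eq_or_ne l k with rfl | h
  · simpa using hasFDerivAt_const (Complex.cot 0) x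
  · have h1 : HasFDerivAt (fun x : Fin n ⊕ Fin m → ℂ => x l - x k)
        (ContinuousLinearMap.proj (R := ℂ) (φ := fun _ : Fin n ⊕ Fin m => ℂ) l
          - ContinuousLinearMap.proj (R := ℂ) (φ := fun _ : Fin n ⊕ Fin m => ℂ) k) x :=
      (hasFDerivAt_apply l x).sub (hasFDerivAt_apply k x)
    have h2 : HasDerivAt (fun z : ℂ => Complex.cot (z / 2))
        (-(1 + Complex.cot ((x l - x k) / 2) ^ 2) / 2) (x l - x k) := by
      have := (hasDerivAt_cot (hx.1 l k h)).comp (x l - x k)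
        ((hasDerivAt_id' (x l - x k)).div_const (2 : ℂ))
      refine this.congr_deriv ?_
      ring
    exact h2.comp_hasFDerivAt x h1

theorem fderiv_cot_sub (hx : x ∈ configSpace n m) (l k : Fin n ⊕ Fin m) (v : Fin n ⊕ Fin m → ℂ) :
    fderiv ℂ (fun x : Fin n ⊕ Fin m → ℂ => Complex.cot ((x l - x k) / 2)) x v
      = -(1 + Complex.cot ((x l - x k) / 2) ^ 2) / 2 * (v l - v k) := by
  rw [(hasFDerivAt_cot_sub hx l k).fderiv]
  simp

/-- The summand k = i on the right is q_i, since 1 + cot(0)² = 1 by the default value, whereas the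
self-interaction has derivative zero; hence the subtracted q_i. -/
theorem fderiv_drift_self (hx : x ∈ configSpace n m) (i : Fin n ⊕ Fin m) :
    fderiv ℂ (fun x => drift q x i) x (Pi.single i 1)
      = -(1 / 4) * q i * (∑ k, q k * (1 + Complex.cot ((x k - x i) / 2) ^ 2) - q i) := by
  unfold drift
  have h := HasFDerivAt.fun_sum (u := Finset.univ) fun k _ =>
    (hasFDerivAt_cot_sub hx i k).const_mul ((q i * q k / 2 : ℝ) : ℂ)
  rw [h.fderiv]
  have e : ∀ k, (1 + Complex.cot ((x i - x k) / 2) ^ 2) * ((Pi.single i 1 : Fin n ⊕ Fin m → ℂ) i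
      - (Pi.single i 1 : Fin n ⊕ Fin m → ℂ) k)
      = (1 + Complex.cot ((x k - x i) / 2) ^ 2) - if k = i then 1 else 0 := by
    intro k
    rcases eq_or_ne k i with rfl | hk
    · simp [cot_zero']
    · rw [cot_neg_half]; simp [hk]
  simp only [sum_apply, _root_.smul_apply, _root_.sub_apply,
    ContinuousLinearMap.proj_apply, smul_eq_mul]
  have e2 : ∀ k, ((q i * q k / 2 : ℝ) : ℂ) * (-(1 + Complex.cot ((x i - x k) / 2) ^ 2) / 2
      * ((Pi.single i 1 : Fin n ⊕ Fin m → ℂ) i - (Pi.single i 1 : Fin n ⊕ Fin m → ℂ) k))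
      = -(1 / 4) * q i * (q k * (1 + Complex.cot ((x k - x i) / 2) ^ 2)
        - if k = i then (q k : ℂ) else 0) := by
    intro k
    push_cast
    have := e k
    split_ifs at this ⊢ <;> linear_combination (-(q i * q k / 4 : ℂ)) * this
  simp only [e2]
  rw [← Finset.mul_sum, Finset.sum_sub_distrib, Finset.sum_ite_eq' Finset.univ i]
  simp

theorem covDeriv_mul {f G : (Fin n ⊕ Fin m → ℂ) → ℂ} (hf : DifferentiableAt ℂ f x)
    (hG : DifferentiableAt ℂ G x) (l : Fin n ⊕ Fin m) :
    covDeriv q l (fun x => f x * G x) x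
      = fderiv ℂ f x (Pi.single l 1) * G x + f x * covDeriv q l G x := by
  unfold covDeriv
  rw [fderiv_fun_mul hf hG]
  simp
  ring

theorem covDeriv_congr {f G : (Fin n ⊕ Fin m → ℂ) → ℂ} (h : ∀ x ∈ configSpace n m, f x = G x)
    (hx : x ∈ configSpace n m) (l : Fin n ⊕ Fin m) : covDeriv q l f x = covDeriv q l G x := by
  have : f =ᶠ[nhds x] G :=
    Filter.eventually_of_mem ((isOpen_configSpace n m).mem_nhds hx) h
  unfold covDeriv
  rw [this.fderiv_eq, h x hx]

end partials

end RadialCoulomb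
end

noncomputable section

namespace RadialCoulomb

open Set

/-! ### Integrands with an extra charge -/

section extra

variable {n m : ℕ} {q : Fin n ⊕ Fin m → ℝ} {x : Fin n ⊕ Fin m → ℂ}
  {G : (Fin n ⊕ Fin m → ℂ) → ℂ} {w : ℂ} {p μ : ℝ}

/-- The configuration with an additional particle at `w`. -/
def extend {ι : Type*} (x : ι → ℂ) (w : ℂ) (o : Option ι) : ℂ := o.elim w x

/-- The logarithmic derivatives in the presence of an additional particle at `w` with charge `p`
and of an exponential factor. -/
def extendDrift {ι : Type*} [Fintype ι] (q : ι → ℝ) (p μ : ℝ) (x : ι → ℂ) (w : ℂ)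
    (o : Option ι) : ℂ :=
  ∑ k, extend (fun l => (q l : ℂ)) p o * extend (fun l => (q l : ℂ)) p k / 2
    * Complex.cot ((extend x w o - extend x w k) / 2) + μ * extend (fun l => (q l : ℂ)) p o

/-- `G` is, up to a constant, the product of the interactions with a charge `p` at `w` and of
`∏ e^{μ q l x l}`. -/
def HasExtraCharge (q : Fin n ⊕ Fin m → ℝ) (p μ : ℝ) (w : ℂ) (G : (Fin n ⊕ Fin m → ℂ) → ℂ) : Prop :=
  ∀ x ∈ configSpace n m, DifferentiableAt ℂ G x ∧ ∀ l, fderiv ℂ G x (Pi.single l 1)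
    = (μ * q l + q l * p / 2 * Complex.cot ((x l - w) / 2)) * G x

/-- The zeros of the sine are real, and w lies at height at least π while all other charges lie
strictly below. -/
theorem sin_extend_ne_zero (hx : x ∈ configSpace n m) (hw : Real.pi ≤ w.im)
    (o k : Option (Fin n ⊕ Fin m)) (h : o ≠ k) :
    Complex.sin ((extend x w o - extend x w k) / 2) ≠ 0 := by
  have him : ∀ l, Complex.sin ((x l - w) / 2) ≠ 0 := by
    intro l h0
    obtain ⟨k, hk⟩ := Complex.sin_eq_zero_iff.1 h0
    have h1 := congrArg Complex.im hk
    have h2 : ((x l - w) / 2).im = ((x l).im - w.im) / 2 := by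
      rw [Complex.div_ofNat_im, Complex.sub_im]
    rw [h2] at h1
    have h3 : ((k : ℂ) * (Real.pi : ℂ)).im = 0 := by simp
    rw [h3] at h1
    linarith [hx.2 l]
  rcases o with _ | l <;> rcases k with _ | k
  · exact absurd rfl h
  · simp only [extend, Option.elim]
    rw [← neg_sub, neg_div, Complex.sin_neg]
    exact neg_ne_zero.2 (him k)
  · exact him l
  · exact hx.1 l k fun e => h (congrArg some e)

theorem extendDrift_some (l : Fin n ⊕ Fin m) : extendDrift q p μ x w (some l)
    = drift q x l + (μ * q l + q l * p / 2 * Complex.cot ((x l - w) / 2)) := by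
  unfold extendDrift drift
  rw [Fintype.sum_option]
  simp only [extend, Option.elim]
  push_cast
  ring

theorem HasExtraCharge.covDeriv (h : HasExtraCharge q p μ w G) (hx : x ∈ configSpace n m)
    (l : Fin n ⊕ Fin m) :
    covDeriv q l G x = extendDrift q p μ x w (some l) * G x := by
  rw [extendDrift_some, RadialCoulomb.covDeriv, (h x hx).2 l]
  ring

theorem hasDerivAt_cot_half {z : ℂ} (h : Complex.sin (z / 2) ≠ 0) :
    HasDerivAt (fun z : ℂ => Complex.cot (z / 2)) (-(1 + Complex.cot (z / 2) ^ 2) / 2) z := by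
  have := (hasDerivAt_cot h).comp z ((hasDerivAt_id' z).div_const (2 : ℂ))
  refine this.congr_deriv ?_
  ring

/-- The first covariant derivative multiplies G by U_i = `extendDrift` at i, so the second
multiplies it by ∂_i U_i + U_i². -/
theorem HasExtraCharge.covDeriv_covDeriv (h : HasExtraCharge q p μ w G)
    (hw : Real.pi ≤ w.im) (hx : x ∈ configSpace n m) (i : Fin n ⊕ Fin m) :
    RadialCoulomb.covDeriv q i (RadialCoulomb.covDeriv q i G) x
      = (-(1 / 4) * q i * (∑ k, extend (fun l => (q l : ℂ)) p k
          * (1 + Complex.cot ((extend x w k - extend x w (some i)) / 2) ^ 2) - q i)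
        + extendDrift q p μ x w (some i) ^ 2) * G x := by
  have hw' : Complex.sin ((x i - w) / 2) ≠ 0 := sin_extend_ne_zero hx hw (some i) none (by simp)
  have hsub : HasFDerivAt (fun x : Fin n ⊕ Fin m → ℂ => x i - w)
      (ContinuousLinearMap.proj (R := ℂ) (φ := fun _ : Fin n ⊕ Fin m => ℂ) i) x :=
    (ContinuousLinearMap.proj (R := ℂ) (φ := fun _ : Fin n ⊕ Fin m => ℂ) i).hasFDerivAt.sub_const w
  have hc : HasDerivAt (fun z : ℂ => Complex.cot (z / 2))
      (-(1 + Complex.cot ((x i - w) / 2) ^ 2) / 2) (x i - w) := hasDerivAt_cot_half hw'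
  have hcw : HasFDerivAt (fun x : Fin n ⊕ Fin m → ℂ => Complex.cot ((x i - w) / 2))
      ((-(1 + Complex.cot ((x i - w) / 2) ^ 2) / 2) •
        ContinuousLinearMap.proj (R := ℂ) (φ := fun _ : Fin n ⊕ Fin m => ℂ) i) x :=
    HasDerivAt.comp_hasFDerivAt (h₂ := fun z : ℂ => Complex.cot (z / 2)) x hc hsub
  have hdr : DifferentiableAt ℂ (fun x => drift q x i) x :=
    ((contDiffOn_drift 1 q i).differentiableOn one_ne_zero).differentiableAt
      ((isOpen_configSpace n m).mem_nhds hx)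
  have hex : HasFDerivAt (fun x : Fin n ⊕ Fin m → ℂ =>
      (μ * q i + q i * p / 2 * Complex.cot ((x i - w) / 2) : ℂ)) _ x :=
    (hcw.const_mul (q i * p / 2 : ℂ)).const_add (μ * q i : ℂ)
  have hU : DifferentiableAt ℂ (fun x => extendDrift q p μ x w (some i)) x := by
    simp only [extendDrift_some]
    exact hdr.add hex.differentiableAt
  rw [covDeriv_congr (fun y hy => h.covDeriv hy i) hx i, covDeriv_mul hU (h x hx).1, h.covDeriv hx]
  have e : fderiv ℂ (fun x => extendDrift q p μ x w (some i)) x (Pi.single i 1)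
      = -(1 / 4) * q i * (∑ k, extend (fun l => (q l : ℂ)) p k
          * (1 + Complex.cot ((extend x w k - extend x w (some i)) / 2) ^ 2) - q i) := by
    simp only [extendDrift_some]
    rw [fderiv_fun_add hdr hex.differentiableAt, hex.fderiv, _root_.add_apply,
      fderiv_drift_self hx, Fintype.sum_option]
    simp only [extend, Option.elim, _root_.smul_apply, ContinuousLinearMap.proj_apply, smul_eq_mul,
      Pi.single_eq_same]
    rw [cot_neg_half w]
    ring
  rw [e]
  ring

/-- These are the total derivatives that absorb the screening terms of `null_vector_identity`: the
coefficient 1/2 of 1 + cot² matches a charge of weight 1. -/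
theorem HasExtraCharge.covDeriv_cot_mul (h : HasExtraCharge q p μ w G)
    (hx : x ∈ configSpace n m) {i l : Fin n ⊕ Fin m} (hil : i ≠ l) :
    RadialCoulomb.covDeriv q l (fun x => Complex.cot ((x i - x l) / 2) * G x) x
      = (1 / 2 * (1 + Complex.cot ((x l - x i) / 2) ^ 2)
        - Complex.cot ((x l - x i) / 2) * extendDrift q p μ x w (some l)) * G x := by
  rw [covDeriv_mul (hasFDerivAt_cot_sub hx i l).differentiableAt (h x hx).1, h.covDeriv hx,
    fderiv_cot_sub hx, cot_neg_half (x i)]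
  simp [hil]
  ring

/-- The null vector operator applied to an integrand with an additional charge. -/
theorem HasExtraCharge.null_vector (h : HasExtraCharge q p μ w G)
    (hw : Real.pi ≤ w.im) (hx : x ∈ configSpace n m) (i : Fin n) {κ b : ℝ} (hκ : κ ≠ 0)
    (hq : ∀ j, q (Sum.inl j) ^ 2 / 2 - b * q (Sum.inl j) = (6 - κ) / (2 * κ))
    (hq' : ∀ r, q (Sum.inr r) ^ 2 / 2 - b * q (Sum.inr r) = 1) :
    (κ / 2 : ℝ) * RadialCoulomb.covDeriv q (Sum.inl i) (RadialCoulomb.covDeriv q (Sum.inl i) G) x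
        + ∑ j ∈ Finset.univ.erase i,
          Complex.cot ((x (Sum.inl j) - x (Sum.inl i)) / 2) * RadialCoulomb.covDeriv q (Sum.inl j) G x
        + ((1 - 6 / κ : ℝ) : ℂ) * (∑ j ∈ Finset.univ.erase i,
          1 / (4 * Complex.sin ((x (Sum.inl j) - x (Sum.inl i)) / 2) ^ 2)) * G x
      = ∑ r, RadialCoulomb.covDeriv q (Sum.inr r)
          (fun x => Complex.cot ((x (Sum.inl i) - x (Sum.inr r)) / 2) * G x) x
        + ((κ * q (Sum.inl i) ^ 2 / 8 - 1 / 4) * (∑ l, extend (fun l => (q l : ℂ)) p l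
            * Complex.cot ((extend x w l - x (Sum.inl i)) / 2)) ^ 2
          + (-(κ * q (Sum.inl i)) / 8 + q (Sum.inl i) / 2 + b / 2)
            * ∑ l, extend (fun l => (q l : ℂ)) p l
              * Complex.cot ((extend x w l - x (Sum.inl i)) / 2) ^ 2
          + μ * (1 - κ * q (Sum.inl i) ^ 2 / 2) * ∑ l, extend (fun l => (q l : ℂ)) p l
              * Complex.cot ((extend x w l - x (Sum.inl i)) / 2)
          + (κ / 2 * μ ^ 2 * q (Sum.inl i) ^ 2
            - κ * q (Sum.inl i) * (p + ∑ l, (q l : ℂ) - q (Sum.inl i)) / 8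
            - (p + ∑ l, (q l : ℂ)) ^ 2 / 4 + q (Sum.inl i) * (p + ∑ l, (q l : ℂ)) / 2
            - q (Sum.inl i) ^ 2 / 4 + b * (p + ∑ l, (q l : ℂ)) / 2 - b * q (Sum.inl i) / 2)
          - (Complex.cot ((w - x (Sum.inl i)) / 2) * extendDrift q p μ x w none
            - 1 / 2 * (p ^ 2 / 2 - b * p)
              * (1 + Complex.cot ((w - x (Sum.inl i)) / 2) ^ 2))) * G x := by
  -- The identity is applied to all charges including the one at w, which sits at the index `none`;
  -- its share of the sums is then split off.
  have key := null_vector_identity (X := extend x w) (extend (fun l => (q l : ℂ)) p)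
    (sin_extend_ne_zero hx hw) (some (Sum.inl i)) κ b μ (extendDrift q p μ x w) (fun _ => rfl)
  have hκ' : (κ : ℂ) ≠ 0 := by exact_mod_cast hκ
  have hqc : ∀ j, (q (Sum.inl j) : ℂ) ^ 2 / 2 - b * q (Sum.inl j) = (6 - κ) / (2 * κ) := fun j => by
    exact_mod_cast hq j
  have hqc' : ∀ r, (q (Sum.inr r) : ℂ) ^ 2 / 2 - b * q (Sum.inr r) = 1 := fun r => by
    exact_mod_cast hq' r
  have hsum : ∑ l, extend (fun l => (q l : ℂ)) p l = p + ∑ l, (q l : ℂ) := by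
    rw [Fintype.sum_option]; rfl
  rw [hsum] at key
  simp only [show extend (fun l => (q l : ℂ)) p (some (Sum.inl i)) = q (Sum.inl i) from rfl,
    show extend x w (some (Sum.inl i)) = x (Sum.inl i) from rfl] at key
  rw [Fintype.sum_option (f := fun l => Complex.cot ((extend x w l - x (Sum.inl i)) / 2)
      * extendDrift q p μ x w l), Fintype.sum_sum_type,
    Fintype.sum_option (f := fun l => (extend (fun l => (q l : ℂ)) p l ^ 2 / 2
      - b * extend (fun l => (q l : ℂ)) p l)
        * (1 + Complex.cot ((extend x w l - x (Sum.inl i)) / 2) ^ 2)), Fintype.sum_sum_type] at key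
  simp only [show extend (fun l => (q l : ℂ)) (p : ℂ) none = p from rfl,
    show extend x w none = w from rfl,
    show ∀ l, extend (fun l => (q l : ℂ)) (p : ℂ) (some l) = q l from fun _ => rfl,
    show ∀ l, extend x w (some l) = x l from fun _ => rfl, hqc, hqc', one_mul] at key
  have e1 : ∑ j, Complex.cot ((x (Sum.inl j) - x (Sum.inl i)) / 2)
      * extendDrift q p μ x w (some (Sum.inl j))
      = ∑ j ∈ Finset.univ.erase i, Complex.cot ((x (Sum.inl j) - x (Sum.inl i)) / 2)
        * extendDrift q p μ x w (some (Sum.inl j)) := by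
    rw [← Finset.add_sum_erase _ _ (Finset.mem_univ i)]
    simp [cot_zero']
  -- Since 1 + cot² = 1/sin², the weights of the points produce the potential of the null vector
  -- equation. The index j = i contributes just its weight, which the identity subtracts again.
  have e2 : ∑ j, (6 - κ : ℂ) / (2 * κ) * (1 + Complex.cot ((x (Sum.inl j) - x (Sum.inl i)) / 2) ^ 2)
      = (6 - κ : ℂ) / (2 * κ) + (6 - κ : ℂ) / (2 * κ) * (4 * ∑ j ∈ Finset.univ.erase i,
        1 / (4 * Complex.sin ((x (Sum.inl j) - x (Sum.inl i)) / 2) ^ 2)) := by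
    rw [← Finset.add_sum_erase _ _ (Finset.mem_univ i), Finset.mul_sum, Finset.mul_sum]
    congr 1
    · simp [cot_zero']
    · refine Finset.sum_congr rfl fun j hj => ?_
      have : Complex.sin ((x (Sum.inl j) - x (Sum.inl i)) / 2) ≠ 0 :=
        hx.1 _ _ (by simpa using Finset.ne_of_mem_erase hj)
      rw [one_add_cot_sq this]
      congr 1
      field_simp
  rw [e1, e2] at key
  rw [h.covDeriv_covDeriv hw hx]
  have e3 : ∀ j, RadialCoulomb.covDeriv q (Sum.inl j) G x
      = extendDrift q p μ x w (some (Sum.inl j)) * G x := fun j => h.covDeriv hx _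
  have e4 : ∀ r, RadialCoulomb.covDeriv q (Sum.inr r)
      (fun x => Complex.cot ((x (Sum.inl i) - x (Sum.inr r)) / 2) * G x) x
      = (1 / 2 * (1 + Complex.cot ((x (Sum.inr r) - x (Sum.inl i)) / 2) ^ 2)
        - Complex.cot ((x (Sum.inr r) - x (Sum.inl i)) / 2)
          * extendDrift q p μ x w (some (Sum.inr r))) * G x := fun r =>
    h.covDeriv_cot_mul hx (by simp)
  simp only [e3, e4, ← mul_assoc]
  rw [← Finset.sum_mul, ← Finset.sum_mul, Finset.sum_sub_distrib, ← Finset.mul_sum]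
  have e5 : ((1 - 6 / κ : ℝ) : ℂ) = -1 / 2 * ((6 - κ) / (2 * κ) * 4) := by
    push_cast; field_simp; ring
  rw [e5]
  push_cast
  simp only [show ∀ k, extend x w k - extend x w (some (Sum.inl i)) = extend x w k - x (Sum.inl i)
    from fun _ => rfl]
  linear_combination G x * key

/-- By translation invariance the logarithmic derivatives over all charges, w included, add up to μ
times the total charge; the share of w is moved to the other side. -/
theorem HasExtraCharge.sum_covDeriv (h : HasExtraCharge q p μ w G) (hx : x ∈ configSpace n m) :
    ∑ l, RadialCoulomb.covDeriv q l G x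
      = (μ * (p + ∑ l, (q l : ℂ)) - extendDrift q p μ x w none) * G x := by
  have h0 := sum_drift_eq_zero (extend (fun l => (q l : ℂ)) p) (extend x w)
  have h1 : ∑ o, extendDrift q p μ x w o = μ * (p + ∑ l, (q l : ℂ)) := by
    unfold extendDrift
    rw [Finset.sum_add_distrib, h0, zero_add, ← Finset.mul_sum, Fintype.sum_option]
    rfl
  rw [Fintype.sum_option] at h1
  simp only [h.covDeriv hx]
  rw [← Finset.sum_mul, ← h1]
  ring

end extra

end RadialCoulomb
end

noncomputable section

namespace RadialCoulomb

open Set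

/-! ### The charges -/

/-- Charge `a` at every point and charge `-2a` at every screening charge. -/
def uniformCharge (n m : ℕ) (κ : ℝ) : Fin n ⊕ Fin m → ℝ :=
  Sum.elim (fun _ => chargeA κ) fun _ => -2 * chargeA κ

theorem kappa_mul_chargeA_sq {κ : ℝ} (hκ : 0 < κ) : κ * chargeA κ ^ 2 = 2 := by
  rw [chargeA, Real.sq_sqrt (by positivity)]
  field_simp

theorem chargeB_eq {κ : ℝ} (hκ : 0 < κ) : chargeB κ = κ / 4 * chargeA κ - chargeA κ := by
  have : Real.sqrt (κ / 8) = κ / 4 * Real.sqrt (2 / κ) := by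
    rw [show κ / 8 = (κ / 4) ^ 2 * (2 / κ) by field_simp; norm_num,
      Real.sqrt_mul (by positivity), Real.sqrt_sq (by positivity)]
  rw [chargeB, chargeA, this]

theorem chargeA_mul_chargeB {κ : ℝ} (hκ : 0 < κ) :
    chargeA κ * chargeB κ = 1 / 2 - chargeA κ ^ 2 := by
  rw [chargeB_eq hκ]
  linear_combination kappa_mul_chargeA_sq hκ / 4

theorem chargeA_sq {κ : ℝ} (hκ : 0 < κ) : chargeA κ ^ 2 = 2 / κ := by
  rw [eq_div_iff hκ.ne']
  linear_combination kappa_mul_chargeA_sq hκ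

theorem weight_point {κ : ℝ} (hκ : 0 < κ) :
    chargeA κ ^ 2 / 2 - chargeB κ * chargeA κ = (6 - κ) / (2 * κ) := by
  have h1 := chargeA_mul_chargeB hκ
  have h2 := chargeA_sq hκ
  have : (6 - κ) / (2 * κ) = 3 / 2 * (2 / κ) - 1 / 2 := by
    field_simp; ring
  rw [this]
  linear_combination 3 / 2 * h2 - h1

/-- Weight 1 is what makes a charge a screening charge: its terms in the null vector operator form a
total derivative. -/
theorem weight_screening {κ : ℝ} (hκ : 0 < κ) :
    (-2 * chargeA κ) ^ 2 / 2 - chargeB κ * (-2 * chargeA κ) = 1 := by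
  linear_combination 2 * chargeA_mul_chargeB hκ

section uniform

variable {n m : ℕ} {x : Fin n ⊕ Fin m → ℂ} {G : (Fin n ⊕ Fin m → ℂ) → ℂ} {w : ℂ} {κ p μ : ℝ}

theorem sum_uniformCharge (κ : ℝ) :
    ∑ l, (uniformCharge n m κ l : ℂ) = chargeA κ * (n - 2 * m) := by
  simp [Fintype.sum_sum_type, uniformCharge]
  ring

/-- The null vector operator on an integrand with the charges of the ground solutions. -/
theorem HasExtraCharge.null_vector_uniform (hκ : 0 < κ)
    (h : HasExtraCharge (uniformCharge n m κ) p μ w G)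
    (hw : Real.pi ≤ w.im) (hx : x ∈ configSpace n m) (i : Fin n) :
    (κ / 2 : ℝ) * RadialCoulomb.covDeriv (uniformCharge n m κ) (Sum.inl i)
          (RadialCoulomb.covDeriv (uniformCharge n m κ) (Sum.inl i) G) x
        + ∑ j ∈ Finset.univ.erase i, Complex.cot ((x (Sum.inl j) - x (Sum.inl i)) / 2)
          * RadialCoulomb.covDeriv (uniformCharge n m κ) (Sum.inl j) G x
        + ((1 - 6 / κ : ℝ) : ℂ) * (∑ j ∈ Finset.univ.erase i,
          1 / (4 * Complex.sin ((x (Sum.inl j) - x (Sum.inl i)) / 2) ^ 2)) * G x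
      = ∑ r, RadialCoulomb.covDeriv (uniformCharge n m κ) (Sum.inr r)
          (fun x => Complex.cot ((x (Sum.inl i) - x (Sum.inr r)) / 2) * G x) x
        + (chargeA κ ^ 2 / 4 - (p + chargeA κ * (n - 2 * m)) ^ 2 / 4 + μ ^ 2
          - (Complex.cot ((w - x (Sum.inl i)) / 2)
              * extendDrift (uniformCharge n m κ) p μ x w none
            - 1 / 2 * (p ^ 2 / 2 - chargeB κ * p)
              * (1 + Complex.cot ((w - x (Sum.inl i)) / 2) ^ 2))) * G x := by
  rw [h.null_vector hw hx i hκ.ne' (fun j => weight_point hκ) (fun r => weight_screening hκ),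
    sum_uniformCharge]
  have h1 : (κ : ℂ) * (chargeA κ : ℂ) ^ 2 = 2 := by exact_mod_cast kappa_mul_chargeA_sq hκ
  have h2 : (chargeB κ : ℂ) = κ / 4 * chargeA κ - chargeA κ := by exact_mod_cast chargeB_eq hκ
  have h3 : uniformCharge n m κ (Sum.inl i) = chargeA κ := rfl
  -- The coefficients of all sums over cotangents vanish for charge a, by κa² = 2 and b = κa/4 - a.
  rw [h3, show (κ * (chargeA κ : ℂ) ^ 2 / 8 - 1 / 4 : ℂ) = 0 by linear_combination h1 / 8,
    show (-(κ * (chargeA κ : ℂ)) / 8 + chargeA κ / 2 + chargeB κ / 2 : ℂ) = 0 by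
      linear_combination h2 / 2,
    show (1 - κ * (chargeA κ : ℂ) ^ 2 / 2 : ℂ) = 0 by linear_combination -h1 / 2]
  linear_combination G x * ((μ ^ 2 / 2 + 1 / 8) * h1
    + (p + chargeA κ * (n - 2 * m) - chargeA κ) / 2 * h2 - h1 / 8)

end uniform

/-! ### Ground solutions, with and without spin -/

/-- The exponential factor `∏ e^{μ q l x l}`. -/
def spinFactor {ι : Type*} [Fintype ι] (q : ι → ℝ) (μ : ℝ) (x : ι → ℂ) : ℂ :=
  Complex.exp (∑ l, (μ * q l : ℂ) * x l)

section spin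

variable {n m : ℕ} {x : Fin n ⊕ Fin m → ℂ} {κ μ : ℝ}

theorem contDiff_spinFactor (k : WithTop ℕ∞) (q : Fin n ⊕ Fin m → ℝ) :
    ContDiff ℂ k (spinFactor q μ) := by
  unfold spinFactor
  fun_prop

theorem hasExtraCharge_spinFactor (q : Fin n ⊕ Fin m → ℝ) (w : ℂ) :
    HasExtraCharge q 0 μ w (spinFactor q μ) := by
  intro x _
  refine ⟨(contDiff_spinFactor 1 q).differentiable one_ne_zero x, fun l => ?_⟩
  have h : HasFDerivAt (fun x : Fin n ⊕ Fin m → ℂ => ∑ l, (μ * q l : ℂ) * x l)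
      (∑ l, (μ * q l : ℂ) • ContinuousLinearMap.proj (R := ℂ) (φ := fun _ : Fin n ⊕ Fin m => ℂ) l)
      x :=
    HasFDerivAt.fun_sum fun l _ => (hasFDerivAt_apply l x).const_mul _
  have h2 : HasFDerivAt (spinFactor q μ) _ x := h.cexp
  rw [h2.fderiv]
  simp [-Fintype.sum_sum_type, Pi.single_apply, spinFactor]
  ring

theorem extendDrift_none_of_uncharged (q : Fin n ⊕ Fin m → ℝ) (w : ℂ) :
    extendDrift q 0 μ x w none = 0 := by
  simp [extendDrift, extend]

theorem LiftedFamily.solvesNullVector_spin (F : LiftedFamily n m) (hκ : 0 < κ) {h : ℝ}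
    (hh : h = chargeA κ ^ 2 * (1 - (n - 2 * m) ^ 2) / 4 + μ ^ 2) {ψ : (Fin n → ℝ) → ℂ}
    (hψ : ∀ θ ∈ chamber n, ψ θ
      = F.integral (uniformCharge n m κ) (spinFactor (uniformCharge n m κ) μ) θ) :
    SolvesNullVector κ h ψ := by
  refine F.solvesNullVector_of_total_derivative hψ (contDiff_spinFactor _ _).contDiffOn
    (fun i r x => Complex.cot ((x (Sum.inl i) - x (Sum.inr r)) / 2)
      * spinFactor (uniformCharge n m κ) μ x)
    (fun i r => (contDiffOn_cot_sub _ _ _).mul (contDiff_spinFactor _ _).contDiffOn)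
    fun i x hx => ?_
  -- There is no extra charge here (p = 0), so any place of height at least π serves; πi is one.
  rw [(hasExtraCharge_spinFactor _ (Real.pi * Complex.I)).null_vector_uniform hκ (by simp) hx i,
    extendDrift_none_of_uncharged, hh]
  push_cast
  ring

theorem LiftedFamily.solvesRotation_spin (F : LiftedFamily n m) {ω : ℝ}
    (hω : ω = μ * (chargeA κ * (n - 2 * m))) {ψ : (Fin n → ℝ) → ℂ}
    (hψ : ∀ θ ∈ chamber n, ψ θ
      = F.integral (uniformCharge n m κ) (spinFactor (uniformCharge n m κ) μ) θ) :
    SolvesRotation ω ψ := by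
  refine F.solvesRotation_of_total_derivative hψ (contDiff_spinFactor _ _).contDiffOn
    fun x hx => ?_
  rw [(hasExtraCharge_spinFactor _ (Real.pi * Complex.I)).sum_covDeriv hx,
    extendDrift_none_of_uncharged, sum_uniformCharge, hω]
  push_cast
  ring

end spin

end RadialCoulomb
end

noncomputable section

namespace RadialCoulomb

open Set

/-! ### Sums of residues at double poles -/

section residues

open Polynomial

/-- Reflection reverses the coefficients. Leading coefficients, which carry the sum of the residues,
become those of 1, X and X². -/
theorem reflect_prod {ι : Type*} (s : Finset ι) (g : ι → ℂ[X]) (d : ι → ℕ)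
    (h : ∀ i ∈ s, (g i).natDegree ≤ d i) :
    (∏ i ∈ s, g i).reflect (∑ i ∈ s, d i) = ∏ i ∈ s, (g i).reflect (d i) := by
  classical
  induction s using Finset.induction_on with
  | empty => simp [reflect_one]
  | insert i s hi ih =>
    have h' : ∀ j ∈ s, (g j).natDegree ≤ d j := fun j hj => h j (Finset.mem_insert_of_mem hj)
    rw [Finset.prod_insert hi, Finset.sum_insert hi, Finset.prod_insert hi,
      reflect_mul _ _ (h i (Finset.mem_insert_self _ _))
        ((natDegree_prod_le _ _).trans (Finset.sum_le_sum h')), ih h']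

theorem reflect_X_sub_C (y : ℂ) : (X - C y).reflect 1 = 1 - C y * X := by
  have h1 : (X : ℂ[X]).reflect 1 = 1 := by simp
  have h2 : (C y).reflect 1 = C y * X := by simp
  rw [reflect_sub, h1, h2]

theorem reflect_X_sub_C_sq (y : ℂ) : ((X - C y) ^ 2).reflect 2 = (1 - C y * X) ^ 2 := by
  rw [pow_two, show (2 : ℕ) = 1 + 1 from rfl, reflect_mul _ _ (natDegree_X_sub_C y).le
    (natDegree_X_sub_C y).le, reflect_X_sub_C, ← pow_two]

theorem coeff_two_mul (f g : ℂ[X]) : (f * g).coeff 2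
    = f.coeff 0 * g.coeff 2 + f.coeff 1 * g.coeff 1 + f.coeff 2 * g.coeff 0 := by
  rw [coeff_mul, show Finset.HasAntidiagonal.antidiagonal 2 = {(0, 2), (1, 1), (2, 0)} from rfl]
  simp [Finset.sum_insert]
  ring

/-- The elementary symmetric functions up to degree two, with the second one written in power sums
by Newton's identity. -/
theorem coeff_prod_one_sub {ι : Type*} (s : Finset ι) (y : ι → ℂ) :
    (∏ j ∈ s, (1 - C (y j) * X)).coeff 0 = 1 ∧
    (∏ j ∈ s, (1 - C (y j) * X)).coeff 1 = -∑ j ∈ s, y j ∧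
    (∏ j ∈ s, (1 - C (y j) * X)).coeff 2
      = ((∑ j ∈ s, y j) ^ 2 - ∑ j ∈ s, y j ^ 2) / 2 := by
  classical
  induction s using Finset.induction_on with
  | empty => simp [coeff_one]
  | insert i s hi ih =>
    obtain ⟨h0, h1, h2⟩ := ih
    have e0 : (1 - C (y i) * X).coeff 0 = 1 := by simp
    have e1 : (1 - C (y i) * X).coeff 1 = -y i := by simp [coeff_one]
    have e2 : (1 - C (y i) * X).coeff 2 = 0 := by simp [coeff_one]
    rw [Finset.prod_insert hi, mul_coeff_zero, mul_coeff_one, coeff_two_mul, Finset.sum_insert hi,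
      Finset.sum_insert hi, h0, h1, h2, e0, e1, e2]
    refine ⟨by ring, by ring, by ring⟩

theorem coeff_sq_one_sub {ι : Type*} (s : Finset ι) (y : ι → ℂ) :
    (∏ j ∈ s, (1 - C (y j) * X) ^ 2).coeff 0 = 1 ∧
    (∏ j ∈ s, (1 - C (y j) * X) ^ 2).coeff 1 = -2 * ∑ j ∈ s, y j ∧
    (∏ j ∈ s, (1 - C (y j) * X) ^ 2).coeff 2
      = 2 * (∑ j ∈ s, y j) ^ 2 - ∑ j ∈ s, y j ^ 2 := by
  obtain ⟨h0, h1, h2⟩ := coeff_prod_one_sub s y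
  rw [Finset.prod_pow, pow_two, mul_coeff_zero, mul_coeff_one, coeff_two_mul, h0, h1, h2]
  refine ⟨by ring, by ring, by ring⟩

theorem logDeriv_prod_sub {ι : Type*} (s : Finset ι) (y : ι → ℂ) {a : ℂ} (h : ∀ j ∈ s, a ≠ y j) :
    logDeriv (fun z => ∏ j ∈ s, (z - y j)) a = ∑ j ∈ s, 1 / (a - y j) := by
  rw [logDeriv_prod (f := fun j z => z - y j) (fun j hj => sub_ne_zero.2 (h j hj)) (by fun_prop)]
  refine Finset.sum_congr rfl fun j _ => ?_
  simp [logDeriv_apply]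

theorem logDeriv_prod_sub_sq {ι : Type*} (s : Finset ι) (y : ι → ℂ) {a : ℂ}
    (h : ∀ j ∈ s, a ≠ y j) :
    logDeriv (fun z => ∏ j ∈ s, (z - y j) ^ 2) a = 2 * ∑ j ∈ s, 1 / (a - y j) := by
  simp only [Finset.prod_pow]
  rw [logDeriv_fun_pow (by fun_prop), logDeriv_prod_sub s y h]
  norm_num

/-- The sum of the residues of `∏ (U - y j) / ∏ (U - a r)²` at its double poles. -/
theorem sum_residues {J ι : Type*} [DecidableEq ι] (s : Finset J) (y : J → ℂ)
    (t : Finset ι) (a : ι → ℂ) (hcard : s.card = 2 * t.card + 1) (ha : Set.InjOn a t)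
    (hy : ∀ r ∈ t, ∀ j ∈ s, a r ≠ y j) :
    ∑ r ∈ t, (∏ j ∈ s, (a r - y j)) / (∏ k ∈ t.erase r, (a r - a k) ^ 2)
        * (∑ j ∈ s, 1 / (a r - y j) - 2 * ∑ k ∈ t.erase r, 1 / (a r - a k))
      = ((∑ j ∈ s, y j - 2 * ∑ r ∈ t, a r) ^ 2 - (∑ j ∈ s, y j ^ 2 - 2 * ∑ r ∈ t, a r ^ 2)) / 2 := by
  set P : ℂ[X] := ∏ j ∈ s, (X - C (y j)) with hP
  -- Partial fractions with respect to the pairwise coprime squares (X - a_r)²: each remainder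
  -- becomes A_r + B_r (X - a_r), and B_r is the residue at a_r.
  obtain ⟨q, ρ, hρ, hdec⟩ := eq_quo_mul_prod_pow_add_sum_rem_mul_prod_pow (s := t) P
    (g := fun r => X - C (a r)) (fun r _ => monic_X_sub_C _)
    (fun i hi j hj hij => isCoprime_X_sub_C_of_isUnit_sub
      (sub_ne_zero.2 fun e => hij (ha hi hj e)).isUnit) (fun _ => 2)
  have hρC : ∀ r ∈ t, ∀ j, ρ r j = C ((ρ r j).coeff 0) := fun r hr j =>
    eq_C_of_degree_le_zero (by
      have := hρ r hr j
      rw [degree_X_sub_C] at this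
      exact Nat.WithBot.lt_one_iff_le_zero.1 this)
  have hdec' : P = q * (∏ r ∈ t, (X - C (a r)) ^ 2) + ∑ r ∈ t, (C ((ρ r 0).coeff 0)
      + C ((ρ r 1).coeff 0) * (X - C (a r))) * ∏ k ∈ t.erase r, (X - C (a k)) ^ 2 := by
    rw [hdec]
    congr 1
    refine Finset.sum_congr rfl fun r hr => ?_
    rw [Fin.sum_univ_two, hρC r hr 0, hρC r hr 1]
    simp
    ring
  generalize hA : (fun r => (ρ r 0).coeff 0) = A at hdec'
  generalize hB : (fun r => (ρ r 1).coeff 0) = B at hdec'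
  have hA' : ∀ r, (ρ r 0).coeff 0 = A r := fun r => congrFun hA r
  have hB' : ∀ r, (ρ r 1).coeff 0 = B r := fun r => congrFun hB r
  simp only [hA', hB'] at hdec'
  -- the residues
  have hres : ∀ r ∈ t, (∏ j ∈ s, (a r - y j)) / (∏ k ∈ t.erase r, (a r - a k) ^ 2)
        * (∑ j ∈ s, 1 / (a r - y j) - 2 * ∑ k ∈ t.erase r, 1 / (a r - a k)) = B r := by
    intro r hr
    -- Modulo (X - a_r)² only the r-th remainder survives; comparing value and derivative at a_r
    -- determines A_r and then B_r.
    obtain ⟨W, hW⟩ : ∃ W, P = (X - C (a r)) ^ 2 * W + (C (A r) + C (B r) * (X - C (a r)))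
        * ∏ k ∈ t.erase r, (X - C (a k)) ^ 2 := by
      rw [hdec', ← Finset.add_sum_erase _ _ hr, ← Finset.mul_prod_erase t _ hr]
      have : (X - C (a r)) ^ 2 ∣ ∑ k ∈ t.erase r, (C (A k) + C (B k) * (X - C (a k)))
          * ∏ l ∈ t.erase k, (X - C (a l)) ^ 2 :=
        Finset.dvd_sum fun k hk => Dvd.dvd.mul_left
          (Finset.dvd_prod_of_mem (fun l => (X - C (a l)) ^ 2)
            (Finset.mem_erase.2 ⟨(Finset.ne_of_mem_erase hk).symm, hr⟩)) _
      obtain ⟨V, hV⟩ := this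
      exact ⟨q * ∏ k ∈ t.erase r, (X - C (a k)) ^ 2 + V, by rw [hV]; ring⟩
    have hk : ∀ k ∈ t.erase r, a r ≠ a k := fun k hk e =>
      (Finset.ne_of_mem_erase hk) (ha hr (Finset.mem_of_mem_erase hk) e).symm
    have hPe : ∀ z, P.eval z = ∏ j ∈ s, (z - y j) := fun z => by simp [hP, eval_prod]
    set D : ℂ[X] := ∏ k ∈ t.erase r, (X - C (a k)) ^ 2 with hD
    have hDe : ∀ z, D.eval z = ∏ k ∈ t.erase r, (z - a k) ^ 2 := fun z => by simp [hD, eval_prod]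
    have hD0 : D.eval (a r) ≠ 0 := by
      rw [hDe]
      exact Finset.prod_ne_zero_iff.2 fun k h => pow_ne_zero _ (sub_ne_zero.2 (hk k h))
    have hP0 : P.eval (a r) ≠ 0 := by
      rw [hPe]
      exact Finset.prod_ne_zero_iff.2 fun j h => sub_ne_zero.2 (hy r hr j h)
    have hPd : P.derivative.eval (a r) = P.eval (a r) * ∑ j ∈ s, 1 / (a r - y j) := by
      rw [← logDeriv_prod_sub s y (hy r hr), ← funext hPe, logDeriv_apply, Polynomial.deriv]
      field_simp
    have hDd : D.derivative.eval (a r)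
        = D.eval (a r) * (2 * ∑ k ∈ t.erase r, 1 / (a r - a k)) := by
      rw [← logDeriv_prod_sub_sq _ a hk, ← funext hDe, logDeriv_apply, Polynomial.deriv]
      field_simp
    have h1 : P.eval (a r) = A r * D.eval (a r) := by rw [hW]; simp
    have h2 : P.derivative.eval (a r) = B r * D.eval (a r) + A r * D.derivative.eval (a r) := by
      rw [hW]; simp [derivative_pow]
    rw [← hPe, ← hDe, div_mul_eq_mul_div, div_eq_iff hD0]
    linear_combination -hPd + h2 + A r * hDd
      - (2 * ∑ k ∈ t.erase r, 1 / (a r - a k)) * h1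
  rw [Finset.sum_congr rfl hres]
  -- comparison of the leading coefficients
  have hd2 : ∀ u : Finset ι, (∏ r ∈ u, (X - C (a r)) ^ 2).natDegree = 2 * u.card := fun u => by
    rw [natDegree_prod_of_monic _ _ fun r _ => (monic_X_sub_C _).pow 2]
    simp [natDegree_pow, mul_comm]
  have hterm : ∀ r ∈ t, ((C (A r) + C (B r) * (X - C (a r)))
      * ∏ k ∈ t.erase r, (X - C (a k)) ^ 2).natDegree ≤ 2 * t.card + 1 := by
    intro r hr
    refine natDegree_mul_le.trans ?_
    rw [hd2, Finset.card_erase_of_mem hr]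
    have : (C (A r) + C (B r) * (X - C (a r))).natDegree ≤ 1 := by compute_degree
    omega
  -- The numerator has degree 2|t| + 1 and the denominator 2|t|, so the polynomial part is linear.
  have hq : q.natDegree ≤ 1 := by
    have h1 : (q * ∏ r ∈ t, (X - C (a r)) ^ 2).natDegree ≤ 2 * t.card + 1 := by
      rw [← sub_eq_iff_eq_add] at hdec'
      rw [← hdec']
      refine (natDegree_sub_le _ _).trans (max_le ?_ (natDegree_sum_le_of_forall_le _ _ hterm))
      rw [hP, natDegree_prod_of_monic _ _ fun j _ => monic_X_sub_C _]
      simp [hcard]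
    rcases eq_or_ne q 0 with rfl | hq0
    · simp
    · rw [natDegree_mul hq0 (monic_prod_of_monic _ _ fun r _ => (monic_X_sub_C (a r)).pow 2).ne_zero,
        hd2] at h1
      omega
  have hrefP : P.reflect (2 * t.card + 1) = ∏ j ∈ s, (1 - C (y j) * X) := by
    have := reflect_prod s (fun j => X - C (y j)) (fun _ => 1) fun j _ => (natDegree_X_sub_C _).le
    simpa [reflect_X_sub_C, hcard] using this
  have hrefD : ∀ u : Finset ι, (∏ r ∈ u, (X - C (a r)) ^ 2).reflect (2 * u.card)
      = ∏ r ∈ u, (1 - C (a r) * X) ^ 2 := fun u => by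
    have := reflect_prod u (fun r => (X - C (a r)) ^ 2) (fun _ => 2) fun r _ => by
      rw [natDegree_pow, natDegree_X_sub_C]
    simpa only [reflect_X_sub_C_sq, Finset.sum_const, smul_eq_mul, mul_comm] using this
  have href := congrArg (reflect (2 * t.card + 1)) hdec'
  have hsum : ∀ u : Finset ι, ∀ f : ι → ℂ[X], reflect (2 * t.card + 1) (∑ r ∈ u, f r)
      = ∑ r ∈ u, reflect (2 * t.card + 1) (f r) := fun u f => by
    classical
    induction u using Finset.induction_on with
    | empty => simp
    | insert i u hi ih => rw [Finset.sum_insert hi, Finset.sum_insert hi, reflect_add, ih]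
  -- Remainder terms have degree at most 2|t| - 1, two below the top, so their reflections are
  -- divisible by X². Thus they enter only the coefficient of X², through B_r.
  have hlast : ∀ r ∈ t, reflect (2 * t.card + 1) ((C (A r) + C (B r) * (X - C (a r)))
      * ∏ k ∈ t.erase r, (X - C (a k)) ^ 2)
      = (C (A r) * X + C (B r) * (1 - C (a r) * X)) * X ^ 2
        * ∏ k ∈ t.erase r, (1 - C (a k) * X) ^ 2 := by
    intro r hr
    have hpos := Finset.card_pos.2 ⟨r, hr⟩
    have e : 2 * t.card + 1 = 3 + 2 * (t.erase r).card := by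
      rw [Finset.card_erase_of_mem hr]; omega
    have h3 : (C (A r) + C (B r) * (X - C (a r))).natDegree ≤ 3 := by compute_degree; norm_num
    rw [e, reflect_mul _ _ h3 (hd2 _).le, hrefD]
    congr 1
    have h5 : (X : ℂ[X]).reflect 3 = X ^ 2 := by
      have := reflect_monomial 3 1 (R := ℂ)
      simpa using this
    rw [reflect_add, reflect_C_mul, reflect_sub, reflect_C, reflect_C, h5]
    ring
  rw [hrefP, reflect_add, hsum, Finset.sum_congr rfl hlast,
    show 2 * t.card + 1 = 1 + 2 * t.card by ring, reflect_mul _ _ hq (hd2 t).le, hrefD] at href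
  obtain ⟨y0, y1, y2⟩ := coeff_prod_one_sub s y
  obtain ⟨a0, a1, a2⟩ := coeff_sq_one_sub t a
  have c0 := congrArg (fun f => f.coeff 0) href
  have c1 := congrArg (fun f => f.coeff 1) href
  have c2 := congrArg (fun f => f.coeff 2) href
  have hz : ∀ r, ((C (A r) * X + C (B r) * (1 - C (a r) * X)) * X ^ 2
        * ∏ k ∈ t.erase r, (1 - C (a k) * X) ^ 2)
      = X ^ 2 * ((C (A r) * X + C (B r) * (1 - C (a r) * X))
        * ∏ k ∈ t.erase r, (1 - C (a k) * X) ^ 2) := fun r => by ring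
  have hz0 : ∀ f : ℂ[X], (X ^ 2 * f).coeff 0 = 0 := fun f => by simp
  have hz1 : ∀ f : ℂ[X], (X ^ 2 * f).coeff 1 = 0 := fun f => by
    rw [coeff_X_pow_mul']; simp
  have hz2 : ∀ f : ℂ[X], (X ^ 2 * f).coeff 2 = f.coeff 0 := fun f => by
    rw [coeff_X_pow_mul']; simp
  have hq2 : (q.reflect 1).coeff 2 = 0 := by
    rw [coeff_reflect]
    have : revAt 1 2 = 2 := revAt_eq_self_of_lt (by norm_num)
    rw [this]
    exact coeff_eq_zero_of_natDegree_lt (by omega)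
  have hlead : ∀ r ∈ t, ((C (A r) * X + C (B r) * (1 - C (a r) * X))
        * ∏ k ∈ t.erase r, (1 - C (a k) * X) ^ 2).coeff 0 = B r := fun r _ => by
    rw [mul_coeff_zero, (coeff_sq_one_sub (t.erase r) a).1]
    simp
  simp only [coeff_add, finsetSum_coeff, hz] at c0 c1 c2
  simp only [hz0, hz1, mul_coeff_zero, mul_coeff_one, y0, y1, a0, a1, Finset.sum_const_zero] at c0 c1
  simp only [hz2] at c2
  rw [Finset.sum_congr rfl hlead, coeff_two_mul, y2, a0, a1, a2, hq2] at c2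
  generalize (q.reflect 1).coeff 0 = q0 at c0 c1 c2
  generalize (q.reflect 1).coeff 1 = q1 at c0 c1 c2
  -- The coefficients of 1 and X determine the linear polynomial part; the coefficient of X² then
  -- gives the sum of the B_r.
  have hq0 : q0 = 1 := by linear_combination -c0
  subst hq0
  have hq1 : q1 = -∑ j ∈ s, y j + 2 * ∑ r ∈ t, a r := by linear_combination -c1
  subst hq1
  linear_combination -c2

end residues

end RadialCoulomb
end

noncomputable section

namespace RadialCoulomb

open Set

/-! ### Chordal-type solutions -/

section chordal

variable {n m : ℕ} {x : Fin n ⊕ Fin m → ℂ} {c : Fin n} {κ : ℝ}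

/-- The charges of the chordal-type solutions. -/
def chordalWeight (m : ℕ) (κ : ℝ) (c : Fin n) : Fin n ⊕ Fin m → ℝ :=
  Sum.elim (chordalCharge κ c) fun _ => -2 * chargeA κ

/-- The coordinate `cot((x l - x c)/2)`. -/
def cotCoord (c : Fin n) (x : Fin n ⊕ Fin m → ℂ) (l : Fin n ⊕ Fin m) : ℂ :=
  Complex.cot ((x l - x (Sum.inl c)) / 2)

/-- `∏_{j ≠ c} (u - y j) / ∏_{s ≠ r} (u - y s)²`. -/
def screeningRatio (c : Fin n) (r : Fin m) (y : Fin n ⊕ Fin m → ℂ) (u : ℂ) : ℂ :=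
  (∏ j ∈ Finset.univ.erase c, (u - y (Sum.inl j)))
    / ∏ s ∈ Finset.univ.erase r, (u - y (Sum.inr s)) ^ 2

/-- The logarithmic derivative of `screeningRatio`. -/
def screeningLogDeriv (c : Fin n) (r : Fin m) (y : Fin n ⊕ Fin m → ℂ) (u : ℂ) : ℂ :=
  ∑ j ∈ Finset.univ.erase c, 1 / (u - y (Sum.inl j))
    - 2 * ∑ s ∈ Finset.univ.erase r, 1 / (u - y (Sum.inr s))

/-- The total derivative that the null vector equation at the special point needs. -/
def chordalCorrection (c : Fin n) (r : Fin m) (x : Fin n ⊕ Fin m → ℂ) : ℂ :=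
  -- The factor -2 sin² is the reciprocal of the derivative of u = cot((x_r - x_c)/2), so the vector
  -- field ∂/∂u is being used along the contour.
  -2 * Complex.sin ((x (Sum.inr r) - x (Sum.inl c)) / 2) ^ 2
    * screeningRatio c r (cotCoord c x) (cotCoord c x (Sum.inr r))

/-- For equal cotangents the subtraction formula would read 0 = -(1 + cot²), but 1 + cot² = 1/sin²
is not zero. -/
theorem cotCoord_ne (hx : x ∈ configSpace n m) {l k : Fin n ⊕ Fin m} (hl : l ≠ Sum.inl c)
    (hk : k ≠ Sum.inl c) (h : l ≠ k) : cotCoord c x l ≠ cotCoord c x k := by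
  intro e
  have h1 := cot_sub_mul_cot (hx.1 l _ hl) (hx.1 k _ hk) (hx.1 l k h)
  unfold cotCoord at e
  rw [← e, sub_self, zero_mul, ← pow_two, add_comm, one_add_cot_sq (hx.1 l _ hl)] at h1
  exact neg_ne_zero.2 (one_div_ne_zero (pow_ne_zero 2 (hx.1 l _ hl))) h1.symm

/-- The subtraction formula solved for the interaction: in the coordinates u = cot((x - x_c)/2),
which send x_c to infinity, interactions are rational functions. -/
theorem cot_sub_eq_cotCoord (hx : x ∈ configSpace n m) {l k : Fin n ⊕ Fin m}
    (hl : l ≠ Sum.inl c) (hk : k ≠ Sum.inl c) (h : l ≠ k) :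
    Complex.cot ((x l - x k) / 2)
      = cotCoord c x l - (1 + cotCoord c x l ^ 2) * (1 / (cotCoord c x l - cotCoord c x k)) := by
  have h1 := cot_sub_mul_cot (hx.1 l _ hl) (hx.1 k _ hk) (hx.1 l k h)
  have h2 := sub_ne_zero.2 (cotCoord_ne hx hl hk h)
  change (cotCoord c x l - cotCoord c x k) * _ = -(cotCoord c x l * cotCoord c x k + 1) at h1
  field_simp
  linear_combination h1

theorem hasDerivAt_screeningRatio (r : Fin m) {y : Fin n ⊕ Fin m → ℂ} {u : ℂ}
    (hj : ∀ j ∈ Finset.univ.erase c, u ≠ y (Sum.inl j))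
    (hs : ∀ s ∈ Finset.univ.erase r, u ≠ y (Sum.inr s)) :
    HasDerivAt (screeningRatio c r y) (screeningRatio c r y u * screeningLogDeriv c r y u) u := by
  have h1 : ∏ j ∈ Finset.univ.erase c, (u - y (Sum.inl j)) ≠ 0 :=
    Finset.prod_ne_zero_iff.2 fun j h => sub_ne_zero.2 (hj j h)
  have h2 : ∏ s ∈ Finset.univ.erase r, (u - y (Sum.inr s)) ^ 2 ≠ 0 :=
    Finset.prod_ne_zero_iff.2 fun s h => pow_ne_zero 2 (sub_ne_zero.2 (hs s h))
  have hd : DifferentiableAt ℂ (screeningRatio c r y) u :=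
    DifferentiableAt.div (by fun_prop) (by fun_prop) h2
  refine hd.hasDerivAt.congr_deriv ?_
  have h3 : logDeriv (screeningRatio c r y) u = screeningLogDeriv c r y u := by
    unfold screeningRatio screeningLogDeriv
    rw [logDeriv_div (f := fun u => ∏ j ∈ Finset.univ.erase c, (u - y (Sum.inl j)))
      (g := fun u => ∏ s ∈ Finset.univ.erase r, (u - y (Sum.inr s)) ^ 2) u h1 h2
      (by fun_prop) (by fun_prop), logDeriv_prod_sub _ _ hj, logDeriv_prod_sub_sq _ _ hs]
  have h4 : screeningRatio c r y u ≠ 0 := div_ne_zero h1 h2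
  rw [← h3, logDeriv_apply]
  field_simp

theorem contDiffOn_chordalCorrection (k : WithTop ℕ∞) (c : Fin n) (r : Fin m) :
    ContDiffOn ℂ k (chordalCorrection c r) (configSpace n m) := by
  unfold chordalCorrection screeningRatio cotCoord
  have hc := contDiffOn_cot_sub (n := n) (m := m) k
  refine ContDiffOn.mul (ContDiff.contDiffOn ?_) (ContDiffOn.div
    (contDiffOn_prod fun j _ => (hc _ _).sub (hc _ _))
    (contDiffOn_prod fun s _ => ((hc _ _).sub (hc _ _)).pow 2) fun x hx =>
      Finset.prod_ne_zero_iff.2 fun s hs => pow_ne_zero 2 (sub_ne_zero.2 ?_))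
  · fun_prop
  · exact cotCoord_ne hx (by simp) (by simp) (by simpa using (Finset.ne_of_mem_erase hs).symm)

theorem fderiv_single_eq_deriv {ι : Type*} [Fintype ι] [DecidableEq ι] {f : (ι → ℂ) → ℂ}
    {x : ι → ℂ} (hf : DifferentiableAt ℂ f x) (l : ι) {f' : ℂ}
    (h : HasDerivAt (fun t => f (Function.update x l t)) f' (x l)) :
    fderiv ℂ f x (Pi.single l 1) = f' := by
  have h1 : HasFDerivAt f (fderiv ℂ f x) (Function.update x l (x l)) := by
    simpa using hf.hasFDerivAt
  exact (h1.comp_hasDerivAt (x l) (hasDerivAt_update x l (x l))).unique h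

theorem fderiv_chordalCorrection (hx : x ∈ configSpace n m) (r : Fin m) :
    fderiv ℂ (chordalCorrection c r) x (Pi.single (Sum.inr r) 1)
      = (screeningLogDeriv c r (cotCoord c x) (cotCoord c x (Sum.inr r))
          - 2 * Complex.sin ((x (Sum.inr r) - x (Sum.inl c)) / 2)
            * Complex.cos ((x (Sum.inr r) - x (Sum.inl c)) / 2))
        * screeningRatio c r (cotCoord c x) (cotCoord c x (Sum.inr r)) := by
  refine fderiv_single_eq_deriv (((contDiffOn_chordalCorrection 1 c r).differentiableOn
    one_ne_zero).differentiableAt ((isOpen_configSpace n m).mem_nhds hx)) _ ?_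
  have hs : Complex.sin ((x (Sum.inr r) - x (Sum.inl c)) / 2) ≠ 0 := hx.1 _ _ (by simp)
  have e : (fun t => chordalCorrection c r (Function.update x (Sum.inr r) t))
      = fun t => -2 * Complex.sin ((t - x (Sum.inl c)) / 2) ^ 2
        * screeningRatio c r (cotCoord c x) (Complex.cot ((t - x (Sum.inl c)) / 2)) := by
    ext t
    simp only [chordalCorrection, cotCoord, screeningRatio, Function.update_self,
      Function.update_of_ne (show (Sum.inl c : Fin n ⊕ Fin m) ≠ Sum.inr r by simp)]
    congr 2
    refine Finset.prod_congr rfl fun s hs => ?_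
    rw [Function.update_of_ne (by simpa using Finset.ne_of_mem_erase hs)]
  rw [e]
  have hl : HasDerivAt (fun t => (t - x (Sum.inl c)) / 2) (1 / 2) (x (Sum.inr r)) :=
    ((hasDerivAt_id' _).sub_const _).div_const _
  have h1 := (Complex.hasDerivAt_sin _).comp (x (Sum.inr r)) hl
  have h2 := (hasDerivAt_cot hs).comp (x (Sum.inr r)) hl
  have h3 := (hasDerivAt_screeningRatio (c := c) r (y := cotCoord c x)
    (u := cotCoord c x (Sum.inr r))
    (fun j hj => cotCoord_ne hx (by simp) (by simpa using Finset.ne_of_mem_erase hj) (by simp))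
    (fun s hs => cotCoord_ne hx (by simp) (by simp)
      (by simpa using (Finset.ne_of_mem_erase hs).symm))).comp (x (Sum.inr r)) h2
  refine (((h1.pow 2).const_mul (-2)).mul h3).congr_deriv ?_
  simp only [Function.comp, Pi.pow_apply]
  rw [one_add_cot_sq hs]
  change _ = (_ - _) * screeningRatio c r (cotCoord c x)
    (Complex.cot ((x (Sum.inr r) - x (Sum.inl c)) / 2))
  have e2 : cotCoord c x (Sum.inr r) = Complex.cot ((x (Sum.inr r) - x (Sum.inl c)) / 2) := rfl
  rw [e2]
  generalize screeningRatio c r (cotCoord c x)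
    (Complex.cot ((x (Sum.inr r) - x (Sum.inl c)) / 2)) = T
  generalize screeningLogDeriv c r (cotCoord c x)
    (Complex.cot ((x (Sum.inr r) - x (Sum.inl c)) / 2)) = R
  field_simp
  push_cast
  ring

/-- The term linear in u collects 2b - a at x_c, the 2m + 1 other points and the m - 1 other
screening charges. With ab = 1/2 - a² its coefficient is exactly -1, and this is where n = 2(m+1)
enters. -/
theorem drift_chordal (hκ : 0 < κ) (hn : n = 2 * (m + 1)) (hx : x ∈ configSpace n m) (r : Fin m) :
    drift (chordalWeight m κ c) x (Sum.inr r)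
      = -cotCoord c x (Sum.inr r) + (chargeA κ : ℂ) ^ 2 * (1 + cotCoord c x (Sum.inr r) ^ 2)
        * screeningLogDeriv c r (cotCoord c x) (cotCoord c x (Sum.inr r)) := by
  have hab : (chargeA κ : ℂ) * chargeB κ = 1 / 2 - (chargeA κ : ℂ) ^ 2 := by
    have := congrArg (fun t : ℝ => (t : ℂ)) (chargeA_mul_chargeB hκ)
    push_cast at this
    exact this
  unfold drift screeningLogDeriv
  rw [Fintype.sum_sum_type, ← Finset.add_sum_erase _ _ (Finset.mem_univ c),
    ← Finset.add_sum_erase _ (fun s : Fin m => ((chordalWeight m κ c (Sum.inr r)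
      * chordalWeight m κ c (Sum.inr s) / 2 : ℝ) : ℂ)
        * Complex.cot ((x (Sum.inr r) - x (Sum.inr s)) / 2)) (Finset.mem_univ r)]
  rw [sub_self, zero_div, cot_zero', mul_zero, zero_add]
  have e1 : ∀ j ∈ Finset.univ.erase c, ((chordalWeight m κ c (Sum.inr r)
      * chordalWeight m κ c (Sum.inl j) / 2 : ℝ) : ℂ)
        * Complex.cot ((x (Sum.inr r) - x (Sum.inl j)) / 2)
      = -(chargeA κ : ℂ) ^ 2 * cotCoord c x (Sum.inr r)
        + (chargeA κ : ℂ) ^ 2 * (1 + cotCoord c x (Sum.inr r) ^ 2)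
          * (1 / (cotCoord c x (Sum.inr r) - cotCoord c x (Sum.inl j))) := by
    intro j hj
    rw [cot_sub_eq_cotCoord (c := c) hx (by simp) (by simpa using Finset.ne_of_mem_erase hj)
      (by simp)]
    simp only [chordalWeight, Sum.elim_inl, Sum.elim_inr, chordalCharge,
      if_neg (Finset.ne_of_mem_erase hj)]
    push_cast
    ring
  have e2 : ∀ s ∈ Finset.univ.erase r, ((chordalWeight m κ c (Sum.inr r)
      * chordalWeight m κ c (Sum.inr s) / 2 : ℝ) : ℂ)
        * Complex.cot ((x (Sum.inr r) - x (Sum.inr s)) / 2)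
      = 2 * (chargeA κ : ℂ) ^ 2 * cotCoord c x (Sum.inr r)
        - 2 * (chargeA κ : ℂ) ^ 2 * (1 + cotCoord c x (Sum.inr r) ^ 2)
          * (1 / (cotCoord c x (Sum.inr r) - cotCoord c x (Sum.inr s))) := by
    intro s hs
    rw [cot_sub_eq_cotCoord (c := c) hx (by simp) (by simp)
      (by simpa using (Finset.ne_of_mem_erase hs).symm)]
    simp only [chordalWeight, Sum.elim_inr]
    push_cast
    ring
  rw [Finset.sum_congr rfl e1, Finset.sum_congr rfl e2, Finset.sum_add_distrib,
    Finset.sum_sub_distrib, Finset.sum_const, Finset.sum_const, ← Finset.mul_sum,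
    ← Finset.mul_sum]
  have c1 : ((Finset.univ.erase c).card : ℂ) = 2 * m + 1 := by
    rw [Finset.card_erase_of_mem (Finset.mem_univ c), Finset.card_fin, hn]
    push_cast [show 2 * (m + 1) - 1 = 2 * m + 1 by omega]
    ring
  have c2 : ((Finset.univ.erase r).card : ℂ) = m - 1 := by
    have := Finset.card_erase_add_one (Finset.mem_univ r)
    rw [Finset.card_fin] at this
    have h' : ((Finset.univ.erase r).card : ℂ) + 1 = m := by exact_mod_cast this
    linear_combination h'
  rw [nsmul_eq_mul, nsmul_eq_mul, c1, c2]
  simp only [chordalWeight, Sum.elim_inl, Sum.elim_inr, chordalCharge, if_true]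
  change _ * cotCoord c x (Sum.inr r) + _ + _ = _
  push_cast
  linear_combination (-2 * cotCoord c x (Sum.inr r)) * hab

/-- The linear term -u of the drift cancels the derivative of the prefactor sin², because sin · cot
= cos. Only a multiple of the residue at the r-th screening charge is left. -/
theorem covDeriv_chordalCorrection (hκ : 0 < κ) (hn : n = 2 * (m + 1)) (hx : x ∈ configSpace n m)
    (r : Fin m) : covDeriv (chordalWeight m κ c) (Sum.inr r) (chordalCorrection c r) x
      = (1 - 2 * (chargeA κ : ℂ) ^ 2)
        * (screeningRatio c r (cotCoord c x) (cotCoord c x (Sum.inr r))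
          * screeningLogDeriv c r (cotCoord c x) (cotCoord c x (Sum.inr r))) := by
  rw [covDeriv, fderiv_chordalCorrection hx, drift_chordal hκ hn hx]
  have hs : Complex.sin ((x (Sum.inr r) - x (Sum.inl c)) / 2) ≠ 0 := hx.1 _ _ (by simp)
  have h1 : Complex.sin ((x (Sum.inr r) - x (Sum.inl c)) / 2) ^ 2
      * (1 + cotCoord c x (Sum.inr r) ^ 2) = 1 := by
    unfold cotCoord
    rw [one_add_cot_sq hs]
    field_simp
  have h2 : Complex.sin ((x (Sum.inr r) - x (Sum.inl c)) / 2) * cotCoord c x (Sum.inr r)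
      = Complex.cos ((x (Sum.inr r) - x (Sum.inl c)) / 2) := by
    unfold cotCoord
    rw [Complex.cot_eq_cos_div_sin]
    field_simp
  simp only [chordalCorrection]
  generalize screeningRatio c r (cotCoord c x) (cotCoord c x (Sum.inr r)) = T
  generalize screeningLogDeriv c r (cotCoord c x) (cotCoord c x (Sum.inr r)) = R
  linear_combination (-2 * (chargeA κ : ℂ) ^ 2 * R * T) * h1
    + 2 * Complex.sin ((x (Sum.inr r) - x (Sum.inl c)) / 2) * T * h2

theorem sum_chordalWeight (hn : n = 2 * (m + 1)) :
    ∑ l, (chordalWeight m κ c l : ℂ) = 2 * chargeB κ := by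
  rw [Fintype.sum_sum_type, ← Finset.add_sum_erase _ _ (Finset.mem_univ c)]
  have e1 : ∀ j ∈ Finset.univ.erase c, (chordalWeight m κ c (Sum.inl j) : ℂ) = chargeA κ :=
    fun j hj => by simp [chordalWeight, chordalCharge, Finset.ne_of_mem_erase hj]
  have c1 : ((Finset.univ.erase c).card : ℂ) = 2 * m + 1 := by
    rw [Finset.card_erase_of_mem (Finset.mem_univ c), Finset.card_fin, hn]
    push_cast [show 2 * (m + 1) - 1 = 2 * m + 1 by omega]
    ring
  rw [Finset.sum_congr rfl e1, Finset.sum_const, nsmul_eq_mul, c1]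
  simp [chordalWeight, chordalCharge]
  ring

/-- The square sums that occur in the null vector equation at the special point. -/
theorem sum_chordal_residues (hn : n = 2 * (m + 1)) (hx : x ∈ configSpace n m) (κ : ℝ) :
    (chargeA κ : ℂ) ^ 2 * ∑ r, screeningRatio c r (cotCoord c x) (cotCoord c x (Sum.inr r))
          * screeningLogDeriv c r (cotCoord c x) (cotCoord c x (Sum.inr r))
      = ((∑ l, chordalWeight m κ c l * cotCoord c x l) ^ 2
        - chargeA κ * ∑ l, chordalWeight m κ c l * cotCoord c x l ^ 2) / 2 := by
  have hcard : (Finset.univ.erase c).card = 2 * (Finset.univ : Finset (Fin m)).card + 1 := by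
    rw [Finset.card_erase_of_mem (Finset.mem_univ c), Finset.card_fin, Finset.card_fin, hn]
    omega
  have key := sum_residues (Finset.univ.erase c) (fun j => cotCoord c x (Sum.inl j))
    Finset.univ (fun r => cotCoord c x (Sum.inr r)) hcard
    (fun r _ s _ e => by
      by_contra hrs
      exact cotCoord_ne hx (c := c) (l := Sum.inr r) (k := Sum.inr s) (by simp) (by simp)
        (by simpa using hrs) e)
    (fun r _ j hj => cotCoord_ne hx (by simp) (by simpa using Finset.ne_of_mem_erase hj) (by simp))
  have h0 : cotCoord c x (Sum.inl c) = 0 := by simp [cotCoord, cot_zero']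
  have e : ∀ k : ℕ, k ≠ 0 → ∑ l, chordalWeight m κ c l * cotCoord c x l ^ k
      = chargeA κ * (∑ j ∈ Finset.univ.erase c, cotCoord c x (Sum.inl j) ^ k
        - 2 * ∑ r, cotCoord c x (Sum.inr r) ^ k) := by
    intro k hk
    rw [Fintype.sum_sum_type, ← Finset.add_sum_erase _ _ (Finset.mem_univ c), h0, zero_pow hk,
      mul_zero, zero_add, mul_sub, Finset.mul_sum, Finset.mul_sum, Finset.mul_sum,
      sub_eq_add_neg, ← Finset.sum_neg_distrib]
    congr 1
    · refine Finset.sum_congr rfl fun j hj => ?_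
      simp [chordalWeight, chordalCharge, Finset.ne_of_mem_erase hj]
    · refine Finset.sum_congr rfl fun j hj => ?_
      simp [chordalWeight]
      ring
  have e1 := e 1 one_ne_zero
  simp only [pow_one] at e1
  rw [e1, e 2 two_ne_zero]
  unfold screeningRatio screeningLogDeriv
  rw [key]
  ring

/-- The weight q²/2 - bq is symmetric under q ↦ 2b - q, so the special point has the weight of an
ordinary one. -/
theorem weight_special (hκ : 0 < κ) :
    (2 * chargeB κ - chargeA κ) ^ 2 / 2 - chargeB κ * (2 * chargeB κ - chargeA κ)
      = (6 - κ) / (2 * κ) := by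
  rw [← weight_point hκ]
  ring

theorem hasExtraCharge_one (q : Fin n ⊕ Fin m → ℝ) (w : ℂ) :
    HasExtraCharge q 0 0 w fun _ => 1 := by
  intro x _
  simp

theorem extendDrift_zero (q : Fin n ⊕ Fin m → ℝ) (w : ℂ) :
    extendDrift q 0 0 x w none = 0 := by
  simp [extendDrift, extend]

/-- The integrand of the total derivatives for the chordal-type solutions. -/
def chordalPotential (κ : ℝ) (c i : Fin n) (r : Fin m) (x : Fin n ⊕ Fin m → ℂ) : ℂ :=
  Complex.cot ((x (Sum.inl i) - x (Sum.inr r)) / 2) * 1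
    -- The constant is dictated by the leftover at charge q = 2b - a: κq²/8 - 1/4 = (κ/4 - 2)(κ/2 -
    -- 2)/2, and a²(κ/2 - 2) = 1 - 2a² is the factor in `covDeriv_chordalCorrection`.
    + (if i = c then κ / 4 - 2 else 0 : ℂ) * chordalCorrection c r x

theorem contDiffOn_chordalPotential (k : WithTop ℕ∞) (κ : ℝ) (c i : Fin n) (r : Fin m) :
    ContDiffOn ℂ k (chordalPotential κ c i r) (configSpace n m) :=
  ((contDiffOn_cot_sub k _ _).mul contDiffOn_const).add
    (contDiffOn_const.mul (contDiffOn_chordalCorrection k c r))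

theorem covDeriv_chordalPotential (hκ : 0 < κ) (hn : n = 2 * (m + 1)) (hx : x ∈ configSpace n m)
    (i : Fin n) (r : Fin m) :
    covDeriv (chordalWeight m κ c) (Sum.inr r) (chordalPotential κ c i r) x
      = covDeriv (chordalWeight m κ c) (Sum.inr r)
          (fun x => Complex.cot ((x (Sum.inl i) - x (Sum.inr r)) / 2) * 1) x
        + (if i = c then κ / 4 - 2 else 0 : ℂ) * ((1 - 2 * (chargeA κ : ℂ) ^ 2)
          * (screeningRatio c r (cotCoord c x) (cotCoord c x (Sum.inr r))
            * screeningLogDeriv c r (cotCoord c x) (cotCoord c x (Sum.inr r)))) := by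
  rw [← covDeriv_chordalCorrection hκ hn hx]
  have hnhds := (isOpen_configSpace n m).mem_nhds hx
  have h1 : DifferentiableAt ℂ (fun x : Fin n ⊕ Fin m → ℂ =>
      Complex.cot ((x (Sum.inl i) - x (Sum.inr r)) / 2) * 1) x :=
    ((((contDiffOn_cot_sub 1 _ _).mul contDiffOn_const).differentiableOn
      one_ne_zero).differentiableAt hnhds)
  have h2 : DifferentiableAt ℂ (chordalCorrection c r) x :=
    ((contDiffOn_chordalCorrection 1 c r).differentiableOn one_ne_zero).differentiableAt hnhds
  unfold covDeriv chordalPotential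
  rw [fderiv_fun_add h1 (h2.const_mul _), fderiv_const_mul h2, _root_.add_apply,
    _root_.smul_apply, smul_eq_mul]
  ring

theorem LiftedFamily.solvesNullVector_chordal (F : LiftedFamily n m) (hκ : 0 < κ)
    (hn : n = 2 * (m + 1)) (c : Fin n) {ψ : (Fin n → ℝ) → ℂ}
    (hψ : ∀ θ ∈ chamber n, ψ θ = F.integral (chordalWeight m κ c) (fun _ => 1) θ) :
    SolvesNullVector κ ((6 - κ) * (κ - 2) / (8 * κ)) ψ := by
  refine F.solvesNullVector_of_total_derivative hψ contDiffOn_const (chordalPotential κ c)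
    (fun i r => contDiffOn_chordalPotential _ κ c i r) fun i x hx => ?_
  have hpt : ∀ j, chordalWeight m κ c (Sum.inl j) ^ 2 / 2
      - chargeB κ * chordalWeight m κ c (Sum.inl j) = (6 - κ) / (2 * κ) := by
    intro j
    by_cases hj : j = c
    · simpa [chordalWeight, chordalCharge, hj] using weight_special hκ
    · simpa [chordalWeight, chordalCharge, hj] using weight_point hκ
  have key := (hasExtraCharge_one (chordalWeight m κ c) (Real.pi * Complex.I)).null_vector
    (by simp) hx i hκ.ne' hpt (fun r => weight_screening hκ)
  rw [key, sum_chordalWeight hn, extendDrift_zero,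
    Finset.sum_congr rfl fun r _ => covDeriv_chordalPotential hκ hn hx i r, Finset.sum_add_distrib,
    Fintype.sum_option, Fintype.sum_option]
  simp only [extend, Option.elim, ← Finset.mul_sum]
  have h1 : (κ : ℂ) * (chargeA κ : ℂ) ^ 2 = 2 := by exact_mod_cast kappa_mul_chargeA_sq hκ
  have h2 : (chargeB κ : ℂ) = κ / 4 * chargeA κ - chargeA κ := by exact_mod_cast chargeB_eq hκ
  have hκ' : (κ : ℂ) ≠ 0 := by exact_mod_cast hκ.ne'
  -- In terms of charges, h = a²/4 - b², the value that a total charge 2b produces.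
  have h3 : (((6 - κ) * (κ - 2) / (8 * κ) : ℝ) : ℂ) = chargeA κ ^ 2 / 4 - chargeB κ ^ 2 := by
    have ha : (chargeA κ : ℂ) ^ 2 = 2 / κ := by
      rw [eq_div_iff hκ']; linear_combination h1
    have hb : (chargeB κ : ℂ) ^ 2 = (κ / 4 - 1) ^ 2 * (2 / κ) := by
      rw [h2, ← ha]; ring
    rw [ha, hb]
    push_cast
    field_simp
    ring
  rw [h3]
  -- At an ordinary point the leftover coefficients vanish as for the ground solutions. At c they do
  -- not, and the sum of residues accounts for them.
  by_cases hic : i = c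
  · subst hic
    have hres := sum_chordal_residues (c := i) hn hx κ
    change _ = ((∑ l, chordalWeight m κ i l * Complex.cot ((x l - x (Sum.inl i)) / 2)) ^ 2
      - chargeA κ * ∑ l, chordalWeight m κ i l * Complex.cot ((x l - x (Sum.inl i)) / 2) ^ 2) / 2
      at hres
    have h4 : chordalWeight m κ i (Sum.inl i) = 2 * chargeB κ - chargeA κ := by
      simp [chordalWeight, chordalCharge]
    rw [h4]
    simp only [if_true]
    generalize ∑ r, screeningRatio i r (cotCoord i x) (cotCoord i x (Sum.inr r))
          * screeningLogDeriv i r (cotCoord i x) (cotCoord i x (Sum.inr r)) = R at hres ⊢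
    generalize ∑ l, (chordalWeight m κ i l : ℂ) * Complex.cot ((x l - x (Sum.inl i)) / 2) = S1
      at hres ⊢
    generalize ∑ l, (chordalWeight m κ i l : ℂ) * Complex.cot ((x l - x (Sum.inl i)) / 2) ^ 2 = S2
      at hres ⊢
    push_cast
    rw [h2]
    linear_combination ((κ / 4 - 2) * R / 2 + (κ / 2 - 3) ^ 2 / 8 * S1 ^ 2) * h1
      - (κ / 4 - 2) * (κ / 2 - 2) * hres
  · have h4 : chordalWeight m κ c (Sum.inl i) = chargeA κ := by
      simp [chordalWeight, chordalCharge, hic]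
    rw [h4]
    simp only [if_neg hic]
    push_cast
    generalize (∑ l, (chordalWeight m κ c l : ℂ) * Complex.cot ((x l - x (Sum.inl i)) / 2)) = S1
    generalize (∑ l, (chordalWeight m κ c l : ℂ) * Complex.cot ((x l - x (Sum.inl i)) / 2) ^ 2) = S2
    rw [h2]
    linear_combination S1 ^ 2 / 8 * h1

theorem LiftedFamily.solvesRotation_chordal (F : LiftedFamily n m) (c : Fin n)
    {ψ : (Fin n → ℝ) → ℂ}
    (hψ : ∀ θ ∈ chamber n, ψ θ = F.integral (chordalWeight m κ c) (fun _ => 1) θ) :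
    SolvesRotation 0 ψ := by
  refine F.solvesRotation_of_total_derivative hψ contDiffOn_const fun x hx => ?_
  rw [(hasExtraCharge_one _ (Real.pi * Complex.I)).sum_covDeriv hx, extendDrift_zero]
  simp

end chordal

end RadialCoulomb
end

noncomputable section

namespace RadialCoulomb

open MeasureTheory Filter Topology Set

/-! ### Integrals depending on a parameter -/

section parametric

variable {E F : Type} [NormedAddCommGroup E] [NormedAddCommGroup F] {V : Set (ℂ × E)} {A : ℂ} {T : ℝ}

/-- The parameters for which the segment of integration lies in the domain. -/
def segmentDomain (V : Set (ℂ × E)) (A : ℂ) (T : ℝ) : Set E :=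
  {x | ∀ s ∈ Set.Icc (0 : ℝ) T, (A + s, x) ∈ V}

theorem isOpen_segmentDomain (hV : IsOpen V) : IsOpen (segmentDomain V A T) := by
  refine isOpen_iff_mem_nhds.2 fun x hx => ?_
  refine (isCompact_Icc (a := (0 : ℝ)) (b := T)).eventually_forall_of_forall_eventually
    (P := fun x s => (A + (s : ℂ), x) ∈ V) fun s hs => ?_
  have hc : Continuous fun z : E × ℝ => (A + (z.2 : ℂ), z.1) := by fun_prop
  exact hc.continuousAt.preimage_mem_nhds (hV.mem_nhds (hx s hs))

theorem continuousOn_segment {H : ℂ × E → F} (hH : ContinuousOn H V) {x : E}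
    (hx : x ∈ segmentDomain V A T) : ContinuousOn (fun s : ℝ => H (A + s, x)) (Set.Icc 0 T) :=
  hH.comp (f := fun s : ℝ => (A + (s : ℂ), x)) (by fun_prop) fun s hs => hx s hs

theorem intervalIntegrable_segment (hT : 0 ≤ T) {H : ℂ × E → F} (hH : ContinuousOn H V) {x : E}
    (hx : x ∈ segmentDomain V A T) :
    IntervalIntegrable (fun s : ℝ => H (A + s, x)) volume 0 T :=
  ContinuousOn.intervalIntegrable (by
    rw [uIcc_of_le hT]; exact continuousOn_segment hH hx)

variable [NormedSpace ℂ E] [NormedSpace ℂ F]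

/-- The partial derivative in the direction of the parameter. -/
def paramDeriv (H : ℂ × E → F) (z : ℂ × E) : E →L[ℂ] F :=
  (fderiv ℂ H z).comp (ContinuousLinearMap.inr ℂ ℂ E)

theorem contDiffOn_paramDeriv (hV : IsOpen V) {k k' : WithTop ℕ∞} (hk : k + 1 ≤ k')
    {H : ℂ × E → F} (hH : ContDiffOn ℂ k' H V) : ContDiffOn ℂ k (paramDeriv H) V :=
  (hH.fderiv_of_isOpen hV hk).clm_comp contDiffOn_const

theorem hasFDerivAt_param (hV : IsOpen V) {H : ℂ × E → F} (hH : ContDiffOn ℂ 1 H V) {w : ℂ} {x : E}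
    (h : (w, x) ∈ V) : HasFDerivAt (fun x => H (w, x)) (paramDeriv H (w, x)) x := by
  have h1 : HasFDerivAt H (fderiv ℂ H (w, x)) (w, x) :=
    ((hH.differentiableOn one_ne_zero).differentiableAt (hV.mem_nhds h)).hasFDerivAt
  have h2 : HasFDerivAt (fun x : E => (w, x)) (ContinuousLinearMap.inr ℂ ℂ E) x :=
    hasFDerivAt_prodMk_right w x
  exact h1.comp x h2

/-- The derivative is bounded by some C on the compact segment, hence by C + 1 on the segments of
all nearby parameters; this dominates the difference quotients. -/
theorem hasFDerivAt_segmentIntegral [CompleteSpace F] (hV : IsOpen V) (hT : 0 ≤ T)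
    {H : ℂ × E → F} (hH : ContDiffOn ℂ 1 H V) {x : E} (hx : x ∈ segmentDomain V A T) :
    HasFDerivAt (fun x => ∫ s in (0 : ℝ)..T, H (A + s, x))
      (∫ s in (0 : ℝ)..T, paramDeriv H (A + s, x)) x := by
  have hD : ContinuousOn (paramDeriv H) V :=
    (contDiffOn_paramDeriv (k := 0) hV (by simp) hH).continuousOn
  obtain ⟨C, hC⟩ := (isCompact_Icc.image_of_continuousOn
    (continuousOn_segment hD hx).norm).bddAbove
  have hCs : ∀ s ∈ Set.Icc (0 : ℝ) T, ‖paramDeriv H (A + s, x)‖ ≤ C := fun s hs =>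
    hC (mem_image_of_mem _ hs)
  have hev : ∀ᶠ y in 𝓝 x, ∀ s ∈ Set.Icc (0 : ℝ) T,
      (A + (s : ℂ), y) ∈ V ∧ ‖paramDeriv H (A + s, y)‖ ≤ C + 1 := by
    refine (isCompact_Icc (a := (0 : ℝ)) (b := T)).eventually_forall_of_forall_eventually
      (P := fun y s => (A + (s : ℂ), y) ∈ V ∧ ‖paramDeriv H (A + s, y)‖ ≤ C + 1) fun s hs => ?_
    have hc : Continuous fun z : E × ℝ => (A + (z.2 : ℂ), z.1) := by fun_prop
    have h1 : ∀ᶠ z : E × ℝ in 𝓝 (x, s), (A + (z.2 : ℂ), z.1) ∈ V :=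
      hc.continuousAt.preimage_mem_nhds (hV.mem_nhds (hx s hs))
    have h2 : ContinuousAt (fun z : E × ℝ => ‖paramDeriv H (A + (z.2 : ℂ), z.1)‖) (x, s) := by
      have := hD.continuousAt (hV.mem_nhds (hx s hs))
      exact (ContinuousAt.comp (g := paramDeriv H)
        (f := fun z : E × ℝ => (A + (z.2 : ℂ), z.1)) (x := (x, s)) this
        hc.continuousAt).norm
    have h3 := h2.eventually_lt_const (show ‖paramDeriv H (A + (s : ℂ), x)‖ < C + 1 by
      linarith [hCs s hs])
    filter_upwards [h1, h3] with z hz1 hz2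
    exact ⟨hz1, hz2.le⟩
  have hsub : ∀ t, t ∈ Set.uIoc 0 T → t ∈ Set.Icc 0 T := fun t ht => by
    rw [uIoc_of_le hT] at ht; exact Ioc_subset_Icc_self ht
  refine intervalIntegral.hasFDerivAt_integral_of_dominated_of_fderiv_le (bound := fun _ => C + 1)
    (F' := fun x s => paramDeriv H (A + s, x)) hev ?_ (intervalIntegrable_segment hT hH.continuousOn hx)
    ?_ ?_ intervalIntegrable_const ?_
  · filter_upwards [(isOpen_segmentDomain (A := A) (T := T) hV).mem_nhds hx] with y hy
    exact (intervalIntegrable_iff.1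
      (intervalIntegrable_segment hT hH.continuousOn hy)).aestronglyMeasurable
  · exact (intervalIntegrable_iff.1 (intervalIntegrable_segment hT hD hx)).aestronglyMeasurable
  · exact ae_of_all _ fun t ht y hy => (hy t (hsub t ht)).2
  · exact ae_of_all _ fun t ht y hy => hasFDerivAt_param hV hH (hy t (hsub t ht)).1

theorem contDiffOn_segmentIntegral [CompleteSpace F] (hV : IsOpen V) (hT : 0 ≤ T) (k : ℕ)
    {H : ℂ × E → F} (hH : ContDiffOn ℂ (k + 1 : ℕ) H V) :
    ContDiffOn ℂ k (fun x => ∫ s in (0 : ℝ)..T, H (A + s, x)) (segmentDomain V A T) := by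
  -- Every target space is allowed, since in the induction the derivative takes values in a space of
  -- continuous linear maps.
  have hd : ∀ {F : Type} [NormedAddCommGroup F] [NormedSpace ℂ F] [CompleteSpace F]
      {H : ℂ × E → F}, ContDiffOn ℂ 1 H V →
      DifferentiableOn ℂ (fun x => ∫ s in (0 : ℝ)..T, H (A + s, x)) (segmentDomain V A T) :=
    fun hH x hx =>
      (hasFDerivAt_segmentIntegral hV hT hH hx).differentiableAt.differentiableWithinAt
  induction k generalizing F with
  | zero => exact contDiffOn_zero.2 (hd (by simpa using hH)).continuousOn
  | succ k ih =>
    have h1 : ContDiffOn ℂ 1 H V := hH.of_le (by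
      exact_mod_cast (by omega : 1 ≤ k + 1 + 1))
    rw [Nat.cast_add, Nat.cast_one,
      contDiffOn_succ_iff_fderiv_of_isOpen (isOpen_segmentDomain hV)]
    refine ⟨hd h1, fun h => absurd h (by exact_mod_cast WithTop.coe_ne_top), ?_⟩
    refine (ih (H := paramDeriv H) (contDiffOn_paramDeriv hV (by push_cast; exact le_rfl) hH)).congr
      fun x hx => (hasFDerivAt_segmentIntegral hV hT h1 hx).fderiv

end parametric

end RadialCoulomb
end

noncomputable section

namespace RadialCoulomb

open MeasureTheory Filter Topology Set

/-! ### Excited solutions -/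

section excited

variable {n m : ℕ} {q : Fin n ⊕ Fin m → ℝ} {x : Fin n ⊕ Fin m → ℂ} {A : ℂ} {p κ : ℝ}

/-- The positions of the additional screening charge and of the other charges. -/
def excitedDomain (n m : ℕ) : Set (ℂ × (Fin n ⊕ Fin m → ℂ)) :=
  {z | z.2 ∈ configSpace n m ∧ ∀ l, Complex.sin ((z.2 l - z.1) / 2) ≠ 0}

theorem isOpen_excitedDomain (n m : ℕ) : IsOpen (excitedDomain n m) := by
  have : excitedDomain n m = Prod.snd ⁻¹' configSpace n m ∩
      ⋂ l, {z : ℂ × (Fin n ⊕ Fin m → ℂ) | Complex.sin ((z.2 l - z.1) / 2) ≠ 0} := by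
    ext z; simp [excitedDomain]
  rw [this]
  exact ((isOpen_configSpace n m).preimage continuous_snd).inter
    (isOpen_iInter_of_finite fun l => isOpen_ne_fun (by fun_prop) continuous_const)

theorem mem_excitedDomain {w : ℂ} (hw : Real.pi ≤ w.im) (hx : x ∈ configSpace n m) :
    (w, x) ∈ excitedDomain n m :=
  ⟨hx, fun l => sin_extend_ne_zero hx hw (some l) none (by simp)⟩

theorem mem_segmentDomain (hA : Real.pi ≤ A.im) (hx : x ∈ configSpace n m) (T : ℝ) :
    x ∈ segmentDomain (excitedDomain n m) A T :=
  fun s _ => mem_excitedDomain (by simpa using hA) hx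

/-- The covariant derivative with an additional parameter. -/
def paramCovDeriv (q : Fin n ⊕ Fin m → ℝ) (l : Fin n ⊕ Fin m)
    (H : ℂ × (Fin n ⊕ Fin m → ℂ) → ℂ) (z : ℂ × (Fin n ⊕ Fin m → ℂ)) : ℂ :=
  covDeriv q l (fun x => H (z.1, x)) z.2

theorem paramCovDeriv_eq {H : ℂ × (Fin n ⊕ Fin m → ℂ) → ℂ}
    (hH : ContDiffOn ℂ 1 H (excitedDomain n m)) (l : Fin n ⊕ Fin m)
    {z : ℂ × (Fin n ⊕ Fin m → ℂ)} (hz : z ∈ excitedDomain n m) :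
    paramCovDeriv q l H z = paramDeriv H z (Pi.single l 1) + drift q z.2 l * H z := by
  unfold paramCovDeriv covDeriv
  rw [(hasFDerivAt_param (isOpen_excitedDomain n m) hH hz).fderiv]

theorem contDiffOn_paramCovDeriv {k k' : WithTop ℕ∞} (hk : k + 1 ≤ k')
    {H : ℂ × (Fin n ⊕ Fin m → ℂ) → ℂ} (hH : ContDiffOn ℂ k' H (excitedDomain n m))
    (q : Fin n ⊕ Fin m → ℝ) (l : Fin n ⊕ Fin m) :
    ContDiffOn ℂ k (paramCovDeriv q l H) (excitedDomain n m) := by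
  have h1 : ContDiffOn ℂ k (fun z => paramDeriv H z (Pi.single l 1) + drift q z.2 l * H z)
      (excitedDomain n m) :=
    ((contDiffOn_paramDeriv (isOpen_excitedDomain n m) hk hH).clm_apply contDiffOn_const).add
      (((contDiffOn_drift k q l).comp contDiffOn_snd fun z hz => hz.1).mul
        (hH.of_le (le_self_add.trans hk)))
  exact h1.congr fun z hz => paramCovDeriv_eq (hH.of_le (le_add_self.trans hk)) l hz

/-- The drift does not involve w, so the covariant derivative commutes with the integral over w. -/
theorem covDeriv_segmentIntegral (hA : Real.pi ≤ A.im) {T : ℝ} (hT : 0 ≤ T)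
    {H : ℂ × (Fin n ⊕ Fin m → ℂ) → ℂ} (hH : ContDiffOn ℂ 1 H (excitedDomain n m))
    (l : Fin n ⊕ Fin m) (hx : x ∈ configSpace n m) :
    covDeriv q l (fun x => ∫ s in (0 : ℝ)..T, H (A + s, x)) x
      = ∫ s in (0 : ℝ)..T, paramCovDeriv q l H (A + s, x) := by
  have hV := isOpen_excitedDomain n m
  have hx' := mem_segmentDomain hA hx T
  have hD : ContinuousOn (paramDeriv H) (excitedDomain n m) :=
    (contDiffOn_paramDeriv (k := 0) hV (by simp) hH).continuousOn
  have hi := intervalIntegrable_segment hT hD hx'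
  rw [intervalIntegral.integral_congr (g := fun s : ℝ => paramDeriv H (A + s, x) (Pi.single l 1)
    + drift q x l * H (A + s, x)) fun s hs => paramCovDeriv_eq hH l
      (hx' s (by rwa [uIcc_of_le hT] at hs)), covDeriv,
    (hasFDerivAt_segmentIntegral hV hT hH hx').fderiv, intervalIntegral.integral_add,
    intervalIntegral.integral_const_mul, ContinuousLinearMap.intervalIntegral_apply hi]
  · exact intervalIntegrable_segment hT (H := fun z => paramDeriv H z (Pi.single l 1))
      (hD.clm_apply continuousOn_const) hx'
  · exact (intervalIntegrable_segment hT hH.continuousOn hx').const_mul _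

/-- The interactions of the additional charge, with integral exponents. -/
def excitedFactor (z : ℂ × (Fin n ⊕ Fin m → ℂ)) : ℂ :=
  ∏ l, Complex.sin ((z.2 l - z.1) / 2) ^ (Sum.elim (fun _ => 1) (fun _ => -2) l : ℤ)

theorem contDiffOn_excitedFactor (k : WithTop ℕ∞) :
    ContDiffOn ℂ k (excitedFactor (n := n) (m := m)) (excitedDomain n m) := by
  unfold excitedFactor
  refine contDiffOn_prod fun l _ z hz => ContDiffAt.contDiffWithinAt ?_
  have h1 : AnalyticAt ℂ
      (fun w : ℂ => w ^ (Sum.elim (fun _ : Fin n => 1) (fun _ : Fin m => -2) l : ℤ))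
      (Complex.sin ((z.2 l - z.1) / 2)) :=
    AnalyticAt.fun_zpow (by fun_prop) (hz.2 l)
  have h2 : ContDiff ℂ k (fun z : ℂ × (Fin n ⊕ Fin m → ℂ) =>
      Complex.sin ((z.2 l - z.1) / 2)) := by fun_prop
  exact ContDiffAt.comp z h1.contDiffAt h2.contDiffAt

/-- The charges of the additional particle. -/
def IsExcitedCharge (q : Fin n ⊕ Fin m → ℝ) (p : ℝ) : Prop :=
  ∀ l, q l * p = ((Sum.elim (fun _ => 1) (fun _ => -2) l : ℤ) : ℝ)

theorem hasDerivAt_sin_zpow {f : ℂ → ℂ} {f' t : ℂ} (hf : HasDerivAt f f' t)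
    (h : Complex.sin (f t) ≠ 0) (e : ℤ) :
    HasDerivAt (fun t => Complex.sin (f t) ^ e)
      (e * f' * Complex.cot (f t) * Complex.sin (f t) ^ e) t := by
  refine ((hasDerivAt_zpow e _ (Or.inl h)).comp t hf.csin).congr_deriv ?_
  rw [zpow_sub_one₀ h, Complex.cot_eq_cos_div_sin]
  field_simp

theorem hasExtraCharge_excitedFactor (hq : IsExcitedCharge q p) {w : ℂ} (hw : Real.pi ≤ w.im) :
    HasExtraCharge q p 0 w fun x => excitedFactor (w, x) := by
  intro x hx
  have hV := mem_excitedDomain hw hx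
  have hd : DifferentiableAt ℂ (fun x => excitedFactor (w, x)) x :=
    (hasFDerivAt_param (isOpen_excitedDomain n m) (contDiffOn_excitedFactor 1) hV).differentiableAt
  refine ⟨hd, fun l => fderiv_single_eq_deriv hd l ?_⟩
  have e : (fun t => excitedFactor (w, Function.update x l t)) = fun t : ℂ =>
      Complex.sin ((t - w) / 2) ^ (Sum.elim (fun _ : Fin n => 1) (fun _ : Fin m => -2) l : ℤ)
        * ∏ k ∈ Finset.univ.erase l, Complex.sin ((x k - w) / 2)
          ^ (Sum.elim (fun _ : Fin n => 1) (fun _ : Fin m => -2) k : ℤ) := by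
    ext t
    simp only [excitedFactor]
    rw [← Finset.mul_prod_erase _ _ (Finset.mem_univ l)]
    congr 1
    · simp
    · refine Finset.prod_congr rfl fun k hk => ?_
      rw [Function.update_of_ne (Finset.ne_of_mem_erase hk)]
  rw [e]
  have hl : HasDerivAt (fun t => (t - w) / 2) (1 / 2) (x l) :=
    ((hasDerivAt_id' _).sub_const _).div_const _
  refine ((hasDerivAt_sin_zpow hl (hV.2 l) _).mul_const _).congr_deriv ?_
  have hc : ((q l * p : ℝ) : ℂ) = _ := congrArg (fun t : ℝ => (t : ℂ)) (hq l)
  push_cast at hc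
  simp only [excitedFactor]
  rw [hc, ← Finset.mul_prod_erase _ _ (Finset.mem_univ l)]
  push_cast
  ring

/-- The logarithmic derivative in w is the drift felt by the extra charge, so the terms of this
charge in the null vector and rotation identities are derivatives in w. -/
theorem hasDerivAt_excitedFactor (hq : IsExcitedCharge q p) {w : ℂ}
    (hV : (w, x) ∈ excitedDomain n m) : HasDerivAt (fun w => excitedFactor (w, x))
      (extendDrift q p 0 x w none * excitedFactor (w, x)) w := by
  have hl : ∀ l, HasDerivAt (fun t => (x l - t) / 2) (-1 / 2) w := fun l =>
    ((hasDerivAt_id' _).const_sub _).div_const _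
  have h1 := HasDerivAt.fun_finsetProd (u := Finset.univ) fun l _ =>
    hasDerivAt_sin_zpow (hl l) (hV.2 l) (Sum.elim (fun _ : Fin n => 1) (fun _ : Fin m => -2) l)
  refine h1.congr_deriv ?_
  unfold extendDrift
  rw [Fintype.sum_option, add_mul, add_mul, Finset.sum_mul]
  simp only [extend, Option.elim, sub_self, zero_div, cot_zero']
  simp only [Complex.ofReal_zero, zero_mul, mul_zero, zero_add, add_zero]
  refine Finset.sum_congr rfl fun l _ => ?_
  have hc : ((q l * p : ℝ) : ℂ) = _ := congrArg (fun t : ℝ => (t : ℂ)) (hq l)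
  push_cast at hc
  rw [excitedFactor, ← Finset.mul_prod_erase _ _ (Finset.mem_univ l), mul_comm (p : ℂ), hc,
    cot_neg_half, smul_eq_mul]
  ring

/-- A shift by 2π changes the sign of every sine: the exponents -2 do not notice it, and the n
simple factors give (-1)^n = 1. This is where the parity of n enters. -/
theorem excitedFactor_periodic (hn : Even n) (w : ℂ) :
    excitedFactor (w + 2 * Real.pi, x) = excitedFactor (w, x) := by
  have h : ∀ l, Complex.sin ((x l - (w + 2 * Real.pi)) / 2) = -Complex.sin ((x l - w) / 2) := by
    intro l
    rw [show (x l - (w + 2 * Real.pi)) / 2 = (x l - w) / 2 - Real.pi by ring, Complex.sin_sub_pi]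
  unfold excitedFactor
  simp only [h]
  rw [Fintype.prod_sum_type, Fintype.prod_sum_type]
  simp only [Sum.elim_inl, Sum.elim_inr, zpow_one]
  congr 1
  · rw [Finset.prod_neg, Finset.card_fin, hn.neg_one_pow, one_mul]
  · refine Finset.prod_congr rfl fun r _ => ?_
    rw [Even.neg_zpow (by decide)]

theorem cot_half_periodic (w y : ℂ) :
    Complex.cot ((w + 2 * Real.pi - y) / 2) = Complex.cot ((w - y) / 2) := by
  rw [show (w + 2 * Real.pi - y) / 2 = (w - y) / 2 + Real.pi by ring,
    Complex.cot_eq_cos_div_sin, Complex.cot_eq_cos_div_sin, Complex.sin_add_pi,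
    Complex.cos_add_pi, neg_div_neg_eq]

theorem integral_deriv_eq_zero_of_periodic {f f' : ℂ → ℂ} {U : Set ℂ} (hU : IsOpen U)
    (hf : ∀ w ∈ U, HasDerivAt f (f' w) w) (hA : ∀ s : ℝ, A + s ∈ U)
    (hper : f (A + 2 * Real.pi) = f A) : ∫ s in (0 : ℝ)..2 * Real.pi, f' (A + s) = 0 := by
  have hd : DifferentiableOn ℂ f U := fun w hw => (hf w hw).differentiableAt.differentiableWithinAt
  have hc : ContinuousOn f' U :=
    (hd.deriv hU).continuousOn.congr fun w hw => (hf w hw).deriv.symm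
  have h1 : ∀ s : ℝ, HasDerivAt (fun s : ℝ => f (A + s)) (f' (A + s)) s := fun s =>
    ((hf _ (hA s)).comp_const_add A (s : ℂ)).comp_ofReal
  rw [intervalIntegral.integral_eq_sub_of_hasDerivAt (fun s _ => h1 s)]
  · push_cast
    rw [hper]
    simp
  · exact (hc.comp_continuous (by fun_prop) hA).intervalIntegrable _ _

theorem isOpen_excitedSection (x : Fin n ⊕ Fin m → ℂ) :
    IsOpen {w : ℂ | (w, x) ∈ excitedDomain n m} :=
  (isOpen_excitedDomain n m).preimage (by fun_prop : Continuous fun w : ℂ => (w, x))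

theorem integral_deriv_excitedFactor (hq : IsExcitedCharge q p) (hn : Even n)
    (hA : Real.pi ≤ A.im) (hx : x ∈ configSpace n m) :
    ∫ s in (0 : ℝ)..2 * Real.pi,
      extendDrift q p 0 x (A + s) none * excitedFactor (A + s, x) = 0 :=
  integral_deriv_eq_zero_of_periodic (isOpen_excitedSection x)
    (fun _ hw => hasDerivAt_excitedFactor hq hw)
    (fun s => mem_excitedDomain (by simpa using hA) hx) (excitedFactor_periodic hn A)

/-- The integrand is the w-derivative of cot((w - x_i)/2) times the interactions of w, a periodic
function. It is the leftover of the extra charge in the null vector operator when that charge has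
weight 1. -/
theorem integral_deriv_cot_mul_excitedFactor (hq : IsExcitedCharge q p) (hn : Even n)
    (hA : Real.pi ≤ A.im) (hx : x ∈ configSpace n m) (i : Fin n ⊕ Fin m) :
    ∫ s in (0 : ℝ)..2 * Real.pi, (Complex.cot ((A + s - x i) / 2) * extendDrift q p 0 x (A + s) none
      - 1 / 2 * (1 + Complex.cot ((A + s - x i) / 2) ^ 2)) * excitedFactor (A + s, x) = 0 := by
  refine integral_deriv_eq_zero_of_periodic (A := A)
    (f := fun w => Complex.cot ((w - x i) / 2) * excitedFactor (w, x))
    (f' := fun w => (Complex.cot ((w - x i) / 2) * extendDrift q p 0 x w none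
      - 1 / 2 * (1 + Complex.cot ((w - x i) / 2) ^ 2)) * excitedFactor (w, x))
    (isOpen_excitedSection x) (fun w hw => ?_)
    (fun s => mem_excitedDomain (by simpa using hA) hx) ?_
  · have hs : Complex.sin ((w - x i) / 2) ≠ 0 := by
      rw [← neg_sub, neg_div, Complex.sin_neg]
      exact neg_ne_zero.2 (hw.2 i)
    have h1 := (hasDerivAt_cot_half hs).comp w ((hasDerivAt_id' w).sub_const (x i))
    refine (h1.mul (hasDerivAt_excitedFactor hq hw)).congr_deriv ?_
    simp only [Function.comp]
    ring
  · simp only [cot_half_periodic, excitedFactor_periodic hn]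

/-- The integral over the additional screening charge. -/
def excitedIntegral (A : ℂ) (x : Fin n ⊕ Fin m → ℂ) : ℂ :=
  ∫ s in (0 : ℝ)..2 * Real.pi, excitedFactor (A + s, x)

theorem contDiffOn_excitedIntegral (hA : Real.pi ≤ A.im) (k : ℕ) :
    ContDiffOn ℂ k (excitedIntegral (n := n) (m := m) A) (configSpace n m) :=
  (contDiffOn_segmentIntegral (isOpen_excitedDomain n m) Real.two_pi_pos.le k
    (contDiffOn_excitedFactor _)).mono fun _ hx => mem_segmentDomain hA hx _

theorem covDeriv_excitedIntegral (hA : Real.pi ≤ A.im) (l : Fin n ⊕ Fin m)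
    (hx : x ∈ configSpace n m) : covDeriv q l (excitedIntegral A) x
      = ∫ s in (0 : ℝ)..2 * Real.pi, paramCovDeriv q l excitedFactor (A + s, x) :=
  covDeriv_segmentIntegral hA Real.two_pi_pos.le (contDiffOn_excitedFactor 1) l hx

theorem covDeriv_covDeriv_excitedIntegral (hA : Real.pi ≤ A.im) (l : Fin n ⊕ Fin m)
    (hx : x ∈ configSpace n m) : covDeriv q l (covDeriv q l (excitedIntegral A)) x
      = ∫ s in (0 : ℝ)..2 * Real.pi,
        paramCovDeriv q l (paramCovDeriv q l excitedFactor) (A + s, x) := by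
  rw [covDeriv_congr (G := fun x => ∫ s in (0 : ℝ)..2 * Real.pi,
      paramCovDeriv q l excitedFactor (A + s, x)) (f := covDeriv q l (excitedIntegral A))
      (fun y hy => covDeriv_excitedIntegral hA l hy) hx]
  exact covDeriv_segmentIntegral hA Real.two_pi_pos.le
    (contDiffOn_paramCovDeriv le_rfl (contDiffOn_excitedFactor _) q l) l hx

theorem contDiffOn_cot_mul_excitedFactor (k : WithTop ℕ∞) (i l : Fin n ⊕ Fin m) :
    ContDiffOn ℂ k (fun z : ℂ × (Fin n ⊕ Fin m → ℂ) =>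
      Complex.cot ((z.2 i - z.2 l) / 2) * excitedFactor z) (excitedDomain n m) :=
  ((contDiffOn_cot_sub k i l).comp contDiffOn_snd fun _ hz => hz.1).mul
    (contDiffOn_excitedFactor k)

theorem covDeriv_cot_mul_excitedIntegral (hA : Real.pi ≤ A.im) (i l : Fin n ⊕ Fin m)
    (hx : x ∈ configSpace n m) :
    covDeriv q l (fun x => Complex.cot ((x i - x l) / 2) * excitedIntegral A x) x
      = ∫ s in (0 : ℝ)..2 * Real.pi, paramCovDeriv q l
        (fun z => Complex.cot ((z.2 i - z.2 l) / 2) * excitedFactor z) (A + s, x) := by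
  rw [← covDeriv_segmentIntegral hA Real.two_pi_pos.le
    (contDiffOn_cot_mul_excitedFactor 1 i l) l hx]
  congr 1
  ext x
  exact (intervalIntegral.integral_const_mul _ _).symm

theorem isExcitedCharge_uniform (hκ : 0 < κ) :
    IsExcitedCharge (uniformCharge n m κ) (2 * (chargeA κ + chargeB κ)) := by
  have := chargeA_mul_chargeB hκ
  rintro (i | r)
  · simp only [uniformCharge, Sum.elim_inl]
    push_cast
    linear_combination 2 * this
  · simp only [uniformCharge, Sum.elim_inr]
    push_cast
    linear_combination -4 * this

/-- Linearity: an identity that holds for each w up to a remainder d of integral zero passes to the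
integrals over w. -/
theorem linearCombination_integral {J R : Type*} {σ : Finset J} {τ : Finset R} {u v : ℝ}
    {a g d : ℝ → ℂ} {b : J → ℝ → ℂ} {c : R → ℝ → ℂ} {k₁ k₂ h : ℂ} {C : J → ℂ}
    (ha : IntervalIntegrable a volume u v) (hb : ∀ j, IntervalIntegrable (b j) volume u v)
    (hg : IntervalIntegrable g volume u v) (hc : ∀ r, IntervalIntegrable (c r) volume u v)
    (hd : ∀ s, k₁ * a s + ∑ j ∈ σ, C j * b j s + k₂ * g s - h * g s - ∑ r ∈ τ, c r s = -d s)
    (h0 : ∫ s in u..v, d s = 0) :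
    k₁ * (∫ s in u..v, a s) + ∑ j ∈ σ, C j * (∫ s in u..v, b j s) + k₂ * (∫ s in u..v, g s)
      - h * (∫ s in u..v, g s) = ∑ r ∈ τ, ∫ s in u..v, c r s := by
  have hb' := IntervalIntegrable.sum σ fun j _ => (hb j).const_mul (C j)
  have hc' := IntervalIntegrable.sum τ fun r _ => hc r
  have h1 : ∫ s in u..v, (k₁ * a s + ∑ j ∈ σ, C j * b j s + k₂ * g s - h * g s
      - ∑ r ∈ τ, c r s) = 0 := by
    simp only [hd]
    rw [intervalIntegral.integral_neg, h0, neg_zero]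
  simp only [Finset.sum_fn] at hb' hc'
  rw [intervalIntegral.integral_sub ((((ha.const_mul _).add hb').add (hg.const_mul _)).sub
      (hg.const_mul _)) hc',
    intervalIntegral.integral_sub (((ha.const_mul _).add hb').add (hg.const_mul _))
      (hg.const_mul _),
    intervalIntegral.integral_add ((ha.const_mul _).add hb') (hg.const_mul _),
    intervalIntegral.integral_add (ha.const_mul _) hb',
    intervalIntegral.integral_finsetSum fun j _ => (hb j).const_mul (C j),
    intervalIntegral.integral_finsetSum fun r _ => hc r] at h1
  simp only [intervalIntegral.integral_const_mul] at h1
  linear_combination h1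

theorem LiftedFamily.solvesNullVector_excited (F : LiftedFamily n m) (hκ : 0 < κ) (hn : Even n)
    (hA : Real.pi ≤ A.im) {ψ : (Fin n → ℝ) → ℂ}
    (hψ : ∀ θ ∈ chamber n, ψ θ = F.integral (uniformCharge n m κ) (excitedIntegral A) θ) :
    SolvesNullVector κ ((1 - ((n : ℝ) - 2 * m + κ / 2) ^ 2) / (2 * κ)) ψ := by
  refine F.solvesNullVector_of_total_derivative hψ (contDiffOn_excitedIntegral hA 3)
    (fun i r x => Complex.cot ((x (Sum.inl i) - x (Sum.inr r)) / 2) * excitedIntegral A x)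
    (fun i r => (contDiffOn_cot_sub _ _ _).mul
      (by simpa using contDiffOn_excitedIntegral hA 1)) fun i x hx => ?_
  have hx' := mem_segmentDomain hA hx (2 * Real.pi)
  have hint : ∀ {H : ℂ × (Fin n ⊕ Fin m → ℂ) → ℂ}, ContDiffOn ℂ 0 H (excitedDomain n m) →
      IntervalIntegrable (fun s : ℝ => H (A + s, x)) volume 0 (2 * Real.pi) := fun hH =>
    intervalIntegrable_segment Real.two_pi_pos.le hH.continuousOn hx'
  have i0 := hint (contDiffOn_excitedFactor 0)
  have i1 := fun l => hint (contDiffOn_paramCovDeriv (k := 0) le_rfl (contDiffOn_excitedFactor _)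
    (uniformCharge n m κ) l)
  have i2 := hint (contDiffOn_paramCovDeriv (k := 0) le_rfl (contDiffOn_paramCovDeriv le_rfl
    (contDiffOn_excitedFactor _) (uniformCharge n m κ) (Sum.inl i))
    (uniformCharge n m κ) (Sum.inl i))
  have i3 := fun r => hint (contDiffOn_paramCovDeriv (k := 0) le_rfl
    (contDiffOn_cot_mul_excitedFactor _ (Sum.inl i) (Sum.inr r)) (uniformCharge n m κ) (Sum.inr r))
  rw [covDeriv_covDeriv_excitedIntegral hA _ hx,
    Finset.sum_congr rfl fun r _ => covDeriv_cot_mul_excitedIntegral hA (Sum.inl i) (Sum.inr r) hx]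
  simp only [covDeriv_excitedIntegral hA _ hx]
  refine linearCombination_integral i2 (fun j => i1 (Sum.inl j)) i0 i3
    (fun s => ?_) (integral_deriv_cot_mul_excitedFactor (isExcitedCharge_uniform (m := m) hκ) hn hA
      hx (Sum.inl i))
  have hw : Real.pi ≤ (A + (s : ℂ)).im := by simpa using hA
  have key := (hasExtraCharge_excitedFactor (isExcitedCharge_uniform (n := n) (m := m) hκ)
    hw).null_vector_uniform hκ hw hx i
  have h1 : (κ : ℂ) * (chargeA κ : ℂ) ^ 2 = 2 := by exact_mod_cast kappa_mul_chargeA_sq hκ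
  have h2 : (chargeB κ : ℂ) = κ / 4 * chargeA κ - chargeA κ := by exact_mod_cast chargeB_eq hκ
  have hκ' : (κ : ℂ) ≠ 0 := by exact_mod_cast hκ.ne'
  have hh : (((1 - ((n : ℝ) - 2 * m + κ / 2) ^ 2) / (2 * κ) : ℝ) : ℂ)
      = (chargeA κ : ℂ) ^ 2 * (1 - ((n : ℂ) - 2 * m + κ / 2) ^ 2) / 4 := by
    rw [show (chargeA κ : ℂ) ^ 2 = 2 / κ by rw [eq_div_iff hκ']; linear_combination h1]
    push_cast
    field_simp
    ring
  rw [hh]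
  simp only [paramCovDeriv]
  -- The extra charge is κa/2: it shifts n - 2m to n - 2m + κ/2 in h, and its weight is κa²/2 = 1.
  have hp : ((2 * (chargeA κ + chargeB κ) : ℝ) : ℂ) = κ / 2 * chargeA κ := by
    push_cast
    rw [h2]
    ring
  rw [hp, h2] at key
  simp only [Complex.ofReal_zero] at key
  linear_combination key + excitedFactor (A + s, x) / 4
    * (1 + Complex.cot ((A + s - x (Sum.inl i)) / 2) ^ 2) * h1

theorem LiftedFamily.solvesRotation_excited (F : LiftedFamily n m) (hκ : 0 < κ) (hn : Even n)
    (hA : Real.pi ≤ A.im) {ψ : (Fin n → ℝ) → ℂ}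
    (hψ : ∀ θ ∈ chamber n, ψ θ = F.integral (uniformCharge n m κ) (excitedIntegral A) θ) :
    SolvesRotation 0 ψ := by
  refine F.solvesRotation_of_total_derivative hψ (by simpa using contDiffOn_excitedIntegral hA 1)
    fun x hx => ?_
  have hx' := mem_segmentDomain hA hx (2 * Real.pi)
  have i1 := fun l => intervalIntegrable_segment Real.two_pi_pos.le
    (contDiffOn_paramCovDeriv (k := 0) le_rfl (contDiffOn_excitedFactor _)
      (uniformCharge n m κ) l).continuousOn hx'
  rw [Finset.sum_congr rfl fun l _ => covDeriv_excitedIntegral hA l hx,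
    ← intervalIntegral.integral_finsetSum fun l _ => i1 l, Complex.ofReal_zero, zero_mul,
    ← neg_eq_zero, ← intervalIntegral.integral_neg,
    ← integral_deriv_excitedFactor (isExcitedCharge_uniform hκ) hn hA hx]
  refine intervalIntegral.integral_congr fun s _ => ?_
  have hw : Real.pi ≤ (A + (s : ℂ)).im := by simpa using hA
  have := (hasExtraCharge_excitedFactor (isExcitedCharge_uniform (n := n) (m := m) hκ)
    hw).sum_covDeriv hx
  simp only [paramCovDeriv]
  rw [this]
  push_cast
  ring

end excited

end RadialCoulomb
end

noncomputable section

namespace RadialCoulomb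

open MeasureTheory Filter Topology Set

/-! ### The lifted points -/

section lift

variable {n : ℕ} [NeZero n] {θ : Fin n → ℝ}

theorem natCast_pos_of_neZero (n : ℕ) [NeZero n] : (0 : ℤ) < n := by
  exact_mod_cast Nat.pos_of_ne_zero (NeZero.ne n)

theorem lift_add_mul (θ : Fin n → ℝ) (k j : ℤ) :
    lift θ (k + j * n) = lift θ k + 2 * Real.pi * j := by
  unfold lift
  rw [Int.add_mul_emod_self_right, Int.add_mul_ediv_right _ _ (natCast_pos_of_neZero n).ne']
  push_cast
  ring

theorem lift_natCast (θ : Fin n → ℝ) (i : Fin n) : lift θ (i : ℤ) = θ i := by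
  have h1 : ((i : ℕ) : ℤ) % n = i := Int.emod_eq_of_lt (by positivity) (by exact_mod_cast i.2)
  have h2 : ((i : ℕ) : ℤ) / n = 0 := Int.ediv_eq_zero_of_lt (by positivity) (by exact_mod_cast i.2)
  unfold lift
  rw [h1, h2]
  simp

theorem exists_fin_add_mul (n : ℕ) [NeZero n] (k : ℤ) : ∃ (i : Fin n) (j : ℤ), k = i + j * n := by
  have hn := natCast_pos_of_neZero n
  have h0 := Int.emod_nonneg k hn.ne'
  have h1 := Int.emod_lt_of_pos k hn
  refine ⟨⟨(k % n).toNat, by omega⟩, k / n, ?_⟩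
  have := Int.emod_add_mul_ediv k n
  simp only [Int.toNat_of_nonneg h0]
  linarith

theorem lift_strictMono (hθ : θ ∈ chamber n) : StrictMono (lift θ) := by
  refine strictMono_int_of_lt_succ fun k => ?_
  obtain ⟨i, j, rfl⟩ := exists_fin_add_mul n k
  by_cases hi : (i : ℕ) + 1 < n
  · have e : ((i : ℕ) : ℤ) + j * n + 1 = ((⟨i + 1, hi⟩ : Fin n) : ℕ) + j * n := by
      push_cast; ring
    rw [e, lift_add_mul, lift_add_mul, lift_natCast, lift_natCast]
    have : θ i < θ ⟨i + 1, hi⟩ := hθ.1 (Fin.lt_def.2 (by simp))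
    linarith
  -- The successor of the last point is the first point of the next period, and the condition θ_n <
  -- θ_1 + 2π orders them.
  · have hi' : (i : ℕ) + 1 = n := by omega
    have e : ((i : ℕ) : ℤ) + j * n + 1 = ((0 : Fin n) : ℕ) + (j + 1) * n := by
      have : ((i : ℕ) : ℤ) + 1 = n := by exact_mod_cast hi'
      have h0 : (((0 : Fin n) : ℕ) : ℤ) = 0 := by simp
      rw [h0]
      linarith
    rw [e, lift_add_mul, lift_add_mul, lift_natCast, lift_natCast]
    push_cast
    linarith [hθ.2 i 0]

theorem continuous_lift (k : ℤ) : Continuous fun θ : Fin n → ℝ => lift θ k := by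
  unfold lift
  fun_prop

theorem lift_sub_lt (hθ : θ ∈ chamber n) {l r : ℤ} (h : r < l + n) :
    lift θ r - lift θ l < 2 * Real.pi := by
  have h1 := lift_strictMono hθ h
  have h2 := lift_add_mul θ l 1
  rw [one_mul, Int.cast_one, mul_one] at h2
  linarith

theorem two_mul_lt_lift_sub (hθ : θ ∈ chamber n) {δ : ℝ}
    (hδ : ∀ k : ℤ, 2 * δ < lift θ (k + 1) - lift θ k) {l r : ℤ} (h : l < r) :
    2 * δ < lift θ r - lift θ l := by
  have h1 : lift θ (l + 1) ≤ lift θ r := (lift_strictMono hθ).monotone (by omega)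
  linarith [hδ l]

end lift

/-! ### Families of contours from determinations -/

/-- Translates between `expWeight`, which takes half the sum over ordered pairs, and the
correlation, a product over i < j. -/
theorem sum_sum_eq_two_mul_sum_Ioi {N : ℕ} (f : Fin N → Fin N → ℂ) (hs : ∀ i j, f i j = f j i)
    (h0 : ∀ i, f i i = 0) : ∑ i, ∑ j, f i j = 2 * ∑ i, ∑ j ∈ Finset.Ioi i, f i j := by
  have h1 := Finset.sum_sum_Ioi_add_eq_sum_sum_off_diag f
  have h2 : ∀ i, ∑ j, f i j = ∑ j ∈ {i}ᶜ, f j i := fun i => by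
    rw [← Finset.add_sum_erase _ _ (Finset.mem_univ i), h0, zero_add, Finset.compl_singleton]
    exact Finset.sum_congr rfl fun j _ => hs i j
  rw [Finset.sum_congr rfl fun i _ => h2 i, ← h1, Finset.mul_sum]
  refine Finset.sum_congr rfl fun i _ => ?_
  rw [Finset.mul_sum]
  refine Finset.sum_congr rfl fun j _ => ?_
  rw [hs j i]
  ring

theorem sin_half_sub_pos {n : ℕ} {θ : Fin n → ℝ} (hθ : θ ∈ chamber n) {i j : Fin n} (h : i < j) :
    0 < Real.sin ((θ j - θ i) / 2) := by
  have h1 := hθ.1 h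
  have h2 := hθ.2 j i
  exact Real.sin_pos_of_pos_of_lt_pi (by linarith) (by linarith)

theorem sin_half_sub_ne_zero {n : ℕ} {θ : Fin n → ℝ} (hθ : θ ∈ chamber n) {i j : Fin n}
    (h : i ≠ j) : Real.sin ((θ j - θ i) / 2) ≠ 0 := by
  rcases lt_or_gt_of_ne h with h | h
  · exact (sin_half_sub_pos hθ h).ne'
  · rw [← neg_sub, neg_div, Real.sin_neg]
    exact neg_ne_zero.2 (sin_half_sub_pos hθ h).ne'

namespace Determination

variable {n m : ℕ} [NeZero n] {left right : Fin m → ℤ} (D : Determination (n := n) left right)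

/-- The logarithms of all `sin((x l - x k)/2)` up to sign. -/
def log : Fin n ⊕ Fin m → Fin n ⊕ Fin m → (Fin n → ℝ) → (Fin m → ℝ) → ℂ
  -- `Real.log` is the logarithm of the absolute value and is 0 at 0, so this entry is symmetric and
  -- vanishes on the diagonal.
  | Sum.inl i, Sum.inl j => fun θ _ => (Real.log (Real.sin ((θ i - θ j) / 2)) : ℂ)
  | Sum.inl i, Sum.inr r => fun θ t => D.logPoint i r θ (t r)
  | Sum.inr r, Sum.inl i => fun θ t => D.logPoint i r θ (t r)
  | Sum.inr r, Sum.inr s => fun θ t =>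
      if r < s then D.logPair r s θ (t r) (t s)
      else if s < r then D.logPair s r θ (t s) (t r) else 0

theorem log_self (l : Fin n ⊕ Fin m) (θ : Fin n → ℝ) (t : Fin m → ℝ) : D.log l l θ t = 0 := by
  rcases l with i | r <;> simp [log]

theorem log_comm (l k : Fin n ⊕ Fin m) (θ : Fin n → ℝ) (t : Fin m → ℝ) :
    D.log l k θ t = D.log k l θ t := by
  rcases l with i | r <;> rcases k with j | s <;> simp only [log]
  · rw [← neg_sub, neg_div, Real.sin_neg, Real.log_neg_eq_log]
  · rcases lt_trichotomy r s with h | rfl | h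
    · rw [if_pos h, if_neg h.not_gt, if_pos h]
    · rfl
    · rw [if_neg h.not_gt, if_pos h, if_pos h]

theorem continuousOn_log (l k : Fin n ⊕ Fin m) :
    ContinuousOn (fun z : (Fin n → ℝ) × (Fin m → ℝ) => D.log l k z.1 z.2)
      (chamber n ×ˢ cube m) := by
  have hpoint : ∀ i r, ContinuousOn
      (fun z : (Fin n → ℝ) × (Fin m → ℝ) => D.logPoint i r z.1 (z.2 r)) (chamber n ×ˢ cube m) :=
    fun i r => (D.logPoint_continuous i r).comp
      (f := fun z : (Fin n → ℝ) × (Fin m → ℝ) => (z.1, z.2 r)) (by fun_prop)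
      fun z hz => ⟨hz.1, mem_cube.1 hz.2 r⟩
  have hpair : ∀ r s, r < s → ContinuousOn
      (fun z : (Fin n → ℝ) × (Fin m → ℝ) => D.logPair r s z.1 (z.2 r) (z.2 s))
      (chamber n ×ˢ cube m) := fun r s h => (D.logPair_continuous r s h).comp
      (f := fun z : (Fin n → ℝ) × (Fin m → ℝ) => (z.1, z.2 r, z.2 s)) (by fun_prop)
      fun z hz => ⟨hz.1, mem_cube.1 hz.2 r, mem_cube.1 hz.2 s⟩
  rcases l with i | r <;> rcases k with j | s <;> simp only [log]
  · rcases eq_or_ne i j with rfl | h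
    · simpa using continuousOn_const
    · refine Complex.continuous_ofReal.comp_continuousOn (ContinuousOn.log ?_ fun z hz =>
        sin_half_sub_ne_zero hz.1 h.symm)
      fun_prop
  · exact hpoint i s
  · exact hpoint j r
  · rcases lt_trichotomy r s with h | rfl | h
    · simpa only [if_pos h] using hpair r s h
    · simpa using continuousOn_const
    · simpa only [if_neg h.not_gt, if_pos h] using hpair s r h

theorem exp_log {l k : Fin n ⊕ Fin m} (hlk : l ≠ k) {θ : Fin n → ℝ} (hθ : θ ∈ chamber n)
    {t : Fin m → ℝ} (ht : t ∈ cube m) : Complex.exp (2 * D.log l k θ t) =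
    Complex.sin (((Sum.elim (fun i => (θ i : ℂ)) (fun r => D.contour r θ (t r)) :
        Fin n ⊕ Fin m → ℂ) l
      - (Sum.elim (fun i => (θ i : ℂ)) (fun r => D.contour r θ (t r)) :
        Fin n ⊕ Fin m → ℂ) k) / 2) ^ 2 := by
  have hsq : ∀ a b : ℂ, Complex.sin ((a - b) / 2) ^ 2 = Complex.sin ((b - a) / 2) ^ 2 :=
    fun a b => by rw [← neg_sub, neg_div, Complex.sin_neg, neg_sq]
  have h2 : ∀ a : ℂ, Complex.exp (2 * a) = Complex.exp a ^ 2 := fun a => by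
    rw [two_mul, Complex.exp_add, pow_two]
  rw [mem_cube] at ht
  rcases l with i | r <;> rcases k with j | s <;>
    simp only [log, Sum.elim_inl, Sum.elim_inr, h2]
  · have hs := sin_half_sub_ne_zero hθ (i := j) (j := i) fun e => hlk (by rw [e])
    rw [← Complex.ofReal_exp, ← Complex.ofReal_pow, Real.exp_log_eq_abs hs, sq_abs]
    push_cast
    rfl
  · rw [D.exp_logPoint i s θ hθ _ (ht s), hsq]
    rfl
  · rw [D.exp_logPoint j r θ hθ _ (ht r)]
    rfl
  · have hrs : r ≠ s := fun e => hlk (by rw [e])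
    rcases lt_or_gt_of_ne hrs with h | h
    · rw [if_pos h, D.exp_logPair r s h θ hθ _ (ht r) _ (ht s), hsq]
      rfl
    · rw [if_neg h.not_gt, if_pos h, D.exp_logPair s r h θ hθ _ (ht s) _ (ht r)]
      rfl

/-- With all other parameters fixed, each branch is a continuous logarithm of a function of a single
commutator path, hence returns to its initial value. -/
theorem log_closed (l k : Fin n ⊕ Fin m) (r : Fin m) {θ : Fin n → ℝ} (hθ : θ ∈ chamber n)
    {t : Fin m → ℝ} (ht : t ∈ cube m) :
    D.log l k θ (Function.update t r 8) = D.log l k θ (Function.update t r 0) := by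
  have hγ : ∀ r, IsCommutatorPath (D.contour r θ) := fun r => isCommutatorPath_pochhammer _ _ _
  rw [mem_cube] at ht
  have hpoint : ∀ i s, D.logPoint i s θ (Function.update t r 8 s)
      = D.logPoint i s θ (Function.update t r 0 s) := by
    intro i s
    rcases eq_or_ne s r with rfl | h
    · rw [Function.update_self, Function.update_self]
      refine ((hγ s).comp fun z => Complex.sin ((z - θ i) / 2)).log_closed
        (f := fun u => D.logPoint i s θ u) ?_ fun u hu => D.exp_logPoint i s θ hθ u hu
      exact (D.logPoint_continuous i s).comp (f := fun u : ℝ => (θ, u)) (by fun_prop)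
        fun u hu => ⟨hθ, hu⟩
    · rw [Function.update_of_ne h, Function.update_of_ne h]
  have hpair : ∀ p s, p < s →
      D.logPair p s θ (Function.update t r 8 p) (Function.update t r 8 s)
      = D.logPair p s θ (Function.update t r 0 p) (Function.update t r 0 s) := by
    intro p s hps
    rcases eq_or_ne p r with rfl | h
    · rw [Function.update_self, Function.update_self, Function.update_of_ne hps.ne',
        Function.update_of_ne hps.ne']
      refine ((hγ p).comp fun z => Complex.sin ((D.contour s θ (t s) - z) / 2)).log_closed
        (f := fun u => D.logPair p s θ u (t s)) ?_
        fun u hu => D.exp_logPair p s hps θ hθ u hu _ (ht s)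
      exact (D.logPair_continuous p s hps).comp (f := fun u : ℝ => (θ, u, t s)) (by fun_prop)
        fun u hu => ⟨hθ, hu, ht s⟩
    · rw [Function.update_of_ne h, Function.update_of_ne h]
      rcases eq_or_ne s r with rfl | h'
      · rw [Function.update_self, Function.update_self]
        refine ((hγ s).comp fun z => Complex.sin ((z - D.contour p θ (t p)) / 2)).log_closed
          (f := fun u => D.logPair p s θ (t p) u) ?_
          fun u hu => D.exp_logPair p s hps θ hθ _ (ht p) u hu
        exact (D.logPair_continuous p s hps).comp (f := fun u : ℝ => (θ, t p, u)) (by fun_prop)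
          fun u hu => ⟨hθ, ht p, hu⟩
      · rw [Function.update_of_ne h', Function.update_of_ne h']
  rcases l with i | p <;> rcases k with j | s <;> simp only [log]
  · exact hpoint i s
  · exact hpoint j p
  · rcases lt_trichotomy p s with h | rfl | h
    · simpa only [if_pos h] using hpair p s h
    · simp
    · simpa only [if_neg h.not_gt, if_pos h] using hpair s p h

/-- Links that are shorter than a full turn. -/
def ShortLinks (n : ℕ) (left right : Fin m → ℤ) : Prop :=
  ∀ r, left r < right r ∧ right r < left r + n

theorem contour_onContour (h : ShortLinks n left right) (r : Fin m) {θ : Fin n → ℝ}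
    (hθ : θ ∈ chamber n) {t : ℝ} (ht : t ∈ Set.Icc (0 : ℝ) 8) :
    OnContour (lift θ (left r)) (lift θ (right r)) (D.δ θ) (D.contour r θ t) :=
  onContour_pochhammer (D.δ_pos θ hθ) (two_mul_lt_lift_sub hθ (D.δ_lt θ hθ) (h r).1) ht

/-- The family of contours of a determination. -/
def toLiftedFamily (h : ShortLinks n left right) : LiftedFamily n m where
  γ := D.contour
  S := breakPoints
  S_countable := breakPoints_finite.countable
  bound := fun _ => 2 * Real.pi * (2 * Real.pi)
  bound_continuous := continuousOn_const
  γ_continuous := fun r => by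
    rw [continuousOn_iff_continuous_domRestrict]
    refine continuous_pochhammer (Z := ↥(chamber n ×ˢ Set.Icc (0 : ℝ) 8))
      (p := fun z => lift z.1.1 (left r)) (q := fun z => lift z.1.1 (right r))
      (δ := fun z => D.δ z.1.1) (t := fun z => z.1.2)
      ((continuous_lift _).comp (by fun_prop)) ((continuous_lift _).comp (by fun_prop)) ?_
      (by fun_prop) fun z => lift_strictMono z.2.1 (h r).1
    exact D.δ_continuous.comp_continuous (by fun_prop) fun z => z.2.1
  γ_differentiable := fun r θ hθ t ht => (hasDerivAt_pochhammer _ _ _ ht).differentiableAt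
  deriv_continuous := fun r t ht => by
    have e : (fun θ => deriv (D.contour r θ) t) = fun θ =>
        pochhammerDeriv (lift θ (left r)) (lift θ (right r)) (D.δ θ) t :=
      funext fun θ => (hasDerivAt_pochhammer _ _ _ ht).deriv
    rw [e, continuousOn_iff_continuous_domRestrict]
    exact continuous_pochhammerDeriv (Z := ↥(chamber n)) (p := fun z => lift z.1 (left r))
      (q := fun z => lift z.1 (right r)) (δ := fun z => D.δ z.1)
      ((continuous_lift _).comp (by fun_prop)) ((continuous_lift _).comp (by fun_prop))
      (D.δ_continuous.comp_continuous (by fun_prop) fun z => z.2)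
      (fun z => lift_strictMono z.2 (h r).1) t
  deriv_le := fun r θ hθ t ht => by
    have e : deriv (D.contour r θ) t
        = pochhammerDeriv (lift θ (left r)) (lift θ (right r)) (D.δ θ) t :=
      (hasDerivAt_pochhammer _ _ _ ht).deriv
    rw [e]
    refine (norm_pochhammerDeriv_le (lift_strictMono hθ (h r).1) _ _).trans ?_
    exact mul_le_mul_of_nonneg_left (lift_sub_lt hθ (h r).2).le Real.two_pi_pos.le
  γ_closed := fun r θ _ => (isCommutatorPath_pochhammer _ _ _).closed
  L := D.log
  L_continuous := D.continuousOn_log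
  L_self := D.log_self
  exp_L := fun _ _ hlk _ hθ _ ht => D.exp_log hlk hθ ht
  L_closed := fun l k r _ hθ _ ht => D.log_closed l k r hθ ht
  γ_im_lt := fun r θ hθ t ht => (D.contour_onContour h r hθ ht).im_lt (D.δ_pos θ hθ)
    (two_mul_lt_lift_sub hθ (D.δ_lt θ hθ) (h r).1) (lift_sub_lt hθ (h r).2)

/-- On the chamber the sines between points i < j are positive, so their real powers are
exponentials of real logarithms and the whole product becomes a single exponential. -/
theorem correlation_eq_expWeight (σ : Fin n → ℝ) (τ : ℝ) {θ : Fin n → ℝ} (hθ : θ ∈ chamber n)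
    (t : Fin m → ℝ) : D.correlation σ τ θ t
      = expWeight (Sum.elim σ fun _ => τ) (fun l k => D.log l k θ t) := by
  have h1 : ∀ i, ∀ j ∈ Finset.Ioi i, ((Real.sin ((θ j - θ i) / 2) ^ (σ i * σ j) : ℝ) : ℂ)
      = Complex.exp (((σ i * σ j : ℝ) : ℂ) * D.log (Sum.inl i) (Sum.inl j) θ t) := by
    intro i j hij
    rw [D.log_comm, log, Real.rpow_def_of_pos (sin_half_sub_pos hθ (Finset.mem_Ioi.1 hij)),
      Complex.ofReal_exp, Complex.ofReal_mul, mul_comm]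
  have h2 : ∀ r, ∀ s ∈ Finset.Ioi r,
      Complex.exp (((τ * τ : ℝ) : ℂ) * D.logPair r s θ (t r) (t s))
      = Complex.exp (((τ * τ : ℝ) : ℂ) * D.log (Sum.inr r) (Sum.inr s) θ t) := by
    intro r s hrs
    simp only [log, if_pos (Finset.mem_Ioi.1 hrs)]
  have e1 := sum_sum_eq_two_mul_sum_Ioi
    (fun i j => ((σ i * σ j : ℝ) : ℂ) * D.log (Sum.inl i) (Sum.inl j) θ t)
    (fun i j => by rw [D.log_comm, mul_comm (σ i)]) fun i => by rw [D.log_self, mul_zero]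
  have e2 := sum_sum_eq_two_mul_sum_Ioi
    (fun r s => ((τ * τ : ℝ) : ℂ) * D.log (Sum.inr r) (Sum.inr s) θ t)
    (fun r s => by rw [D.log_comm]) fun r => by rw [D.log_self, mul_zero]
  have e3 : ∑ r, ∑ i, ((τ * σ i : ℝ) : ℂ) * D.log (Sum.inr r) (Sum.inl i) θ t
      = ∑ i, ∑ r, ((τ * σ i : ℝ) : ℂ) * D.logPoint i r θ (t r) := Finset.sum_comm
  have e4 : ∑ i, ∑ r, ((σ i * τ : ℝ) : ℂ) * D.log (Sum.inl i) (Sum.inr r) θ t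
      = ∑ i, ∑ r, ((τ * σ i : ℝ) : ℂ) * D.logPoint i r θ (t r) := by
    simp only [log, mul_comm τ]
  unfold correlation expWeight
  rw [Finset.prod_congr rfl fun i _ => Finset.prod_congr rfl (h1 i),
    Finset.prod_congr rfl fun r _ => Finset.prod_congr rfl (h2 r)]
  simp only [← Complex.exp_sum, ← Complex.exp_add]
  congr 1
  simp only [Fintype.sum_sum_type, Sum.elim_inl, Sum.elim_inr, Finset.sum_add_distrib]
  rw [e1, e2, e3, e4]
  ring

theorem integral_eq (h : ShortLinks n left right) (σ : Fin n → ℝ) (τ : ℝ)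
    {g : (Fin n → ℝ) → (Fin m → ℂ) → ℂ} {G : (Fin n ⊕ Fin m → ℂ) → ℂ}
    (hg : ∀ θ ζ, g θ ζ = G (Sum.elim (fun i => (θ i : ℂ)) ζ)) {θ : Fin n → ℝ}
    (hθ : θ ∈ chamber n) :
    D.integral σ τ g θ = (D.toLiftedFamily h).integral (Sum.elim σ fun _ => τ) G θ := by
  refine setIntegral_congr_fun (measurableSet_cube m) fun t _ => ?_
  simp only [hg, D.correlation_eq_expWeight σ τ hθ]
  rfl

end Determination

end RadialCoulomb
end

noncomputable section

namespace RadialCoulomb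

open Filter Topology Set

/-! ### Disjointness of the contours of a link pattern -/

/-- Links with distinct endpoints that do not cross each other or their translates. -/
structure LinkSystem {m : ℕ} (n : ℕ) (left right : Fin m → ℤ) : Prop where
  left_lt_right : ∀ r, left r < right r
  left_distinct : ∀ r s, r ≠ s → ¬ left r ≡ left s [ZMOD n]
  right_distinct : ∀ r s, r ≠ s → ¬ right r ≡ right s [ZMOD n]
  left_right_distinct : ∀ r s, ¬ left r ≡ right s [ZMOD n]
  links_disjoint : ∀ r s, ∀ k : ℤ,
    ¬ (left r < left s + k * n ∧ left s + k * n < right r ∧ right r < right s + k * n)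

theorem RadialLinkPattern.linkSystem {n m : ℕ} (α : RadialLinkPattern n m) :
    LinkSystem n α.left α.right :=
  ⟨α.left_lt_right, α.left_distinct, α.right_distinct, α.left_right_distinct, α.links_disjoint⟩

namespace LinkSystem

variable {n m : ℕ} {left right : Fin m → ℤ}

/-- Needed for the chordal-type solutions, where a link is dropped. Non-crossing of links survives
this, whereas the condition on rays may not: an end of the dropped link can lie under another link.
-/
theorem comp {l : ℕ} (h : LinkSystem n left right) {f : Fin l → Fin m}
    (hf : Function.Injective f) : LinkSystem n (left ∘ f) (right ∘ f) :=
  ⟨fun _ => h.left_lt_right _, fun _ _ hrs => h.left_distinct _ _ (hf.ne hrs),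
    fun _ _ hrs => h.right_distinct _ _ (hf.ne hrs), fun _ _ => h.left_right_distinct _ _,
    fun _ _ => h.links_disjoint _ _⟩

theorem modEq_of_eq_add_mul {a b k : ℤ} (h : a = b + k * n) : a ≡ b [ZMOD n] :=
  (Int.modEq_iff_dvd.2 ⟨k, by rw [h]; ring⟩ : b ≡ a [ZMOD n]).symm

/-- A link longer than a full turn crosses its own translate by one period, and a link of exactly a
full turn would join a boundary point to itself. -/
theorem shortLinks [NeZero n] (h : LinkSystem n left right) :
    Determination.ShortLinks n left right := by
  refine fun r => ⟨h.left_lt_right r, lt_of_not_ge fun hr => ?_⟩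
  have hn := natCast_pos_of_neZero n
  rcases hr.eq_or_lt with e | hlt
  · exact h.left_right_distinct r r (modEq_of_eq_add_mul (k := 1) (a := right r)
      (by rw [← e, one_mul])).symm
  · exact h.links_disjoint r r 1 (by omega)

end LinkSystem

section disjoint

variable {n : ℕ} [NeZero n] {θ : Fin n → ℝ} {δ : ℝ}

theorem two_mul_lt_abs_lift_sub (hθ : θ ∈ chamber n)
    (hgap : ∀ k : ℤ, 2 * δ < lift θ (k + 1) - lift θ k) {k l : ℤ} (h : k ≠ l) :
    2 * δ < |lift θ k - lift θ l| := by
  rcases lt_or_gt_of_ne h with h | h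
  · rw [abs_sub_comm]
    exact (two_mul_lt_lift_sub hθ hgap h).trans_le (le_abs_self _)
  · exact (two_mul_lt_lift_sub hθ hgap h).trans_le (le_abs_self _)

theorem OnContour.ne_lift (hθ : θ ∈ chamber n) (hδ : 0 < δ)
    (hgap : ∀ k : ℤ, 2 * δ < lift θ (k + 1) - lift θ k) {l r : ℤ} {z : ℂ}
    (hz : OnContour (lift θ l) (lift θ r) δ z) (k : ℤ) : z ≠ lift θ k := by
  rintro rfl
  have key : ∀ l : ℤ, (lift θ k - lift θ l) ^ 2 + 0 ^ 2 ≠ δ ^ 2 := by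
    intro l hl
    rcases eq_or_ne k l with rfl | hkl
    · nlinarith
    · have h1 := two_mul_lt_abs_lift_sub hθ hgap hkl
      have h2 := sq_abs (lift θ k - lift θ l)
      nlinarith
  rcases hz with h | h | ⟨h, -⟩
  · exact key l h
  · exact key r h
  · exact lt_irrefl _ h

/-- Each contour consists of two circles and a semicircle, so nine pairs of pieces are checked. Only
the two semicircles use non-crossing, which says that the segments are disjoint or nested. -/
theorem OnContour.disjoint (hθ : θ ∈ chamber n) (hδ : 0 < δ)
    (hgap : ∀ k : ℤ, 2 * δ < lift θ (k + 1) - lift θ k) {l r l' r' : ℤ} {z : ℂ}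
    (hlr : l < r) (hlr' : l' < r') (hll : l ≠ l') (hlr₁ : l ≠ r') (hrl : r ≠ l') (hrr : r ≠ r')
    (hc : ¬ (l < l' ∧ l' < r ∧ r < r')) (hc' : ¬ (l' < l ∧ l < r' ∧ r' < r))
    (hz : OnContour (lift θ l) (lift θ r) δ z) (hz' : OnContour (lift θ l') (lift θ r') δ z) :
    False := by
  have d : ∀ {k j : ℤ}, k ≠ j → 2 * δ < |lift θ k - lift θ j| := two_mul_lt_abs_lift_sub hθ hgap
  have mono := lift_strictMono hθ
  rcases hz with h | h | ⟨hy, h⟩ <;> rcases hz' with h' | h' | ⟨hy', h'⟩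
  · exact circles_disjoint hδ (d hll) h h'
  · exact circles_disjoint hδ (d hlr₁) h h'
  · exact circle_semicircle_disjoint hδ (d hll) (d hlr₁) h h'
  · exact circles_disjoint hδ (d hrl) h h'
  · exact circles_disjoint hδ (d hrr) h h'
  · exact circle_semicircle_disjoint hδ (d hrl) (d hrr) h h'
  · exact circle_semicircle_disjoint hδ (d hll.symm) (d hrl.symm) h' h
  · exact circle_semicircle_disjoint hδ (d hlr₁.symm) (d hrr.symm) h' h
  · refine semicircles_disjoint (mono hlr) (mono hlr') hy ?_ h h'
    simp only [mono.le_iff_le, mono.lt_iff_lt]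
    omega

theorem OnContour.add_period {l r k : ℤ} {z : ℂ} (hz : OnContour (lift θ l) (lift θ r) δ z) :
    OnContour (lift θ (l + k * n)) (lift θ (r + k * n)) δ (z + 2 * Real.pi * k) := by
  have hre : (z + 2 * Real.pi * k).re = z.re + 2 * Real.pi * k := by simp
  have him : (z + 2 * Real.pi * k).im = z.im := by simp
  unfold OnContour at *
  simpa only [hre, him, lift_add_mul, add_sub_add_right_eq_sub] using hz

theorem sin_half_sub_eq_zero_iff {z w : ℂ} :
    Complex.sin ((z - w) / 2) = 0 ↔ ∃ k : ℤ, z = w + 2 * Real.pi * k := by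
  rw [Complex.sin_eq_zero_iff]
  refine exists_congr fun k => ⟨fun h => ?_, fun h => ?_⟩
  · linear_combination 2 * h
  · rw [h]; ring

theorem OnContour.sin_half_sub_point_ne_zero (hθ : θ ∈ chamber n) (hδ : 0 < δ)
    (hgap : ∀ k : ℤ, 2 * δ < lift θ (k + 1) - lift θ k) {l r : ℤ} {z : ℂ}
    (hz : OnContour (lift θ l) (lift θ r) δ z) (i : Fin n) :
    Complex.sin ((z - θ i) / 2) ≠ 0 := by
  rw [Ne, sin_half_sub_eq_zero_iff]
  rintro ⟨k, hk⟩
  refine hz.ne_lift hθ hδ hgap (i + k * n) ?_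
  rw [hk, lift_add_mul, lift_natCast]
  push_cast
  rfl

theorem OnContour.sin_half_sub_ne_zero {m : ℕ} {left right : Fin m → ℤ}
    (hL : LinkSystem n left right) (hθ : θ ∈ chamber n) (hδ : 0 < δ)
    (hgap : ∀ k : ℤ, 2 * δ < lift θ (k + 1) - lift θ k) {r s : Fin m} (hrs : r ≠ s) {z w : ℂ}
    (hz : OnContour (lift θ (left r)) (lift θ (right r)) δ z)
    (hw : OnContour (lift θ (left s)) (lift θ (right s)) δ w) :
    Complex.sin ((w - z) / 2) ≠ 0 := by
  rw [Ne, sin_half_sub_eq_zero_iff]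
  rintro ⟨k, rfl⟩
  have h1 := hL.left_lt_right r
  have h2 := hL.left_lt_right s
  have h3 := hL.links_disjoint s r k
  -- Link s may cross the translate of link r by k in either order; the second order is read off
  -- after translating back by -k.
  have h4 := hL.links_disjoint r s (-k)
  have hneg : -k * (n : ℤ) = -(k * n) := neg_mul _ _
  rw [hneg] at h4
  refine OnContour.disjoint hθ hδ hgap h2 (add_lt_add_left h1 (k * n)) ?_ ?_ ?_ ?_ h3 ?_ hw
    hz.add_period
  · exact fun h => hL.left_distinct s r hrs.symm (LinkSystem.modEq_of_eq_add_mul h)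
  · exact fun h => hL.left_right_distinct s r (LinkSystem.modEq_of_eq_add_mul h)
  · exact fun h => hL.left_right_distinct r s (LinkSystem.modEq_of_eq_add_mul h).symm
  · exact fun h => hL.right_distinct s r hrs.symm (LinkSystem.modEq_of_eq_add_mul h)
  · omega

end disjoint

/-! ### The radius of the contours -/

/-- A quarter of the smallest gap between neighbouring points. -/
def quarterGap {n : ℕ} [NeZero n] (θ : Fin n → ℝ) : ℝ :=
  (Finset.univ.inf' Finset.univ_nonempty
    fun i : Fin n => lift θ ((i : ℤ) + 1) - lift θ (i : ℤ)) / 4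

section quarterGap

variable {n : ℕ} [NeZero n] {θ : Fin n → ℝ}

theorem continuous_quarterGap : Continuous (quarterGap (n := n)) :=
  (Continuous.finset_inf'_apply _ fun _ _ =>
    (continuous_lift _).sub (continuous_lift _)).div_const 4

theorem quarterGap_pos (hθ : θ ∈ chamber n) : 0 < quarterGap θ := by
  refine div_pos ?_ four_pos
  rw [Finset.lt_inf'_iff]
  exact fun i _ => sub_pos.2 (lift_strictMono hθ (lt_add_one _))

theorem two_mul_quarterGap_lt (hθ : θ ∈ chamber n) (k : ℤ) :
    2 * quarterGap θ < lift θ (k + 1) - lift θ k := by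
  have h0 := quarterGap_pos hθ
  obtain ⟨i, j, rfl⟩ := exists_fin_add_mul n k
  have h1 : 4 * quarterGap θ ≤ lift θ ((i : ℤ) + 1) - lift θ (i : ℤ) := by
    have := Finset.inf'_le (fun i : Fin n => lift θ ((i : ℤ) + 1) - lift θ (i : ℤ))
      (Finset.mem_univ i)
    unfold quarterGap
    linarith
  have e : (i : ℤ) + j * n + 1 = (i + 1) + j * n := by ring
  rw [e, lift_add_mul, lift_add_mul]
  linarith

end quarterGap

/-! ### Branches of logarithms -/

/-- Convexity makes the domain of the logarithms simply connected, so branches exist on the whole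
chamber at once. -/
theorem convex_chamber (n : ℕ) : Convex ℝ (chamber n) := by
  intro x hx y hy a b ha hb hab
  have key : ∀ {u v u' v' : ℝ}, u < v → u' < v' → a * u + b * u' < a * v + b * v' := by
    intro u v u' v' h h'
    rcases ha.eq_or_lt with rfl | ha'
    · have : b = 1 := by linarith
      subst this
      linarith
    · have := mul_lt_mul_of_pos_left h ha'
      have := mul_le_mul_of_nonneg_left h'.le hb
      linarith
  refine ⟨fun i j hij => ?_, fun i j => ?_⟩
  · simpa using key (hx.1 hij) (hy.1 hij)
  · have := key (hx.2 i j) (hy.2 i j)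
    simp only [Pi.add_apply, Pi.smul_apply, smul_eq_mul]
    linear_combination this + 2 * Real.pi * hab

theorem exists_continuousOn_log {E : Type*} [NormedAddCommGroup E] [NormedSpace ℝ E] {U : Set E}
    (hU : Convex ℝ U) (hUo : IsOpen U) {g : E → ℂ} (hg : ContinuousOn g U)
    (h0 : ∀ x ∈ U, g x ≠ 0) : ∃ f : E → ℂ, ContinuousOn f U ∧ ∀ x ∈ U, Complex.exp (f x) = g x := by
  rcases U.eq_empty_or_nonempty with rfl | hne
  · exact ⟨0, continuousOn_empty _, fun x hx => hx.elim⟩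
  have := hU.contractibleSpace hne
  have hs : IsSimplyConnected U := SimplyConnectedSpace.ofContractible U
  obtain ⟨f, hf, he⟩ := Complex.exists_continuousOn_eqOn_exp_comp hs hUo hg fun ⟨x, hx, e⟩ =>
    h0 x hx e
  exact ⟨f, hf, he⟩

/-- Extending the contour parameter by constants outside [0,8] gives a domain, chamber times a real
vector space, that is both open and convex, as the construction of logarithms needs. -/
theorem continuousOn_linkContour_projIcc {n : ℕ} [NeZero n] {Z : Type*} [TopologicalSpace Z]
    {U : Set Z} {l r : ℤ} (hlr : l < r) {x : Z → Fin n → ℝ} {t : Z → ℝ} (hx : Continuous x)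
    (ht : Continuous t) (hU : ∀ z ∈ U, x z ∈ chamber n) : ContinuousOn
      (fun z => linkContour l r (quarterGap (x z)) (x z) (projIcc 0 8 (by norm_num) (t z))) U := by
  rw [continuousOn_iff_continuous_domRestrict]
  have hx' : Continuous fun z : U => x z := hx.comp continuous_subtype_val
  have ht' : Continuous fun z : U => t z := ht.comp continuous_subtype_val
  exact continuous_pochhammer (p := fun z : U => lift (x z) l) (q := fun z : U => lift (x z) r)
    ((continuous_lift l).comp hx') ((continuous_lift r).comp hx') (continuous_quarterGap.comp hx')
    (continuous_subtype_val.comp (continuous_projIcc.comp ht'))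
    fun z => lift_strictMono (hU z z.2) hlr

theorem LinkSystem.nonempty_determination {n m : ℕ} [NeZero n] {left right : Fin m → ℤ}
    (h : LinkSystem n left right) : Nonempty (Determination (n := n) left right) := by
  have h08 : (0 : ℝ) ≤ 8 := by norm_num
  have hon : ∀ r, ∀ θ ∈ chamber n, ∀ t ∈ Icc (0 : ℝ) 8,
      OnContour (lift θ (left r)) (lift θ (right r)) (quarterGap θ)
        (linkContour (left r) (right r) (quarterGap θ) θ t) := fun r θ hθ t ht =>
    onContour_pochhammer (quarterGap_pos hθ)
      (two_mul_lt_lift_sub hθ (two_mul_quarterGap_lt hθ) (h.left_lt_right r)) ht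
  have hpoint : ∀ (i : Fin n) (r : Fin m), ∃ f : (Fin n → ℝ) × ℝ → ℂ,
      ContinuousOn f (chamber n ×ˢ univ) ∧ ∀ x ∈ chamber n ×ˢ univ, Complex.exp (f x)
        = Complex.sin ((linkContour (left r) (right r) (quarterGap x.1) x.1
            (projIcc 0 8 h08 x.2) - x.1 i) / 2) := fun i r =>
    exists_continuousOn_log ((convex_chamber n).prod convex_univ)
      ((isOpen_chamber n).prod isOpen_univ)
      (Complex.continuous_sin.comp_continuousOn (((continuousOn_linkContour_projIcc
        (h.left_lt_right r) continuous_fst continuous_snd fun z hz => hz.1).sub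
        (by fun_prop)).div_const 2))
      fun x hx => (hon r x.1 hx.1 _ (projIcc 0 8 h08 x.2).2).sin_half_sub_point_ne_zero hx.1
        (quarterGap_pos hx.1) (two_mul_quarterGap_lt hx.1) i
  -- The condition r < s stays behind the existential quantifier, so that the choice of branches is
  -- a total function of r and s.
  have hpair : ∀ r s : Fin m, ∃ f : (Fin n → ℝ) × ℝ × ℝ → ℂ, r < s →
      ContinuousOn f (chamber n ×ˢ univ) ∧ ∀ x ∈ chamber n ×ˢ univ, Complex.exp (f x)
        = Complex.sin ((linkContour (left s) (right s) (quarterGap x.1) x.1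
            (projIcc 0 8 h08 x.2.2) - linkContour (left r) (right r) (quarterGap x.1) x.1
            (projIcc 0 8 h08 x.2.1)) / 2) := fun r s => by
    by_cases hrs : r < s
    · obtain ⟨f, hf⟩ := exists_continuousOn_log ((convex_chamber n).prod convex_univ)
        ((isOpen_chamber n).prod isOpen_univ)
        (Complex.continuous_sin.comp_continuousOn (((continuousOn_linkContour_projIcc
          (h.left_lt_right s) continuous_fst (continuous_snd.comp continuous_snd)
          fun z hz => hz.1).sub (continuousOn_linkContour_projIcc
          (h.left_lt_right r) continuous_fst (continuous_fst.comp continuous_snd)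
          fun z hz => hz.1)).div_const 2))
        fun x hx => OnContour.sin_half_sub_ne_zero h hx.1 (quarterGap_pos hx.1)
          (two_mul_quarterGap_lt hx.1) hrs.ne (hon r x.1 hx.1 _ (projIcc 0 8 h08 x.2.1).2)
          (hon s x.1 hx.1 _ (projIcc 0 8 h08 x.2.2).2)
      exact ⟨f, fun _ => hf⟩
    · exact ⟨0, fun hlt => absurd hlt hrs⟩
  choose f hf hfe using hpoint
  choose g hg using hpair
  exact ⟨{
    δ := quarterGap
    δ_continuous := continuous_quarterGap.continuousOn
    δ_pos := fun θ hθ => quarterGap_pos hθ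
    δ_lt := fun θ hθ => two_mul_quarterGap_lt hθ
    logPoint := fun i r θ t => f i r (θ, t)
    logPoint_continuous := fun i r => (hf i r).mono (prod_mono_right (subset_univ _))
    exp_logPoint := fun i r θ hθ t ht => by
      rw [hfe i r (θ, t) ⟨hθ, mem_univ _⟩, projIcc_of_mem h08 ht]
    logPair := fun r s θ t u => g r s (θ, t, u)
    logPair_continuous := fun r s hrs => (hg r s hrs).1.mono (prod_mono_right (subset_univ _))
    exp_logPair := fun r s hrs θ hθ t ht u hu => by
      rw [(hg r s hrs).2 (θ, t, u) ⟨hθ, mem_univ _⟩, projIcc_of_mem h08 ht,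
        projIcc_of_mem h08 hu] }⟩

end RadialCoulomb
end

noncomputable section

namespace RadialCoulomb

/-! ### The four families of solutions -/

section families

variable {n m : ℕ} [NeZero n] {left right : Fin m → ℤ} (D : Determination (n := n) left right)
  {κ : ℝ}

theorem groundSolution_eq (h : Determination.ShortLinks n left right) {θ : Fin n → ℝ}
    (hθ : θ ∈ chamber n) : groundSolution D κ θ = (D.toLiftedFamily h).integral
      (uniformCharge n m κ) (spinFactor (uniformCharge n m κ) 0) θ :=
  D.integral_eq h _ _ (fun θ ζ => by simp [spinFactor]) hθ

theorem solves_groundSolution (h : Determination.ShortLinks n left right) (hκ : 0 < κ) :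
    SolvesNullVector κ ((1 - ((n : ℝ) - 2 * m) ^ 2) / (2 * κ)) (groundSolution D κ) ∧
      SolvesRotation 0 (groundSolution D κ) := by
  refine ⟨(D.toLiftedFamily h).solvesNullVector_spin hκ (μ := 0) ?_
    fun θ hθ => groundSolution_eq D h hθ, (D.toLiftedFamily h).solvesRotation_spin (μ := 0) ?_
    fun θ hθ => groundSolution_eq D h hθ⟩
  · rw [chargeA_sq hκ]
    field_simp
    ring
  · ring

/-- The spin corresponds to μ = ηa/2: charge a then gives the exponent ηa²/2 and charge -2a the
exponent -ηa². -/
theorem spinSolution_eq (h : Determination.ShortLinks n left right) (η : ℝ) {θ : Fin n → ℝ}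
    (hθ : θ ∈ chamber n) : spinSolution D κ η θ = (D.toLiftedFamily h).integral
      (uniformCharge n m κ) (spinFactor (uniformCharge n m κ) (η * chargeA κ / 2)) θ := by
  refine D.integral_eq h _ _ (fun θ ζ => ?_) hθ
  rw [spinFactor, ← Complex.exp_sum, ← Complex.exp_sum, ← Complex.exp_add, Fintype.sum_sum_type]
  congr 2
  · refine Finset.sum_congr rfl fun i _ => ?_
    simp only [uniformCharge, Sum.elim_inl]
    push_cast
    ring
  · refine Finset.sum_congr rfl fun r _ => ?_
    simp only [uniformCharge, Sum.elim_inr]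
    push_cast
    ring

theorem solves_spinSolution (h : Determination.ShortLinks n left right) (hκ : 0 < κ) (η : ℝ) :
    SolvesNullVector κ (-((n : ℝ) - 2 * m) ^ 2 / (2 * κ) + (1 + η ^ 2) / (2 * κ))
      (spinSolution D κ η) ∧
    SolvesRotation (η * ((n : ℝ) - 2 * m) / κ) (spinSolution D κ η) := by
  refine ⟨(D.toLiftedFamily h).solvesNullVector_spin hκ (μ := η * chargeA κ / 2) ?_
    fun θ hθ => spinSolution_eq D h η hθ,
    (D.toLiftedFamily h).solvesRotation_spin (μ := η * chargeA κ / 2) ?_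
    fun θ hθ => spinSolution_eq D h η hθ⟩
  · rw [div_pow, mul_pow, chargeA_sq hκ]
    field_simp
    ring
  · have e : η * chargeA κ / 2 * (chargeA κ * ((n : ℝ) - 2 * m))
        = η * chargeA κ ^ 2 / 2 * ((n : ℝ) - 2 * m) := by ring
    rw [e, chargeA_sq hκ]
    field_simp

theorem solves_excitedSolution (h : Determination.ShortLinks n left right) (hκ : 0 < κ)
    (hn : Even n) {A : ℂ} (hA : Real.pi ≤ A.im) :
    SolvesNullVector κ ((1 - ((n : ℝ) - 2 * m + κ / 2) ^ 2) / (2 * κ)) (excitedSolution D κ A) ∧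
      SolvesRotation 0 (excitedSolution D κ A) := by
  have e : ∀ θ ∈ chamber n, excitedSolution D κ A θ = (D.toLiftedFamily h).integral
      (uniformCharge n m κ) (excitedIntegral A) θ := fun θ hθ =>
    D.integral_eq h _ _ (fun θ ζ => by simp [excitedIntegral, excitedFactor]) hθ
  exact ⟨(D.toLiftedFamily h).solvesNullVector_excited hκ hn hA e,
    (D.toLiftedFamily h).solvesRotation_excited hκ hn hA e⟩

theorem solves_chordalSolution (h : Determination.ShortLinks n left right) (hκ : 0 < κ)
    (hn : n = 2 * (m + 1)) (c : Fin n) :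
    SolvesNullVector κ ((6 - κ) * (κ - 2) / (8 * κ)) (chordalSolution D κ c) ∧
      SolvesRotation 0 (chordalSolution D κ c) := by
  have e : ∀ θ ∈ chamber n, chordalSolution D κ c θ = (D.toLiftedFamily h).integral
      (chordalWeight m κ c) (fun _ => 1) θ := fun θ hθ =>
    D.integral_eq h _ _ (g := fun _ _ => 1) (G := fun _ => 1) (fun _ _ => rfl) hθ
  exact ⟨(D.toLiftedFamily h).solvesNullVector_chordal hκ hn c e,
    (D.toLiftedFamily h).solvesRotation_chordal c e⟩

end families

end RadialCoulomb
end

theorem mainTheorem2 (κ : ℝ) (hκ : 0 < κ) :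
    -- radial ground solutions
    (∀ (n m : ℕ) [NeZero n], 1 ≤ m → 2 * m ≤ n →
      ∀ α : RadialCoulomb.RadialLinkPattern n m,
        Nonempty (RadialCoulomb.Determination (n := n) α.left α.right) ∧
        ∀ D : RadialCoulomb.Determination (n := n) α.left α.right,
          RadialCoulomb.SolvesNullVector κ ((1 - ((n : ℝ) - 2 * m) ^ 2) / (2 * κ))
            (RadialCoulomb.groundSolution D κ) ∧
          RadialCoulomb.SolvesRotation 0 (RadialCoulomb.groundSolution D κ)) ∧
    -- radial excited solutions
    (∀ (n m : ℕ) [NeZero n], 1 ≤ m → 2 * m ≤ n → Even n →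
      ∀ α : RadialCoulomb.RadialLinkPattern n m,
        Nonempty (RadialCoulomb.Determination (n := n) α.left α.right) ∧
        ∀ D : RadialCoulomb.Determination (n := n) α.left α.right,
        ∀ A : ℂ, Real.pi ≤ A.im →
          RadialCoulomb.SolvesNullVector κ ((1 - ((n : ℝ) - 2 * m + κ / 2) ^ 2) / (2 * κ))
            (RadialCoulomb.excitedSolution D κ A) ∧
          RadialCoulomb.SolvesRotation 0 (RadialCoulomb.excitedSolution D κ A)) ∧
    -- radial ground solutions with spin
    (∀ (n m : ℕ) [NeZero n], 1 ≤ m → 2 * m ≤ n →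
      ∀ α : RadialCoulomb.RadialLinkPattern n m,
        Nonempty (RadialCoulomb.Determination (n := n) α.left α.right) ∧
        ∀ D : RadialCoulomb.Determination (n := n) α.left α.right, ∀ η : ℝ,
          RadialCoulomb.SolvesNullVector κ
            (-((n : ℝ) - 2 * m) ^ 2 / (2 * κ) + (1 + η ^ 2) / (2 * κ))
            (RadialCoulomb.spinSolution D κ η) ∧
          RadialCoulomb.SolvesRotation (η * ((n : ℝ) - 2 * m) / κ)
            (RadialCoulomb.spinSolution D κ η)) ∧
    -- chordal-type solutions: `n = 2k` points, `k` links, the link `r₀` ends at the point `c`, and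
    -- the `k - 1 = m` other links carry the contours
    (∀ (n m : ℕ) [NeZero n], n = 2 * (m + 1) →
      ∀ (α : RadialCoulomb.RadialLinkPattern n (m + 1)) (c : Fin n) (r₀ : Fin (m + 1)),
        ((c : ℤ) ≡ α.left r₀ [ZMOD n] ∨ (c : ℤ) ≡ α.right r₀ [ZMOD n]) →
        Nonempty (RadialCoulomb.Determination (n := n)
          (α.left ∘ r₀.succAbove) (α.right ∘ r₀.succAbove)) ∧
        ∀ D : RadialCoulomb.Determination (n := n)
            (α.left ∘ r₀.succAbove) (α.right ∘ r₀.succAbove),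
          RadialCoulomb.SolvesNullVector κ ((6 - κ) * (κ - 2) / (8 * κ))
            (RadialCoulomb.chordalSolution D κ c) ∧
          RadialCoulomb.SolvesRotation 0 (RadialCoulomb.chordalSolution D κ c)) := by
  refine ⟨?_, ?_, ?_, ?_⟩
  · intro n m _ _ _ α
    exact ⟨α.linkSystem.nonempty_determination, fun D =>
      RadialCoulomb.solves_groundSolution D α.linkSystem.shortLinks hκ⟩
  · intro n m _ _ _ hn α
    exact ⟨α.linkSystem.nonempty_determination, fun D A hA =>
      RadialCoulomb.solves_excitedSolution D α.linkSystem.shortLinks hκ hn hA⟩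
  · intro n m _ _ _ α
    exact ⟨α.linkSystem.nonempty_determination, fun D η =>
      RadialCoulomb.solves_spinSolution D α.linkSystem.shortLinks hκ η⟩
  · intro n m _ hn α c r₀ _
    have hL := α.linkSystem.comp r₀.succAbove_right_injective
    exact ⟨hL.nonempty_determination, fun D =>
      RadialCoulomb.solves_chordalSolution D hL.shortLinks hκ hn c⟩
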